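/- Conventions. $E[1]$ denotes the nerve of the groupoid freely generated by an isomorphism $0\to 1$. An $E[1]$-homotopy between simplicial maps $f,g\colon K\to L$ is a map $K\times E[1]\to L$ restricting to $f$ and $g$ over the two vertices of $E[1]$; $f$ and $g$ are $E[1]$-homotopic if they are connected by a zig-zag of $E[1]$-homotopies. A map of quasicategories is a categorical equivalence if it has an inverse up to $E[1]$-homotopy. A simplicial map is an inner isofibration if it has the right lifting property with respect to all inner horn inclusions and to $\{0\}\hookrightarrow E[1]$. For a simplicial set $K$ put $K^{\triangleright}=K\star\Delta[0]$. A cone $S\colon K^{\triangleright}\to\mathcal C$ in a quasicategory is universal (a colimit of $S|K$) if for every $m>0$ each map $U\colon K\star\partial\Delta[m]\to\mathcal C$ with $U|(K\star\{0\})=S$ extends to $K\star\Delta[m]$. A quasicategory is finitely cocomplete if every diagram in it indexed by a finite simplicial set has a colimit; a simplicial map between finitely cocomplete quasicategories is exact if it sends universal cones under finite diagrams to universal cones. A fibration category is a category with two subcategories, of weak equivalences and of fibrations, such that: weak equivalences satisfy the 2-out-of-6 property; every isomorphism is an acyclic fibration (i.e. both a weak equivalence and a fibration); a terminal object exists and every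 map to it is a fibration; pullbacks of fibrations along arbitrary morphisms exist, and fibrations and acyclic fibrations are stable under pullback; every morphism factors as a weak equivalence followed by a fibration. Theorem. (1) The category of small finitely cocomplete quasicategories and exact maps, with categorical equivalences as weak equivalences and (exact) inner isofibrations as fibrations, is a fibration category. (2) Let $F\colon\mathcal C\to\mathcal D$ and $P\colon\mathcal E\to\mathcal D$ be exact maps of small finitely cocomplete quasicategories with $P$ an inner isofibration, and let $\mathcal R=\mathcal C\times_{\mathcal D}\mathcal E$ be their pullback in simplicial sets, with projections $Q\colon\mathcal R\to\mathcal C$ and $G\colon\mathcal R\to\mathcal E$. Then $\mathcal R$ is a finitely cocomplete quasicategory, $Q$ and $G$ are exact, and the square is also a pullback in the category of finitely cocomplete quasicategories and exact maps. Moreover, for $K$ finite, a cone $S\colon K^{\triangleright}\to\mathcal R$ is universal if and only if both $QS$ and $GS$ are universal. (3) Let $P\colon\mathcal C\to\mathcal D$ be an inner isofibration of small quasicategories, $X\colon K\to\mathcal C$ a diagram indexed by a small simplicial set, and $T\colon K^{\triangleright}\to\mathcal D$ a colimit of $PX$. If $X$ has a colimit $S'$ in $\mathcal C$ such that $PS'$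 is universal, then $X$ has a colimit $S$ with $PS=T$. -/

import Mathlib

open CategoryTheory Limits MonoidalCategory CartesianMonoidalCategory Simplicial Opposite

universe u v w

/-! ### Fibration categories -/

/-- A category with classes `W` (weak equivalences) and `Fib` (fibrations) is a *fibration
category*: the dual of a cofibration category, with all objects fibrant and with the
"2 out of 6" property for weak equivalences. -/
structure IsFibrationCategory (C : Type w) [Category.{v} C] (W Fib : MorphismProperty C) :
    Prop where
  /-- weak equivalences form a subcategory -/
  weq_multiplicative : W.IsMultiplicative
  /-- fibrations form a subcategory -/
  fib_multiplicative : Fib.IsMultiplicative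
  /-- the "2 out of 6" property -/
  two_out_of_six : ∀ {X Y Z T : C} (f : X ⟶ Y) (g : Y ⟶ Z) (h : Z ⟶ T),
    W (f ≫ g) → W (g ≫ h) → W f ∧ W g ∧ W h
  /-- isomorphisms are acyclic fibrations -/
  iso_acyclic : ∀ {X Y : C} (f : X ⟶ Y), IsIso f → W f ∧ Fib f
  hasTerminal : HasTerminal C
  /-- every object is fibrant -/
  fibrant : ∀ {X T : C}, IsTerminal T → ∀ f : X ⟶ T, Fib f
  /-- pullbacks of fibrations along arbitrary morphisms exist -/
  hasPullback : ∀ {X Y Z : C} (f : X ⟶ Z) (p : Y ⟶ Z), Fib p → HasPullback f p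
  /-- fibrations are stable under pullbacks -/
  fib_baseChange : Fib.IsStableUnderBaseChange
  /-- acyclic fibrations are stable under pullbacks -/
  acyclicFib_baseChange : (W ⊓ Fib).IsStableUnderBaseChange
  /-- every morphism is a weak equivalence followed by a fibration -/
  factorization : ∀ {X Y : C} (f : X ⟶ Y), ∃ (Z : C) (j : X ⟶ Z) (p : Z ⟶ Y),
    W j ∧ Fib p ∧ j ≫ p = f

namespace SSet

/-! ### Homotopies parametrized by the walking isomorphism, inner isofibrations -/

/-- There is a homotopy `K × E[1] ⟶ L` from `f` to `g`, where `E[1] = coherentIso` is the nerve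
of the groupoid freely generated by an isomorphism `0 ⟶ 1`. -/
def IsoHomotopy {K L : SSet.{u}} (f g : K ⟶ L) : Prop :=
  ∃ H : K ⊗ coherentIso.{u} ⟶ L,
    lift (𝟙 K) (const coherentIso.x₀) ≫ H = f ∧ lift (𝟙 K) (const coherentIso.x₁) ≫ H = g

/-- Two simplicial maps are `E[1]`-homotopic if they are connected by a zig-zag of
`E[1]`-homotopies. -/
def IsoHomotopic {K L : SSet.{u}} (f g : K ⟶ L) : Prop :=
  Relation.EqvGen (fun a b : K ⟶ L => IsoHomotopy a b) f g

/-- `E[1]`-homotopy equivalences; between quasicategories these are called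
*categorical equivalences*. -/
def IsCategoricalEquivalence {K L : SSet.{u}} (f : K ⟶ L) : Prop :=
  ∃ g : L ⟶ K, IsoHomotopic (g ≫ f) (𝟙 L) ∧ IsoHomotopic (f ≫ g) (𝟙 K)

/-- The vertex inclusion `Δ[0] ⟶ E[1]` at `0`. -/
def coherentIsoZero : (Δ[0] : SSet.{u}) ⟶ coherentIso.{u} := const coherentIso.x₀

/-- Inner isofibrations: inner fibrations with the right lifting property with respect to
`Δ[0] ⟶ E[1]`. -/
def IsInnerIsofibration {K L : SSet.{u}} (p : K ⟶ L) : Prop :=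
  innerFibrations p ∧ HasLiftingProperty coherentIsoZero.{u} p

/-! ### Joins -/

/-- The part of `T` lying over the vertex `e` of `Δ[1]`, for a map `c : T ⟶ Δ[1]`. -/
def cutFiber {T : SSet.{u}} (c : T ⟶ Δ[1]) (e : Fin 2) : T.Subcomplex :=
  (stdSimplex.face {e}).preimage c

/-- The map `cutFiber (f ≫ c) e ⟶ cutFiber c e` induced by `f : S ⟶ T`. -/
def cutFiberMap {S T : SSet.{u}} (f : S ⟶ T) (c : T ⟶ Δ[1]) (e : Fin 2) :
    (cutFiber (f ≫ c) e : SSet.{u}) ⟶ (cutFiber c e : SSet.{u}) :=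
  (cutFiber c e).fromPreimage f

/-- The data of a map from `T` to the join of `K` and `L`: a decomposition of the vertices of `T`
into an initial and a terminal part, given by a map `T ⟶ Δ[1]`, with a map to `K` on the
initial part and a map to `L` on the terminal part. For `T = Δ[n]` the two parts are faces
`Δ[i]` and `Δ[j]` with `i + 1 + j = n` and `i, j ≥ -1`, where a map out of `Δ[-1] = ∅` is no
data at all; so this is an element of the disjoint union of the products `K_i × L_j` with
`K_{-1}` and `L_{-1}` singletons, i.e. an `n`-simplex of the join. -/
structure JoinSimplex (K L T : SSet.{u}) : Type u where
  cut : T ⟶ Δ[1]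
  left : (cutFiber cut 0 : SSet.{u}) ⟶ K
  right : (cutFiber cut 1 : SSet.{u}) ⟶ L

namespace JoinSimplex

variable {K L K' L' : SSet.{u}}

lemma ext' {T : SSet.{u}} {x y : JoinSimplex K L T} (h : x.cut = y.cut)
    (hl : ∀ (m : SimplexCategoryᵒᵖ) (z : T.obj m) (hx : z ∈ (cutFiber x.cut 0).obj m)
      (hy : z ∈ (cutFiber y.cut 0).obj m), x.left.app m ⟨z, hx⟩ = y.left.app m ⟨z, hy⟩)
    (hr : ∀ (m : SimplexCategoryᵒᵖ) (z : T.obj m) (hx : z ∈ (cutFiber x.cut 1).obj m)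
      (hy : z ∈ (cutFiber y.cut 1).obj m), x.right.app m ⟨z, hx⟩ = y.right.app m ⟨z, hy⟩) :
    x = y := by
  obtain ⟨c, l, r⟩ := x
  obtain ⟨c', l', r'⟩ := y
  obtain rfl : c = c' := h
  have h1 : l = l' := by
    ext m ⟨z, hz⟩
    exact hl m z hz hz
  have h2 : r = r' := by
    ext m ⟨z, hz⟩
    exact hr m z hz hz
  rw [h1, h2]

/-- Restriction along `f : S ⟶ T`. -/
def restrict {S T : SSet.{u}} (f : S ⟶ T) (x : JoinSimplex K L T) : JoinSimplex K L S where
  cut := f ≫ x.cut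
  left := cutFiberMap f x.cut 0 ≫ x.left
  right := cutFiberMap f x.cut 1 ≫ x.right

lemma restrict_id {T : SSet.{u}} (x : JoinSimplex K L T) : x.restrict (𝟙 T) = x := rfl

lemma restrict_comp {S T U : SSet.{u}} (f : S ⟶ T) (g : T ⟶ U) (x : JoinSimplex K L U) :
    x.restrict (f ≫ g) = (x.restrict g).restrict f := rfl

/-- Functoriality in the two simplicial sets. -/
def map {T : SSet.{u}} (f : K ⟶ K') (g : L ⟶ L') (x : JoinSimplex K L T) :
    JoinSimplex K' L' T where
  cut := x.cut
  left := x.left ≫ f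
  right := x.right ≫ g

/-- A `T`-simplex of `K`, as a `T`-simplex of the join whose terminal part is empty. -/
def inl {T : SSet.{u}} (x : T ⟶ K) : JoinSimplex K L T where
  cut := const (stdSimplex.obj₀Equiv.symm 0)
  left := Subcomplex.ι _ ≫ x
  right := (isInitialOfNotNonempty (by
    rw [not_nonempty_iff]
    refine ⟨?_⟩
    rintro ⟨z, hz⟩
    have h : (0 : Fin 2) ∈ ({1} : Finset (Fin 2)) :=
      (stdSimplex.mem_face_iff.{u} {1} _).1 hz 0
    simp at h)).to L

lemma restrict_inl {S T : SSet.{u}} (f : S ⟶ T) (x : T ⟶ K) :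
    (inl x : JoinSimplex K L T).restrict f = inl (f ≫ x) := by
  refine ext' rfl (fun _ _ _ _ => rfl) (fun m z _ hy => ?_)
  obtain ⟨m⟩ := m
  have h : (0 : Fin 2) ∈ ({1} : Finset (Fin 2)) :=
    (stdSimplex.mem_face_iff.{u} (d := m.len) {1} _).1 hy 0
  simp at h

end JoinSimplex

/-- The presheaf `T ↦ JoinSimplex K L T` on simplicial sets. -/
def joinPresheaf (K L : SSet.{u}) : SSet.{u}ᵒᵖ ⥤ Type u where
  obj T := JoinSimplex K L T.unop
  map f := ↾(JoinSimplex.restrict f.unop)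
  map_id _ := rfl
  map_comp _ _ := rfl

/-- Functoriality of `joinPresheaf`. -/
def joinPresheafMap {K K' L L' : SSet.{u}} (f : K ⟶ K') (g : L ⟶ L') :
    joinPresheaf K L ⟶ joinPresheaf K' L' where
  app T := ↾(JoinSimplex.map (T := T.unop) f g)
  naturality _ _ _ := rfl

/-- The join `K ⋆ L` of simplicial sets. -/
def join (K L : SSet.{u}) : SSet.{u} :=
  stdSimplex.{u}.op ⋙ joinPresheaf K L

/-- The `n`-simplices of the join. -/
def joinEquiv (K L : SSet.{u}) (n : SimplexCategory) :
    JoinSimplex K L (stdSimplex.{u}.obj n) ≃ (join K L).obj (op n) :=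
  Equiv.refl _

/-- Functoriality of the join. -/
def joinMap {K K' L L' : SSet.{u}} (f : K ⟶ K') (g : L ⟶ L') : join K L ⟶ join K' L' :=
  Functor.whiskerLeft stdSimplex.{u}.op (joinPresheafMap f g)

/-- The inclusion of `K` into `K ⋆ L`. -/
def joinInl (K L : SSet.{u}) : K ⟶ join K L where
  app n := ↾fun x => joinEquiv K L n.unop (JoinSimplex.inl (yonedaEquiv.symm x))
  naturality m n f := by
    ext x
    change JoinSimplex.inl (yonedaEquiv.symm (K.map f x)) =
      (JoinSimplex.inl (yonedaEquiv.symm x)).restrict (stdSimplex.{u}.map f.unop)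
    rw [JoinSimplex.restrict_inl]
    exact congrArg JoinSimplex.inl (yonedaEquiv_symm_naturality_left f.unop x).symm

/-! ### Colimits in quasicategories -/

/-- The cone `K ⋆ Δ[0]`. -/
abbrev underCone (K : SSet.{u}) : SSet.{u} := join K Δ[0]

/-- The inclusion of `K` into its cone; `S : underCone K ⟶ C` is a cone under `X : K ⟶ C` if
`coneBase K ≫ S = X`. -/
abbrev coneBase (K : SSet.{u}) : K ⟶ underCone K := joinInl K Δ[0]

/-- The vertex `0` of the boundary of `Δ[m + 1]`. -/
def boundaryZero (m : ℕ) : (Δ[0] : SSet.{u}) ⟶ (∂Δ[m + 1] : SSet.{u}) :=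
  Subcomplex.lift (const (stdSimplex.obj₀Equiv.symm 0)) (by
    rintro ⟨n⟩ _ ⟨x, rfl⟩ h
    obtain ⟨i, hi⟩ := h 1
    exact absurd hi (Fin.succ_ne_zero 0).symm)

/-- A cone `S` is *universal* (a colimit of its restriction to `K`) if for all `m > 0` every map
`U : K ⋆ ∂Δ[m] ⟶ C` whose restriction to `K ⋆ {0}` is `S` extends to `K ⋆ Δ[m]`. -/
def IsUniversalCone {K C : SSet.{u}} (S : underCone K ⟶ C) : Prop :=
  ∀ (m : ℕ) (U : join K (∂Δ[m + 1] : SSet.{u}) ⟶ C),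
    joinMap (𝟙 K) (boundaryZero m) ≫ U = S →
      ∃ V : join K Δ[m + 1] ⟶ C, joinMap (𝟙 K) (∂Δ[m + 1]).ι ≫ V = U

/-- Every diagram indexed by a finite simplicial set has a colimit. -/
def IsFinitelyCocomplete (C : SSet.{u}) : Prop :=
  ∀ (K : SSet.{u}), K.Finite → ∀ X : K ⟶ C,
    ∃ S : underCone K ⟶ C, coneBase K ≫ S = X ∧ IsUniversalCone S

/-- Exact maps: those preserving universal cones under finite diagrams. -/
def IsExact {C D : SSet.{u}} (F : C ⟶ D) : Prop :=
  ∀ (K : SSet.{u}), K.Finite → ∀ S : underCone K ⟶ C,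
    IsUniversalCone S → IsUniversalCone (S ≫ F)

lemma isExact_id (C : SSet.{u}) : IsExact (𝟙 C) := by
  intro K _ S hS
  simpa using hS

lemma IsExact.comp {C D E : SSet.{u}} {F : C ⟶ D} {G : D ⟶ E} (hF : IsExact F)
    (hG : IsExact G) : IsExact (F ≫ G) := by
  intro K hK S hS
  simpa using hG K hK _ (hF K hK S hS)

end SSet

/-! ### The category of finitely cocomplete quasicategories -/

/-- Small finitely cocomplete quasicategories. -/
structure FCQCat : Type (u + 1) where
  toSSet : SSet.{u}
  quasicategory : SSet.Quasicategory toSSet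
  finitelyCocomplete : SSet.IsFinitelyCocomplete toSSet

namespace FCQCat

/-- Morphisms of finitely cocomplete quasicategories are the exact simplicial maps. -/
@[ext]
structure Hom (C D : FCQCat.{u}) : Type u where
  map : C.toSSet ⟶ D.toSSet
  exact : SSet.IsExact map

instance : Category FCQCat.{u} where
  Hom := Hom
  id C := ⟨𝟙 C.toSSet, SSet.isExact_id _⟩
  comp F G := ⟨F.map ≫ G.map, F.exact.comp G.exact⟩

/-- An exact simplicial map, as a morphism of finitely cocomplete quasicategories. -/
def ofMap {C D : FCQCat.{u}} (F : C.toSSet ⟶ D.toSSet) (hF : SSet.IsExact F) : C ⟶ D :=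
  Hom.mk F hF

/-- The simplicial map underlying a morphism. -/
def mapOf {C D : FCQCat.{u}} (F : C ⟶ D) : C.toSSet ⟶ D.toSSet :=
  Hom.map F

/-- The categorical equivalences between finitely cocomplete quasicategories. -/
def weakEquivalences : MorphismProperty FCQCat.{u} :=
  fun _ _ F => SSet.IsCategoricalEquivalence (mapOf F)

/-- The (exact) inner isofibrations between finitely cocomplete quasicategories. -/
def fibrations : MorphismProperty FCQCat.{u} :=
  fun _ _ F => SSet.IsInnerIsofibration (mapOf F)

end FCQCat

/-! Two lifting principles carry the theorem. First, an inner isofibration lifts E[1]-homotopies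
relative to any monomorphism. By adjunction only ∂Δ[n] × E[1] ∪ Δ[n] × {0} ⊂ Δ[n] × E[1] matters.
For n > 0 this inclusion is inner anodyne
(`stdSimplexProdCoherentIso.innerAnodyneExtensions_union_ι`): the nondegenerate simplices outside
the subcomplex are words of pairs (vertex of Δ[n], label in E[1]), matched in couples that differ by
one inner letter, the pivot. For n = 0 it is {0} ⊂ E[1], the extra condition in the definition of an
inner isofibration.

Second, a pairing of the simplices of B outside A induces one for K ⋆ A ∪ B ⊂ K ⋆ B, whose indices
are shifted by the vertices of a simplex of K and so are never 0. Thus even {0} ⊂ E[1] becomes inner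
after joining, and an inner isofibration induces inner isofibrations of slices
(`IsInnerIsofibration.sliceMap`).

A universal cone is an initial vertex of the slice under its diagram. Initial vertices span a
contractible full subcomplex, and initiality travels along maps from E[1] into a quasicategory. So
two colimits of one diagram are joined by such a map, and lifting it along the map of slices gives
(3). For (2), a colimit in 𝓔 is corrected by (3) until it lies over the image of a colimit in 𝓒.
Componentwise universality suffices because boundary fillings at a universal cone with universal
image can be prescribed in the base (`IsUniversalCone.exists_lift`). The projections are exact since
a functor that preserves one colimit of a diagram preserves all of them
(`IsUniversalCone.comp_of_comp`).

For (1), weak equivalences are the maps inverted in a quotient category, so 2-out-of-6 is formal. An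
acyclic fibration has a section and a deformation over its base
(`IsInnerIsofibration.isShrinkable`), and such data pull back. Factorizations come from the path
object: evaluation at one end lifts against all monomorphisms, hence reflects and preserves
colimits, while evaluation at both ends is an inner isofibration. -/

/-! ### Words in `ℕ × Bool` -/

namespace PivotWord

/-- The word `f` with the letter at position `k` removed. -/
def del {α : Type*} (k : ℕ) (f : ℕ → α) (i : ℕ) : α := if i < k then f i else f (i + 1)

/-- The word `f` with a letter `v` inserted at position `k`. -/
def ins {α : Type*} (k : ℕ) (v : α) (f : ℕ → α) (i : ℕ) : α :=
  if i < k then f i else if i = k then v else f (i - 1)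

/-- The words `(a 0, b 0), …, (a m, b m)` which correspond to the nondegenerate `m`-simplices of
`Δ[n] × E[1]` which do not belong to `∂Δ[n] × E[1] ∪ Δ[n] × {0}`. -/
structure Good (n m : ℕ) (a : ℕ → ℕ) (b : ℕ → Bool) : Prop where
  mono : ∀ i j, i ≤ j → j ≤ m → a i ≤ a j
  surj : ∀ v ≤ n, ∃ i ≤ m, a i = v
  exists_true : ∃ i ≤ m, b i = true
  ne : ∀ i < m, a i = a (i + 1) → b i ≠ b (i + 1)

/-- The first kind of pivots: the last letter of the initial block of a word with a letter
`(0, true)`. -/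
structure IsPivot₁ (m : ℕ) (a : ℕ → ℕ) (b : ℕ → Bool) (k : ℕ) : Prop where
  le : k ≤ m
  fst : a k = 0
  snd : b k = false
  exists_lt : ∃ i < k, a i = 0 ∧ b i = true
  ne_zero : ∀ i, k < i → i ≤ m → a i ≠ 0

/-- The second kind of pivots: the letter which precedes the first letter of the form
`(_, true)` in a word without the letter `(0, true)`, if it has the same first component. -/
structure IsPivot₂ (m : ℕ) (a : ℕ → ℕ) (b : ℕ → Bool) (k : ℕ) : Prop where
  lt : k < m
  ne : ∀ i ≤ m, a i = 0 → b i = false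
  snd : ∀ i ≤ k, b i = false
  fst_succ : a (k + 1) = a k
  snd_succ : b (k + 1) = true

/-- Pivots of a word. -/
def IsPivot (m : ℕ) (a : ℕ → ℕ) (b : ℕ → Bool) (k : ℕ) : Prop :=
  IsPivot₁ m a b k ∨ IsPivot₂ m a b k

variable {n m : ℕ} {a a' : ℕ → ℕ} {b b' : ℕ → Bool} {k k' : ℕ}

/-- A letter (0, true) is present for the first kind and absent for the second, so the kinds never
mix. Within a kind, the end of the zero block, respectively the first true letter, fixes the
position. -/
lemma IsPivot.unique (h : IsPivot m a b k) (h' : IsPivot m a b k') : k = k' := by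
  rcases h with h | h <;> rcases h' with h' | h'
  · have h1 := h.ne_zero k'
    have h2 := h'.ne_zero k
    have := h.fst; have := h'.fst; have := h.le; have := h'.le
    grind
  · obtain ⟨i, hi, h1, h2⟩ := h.exists_lt
    have := h'.ne i (by have := h.le; lia) h1
    grind
  · obtain ⟨i, hi, h1, h2⟩ := h'.exists_lt
    have := h.ne i (by have := h'.le; lia) h1
    grind
  · have h1 := h.snd (k' + 1)
    have h2 := h'.snd (k + 1)
    have := h.snd_succ; have := h'.snd_succ
    grind

lemma IsPivot.snd (h : IsPivot m a b k) : b k = false := by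
  rcases h with h | h
  · exact h.snd
  · exact h.snd k le_rfl

lemma IsPivot.le (h : IsPivot m a b k) : k ≤ m := by
  rcases h with h | h
  · exact h.le
  · exact h.lt.le

lemma Good.fst_zero (hg : Good n m a b) : a 0 = 0 := by
  obtain ⟨i, hi, h⟩ := hg.surj 0 (by lia)
  have := hg.mono 0 i (by lia) hi
  lia

/-- Together with `IsPivot.lt` this makes the pairing inner. A pivot of the second kind at position
0 would be followed by the forbidden letter (0, true). -/
lemma IsPivot.pos (hg : Good n m a b) (h : IsPivot m a b k) : 0 < k := by
  rcases h with h | h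
  · obtain ⟨i, hi, -⟩ := h.exists_lt
    lia
  · by_contra hk
    obtain rfl : k = 0 := by lia
    have h1 := h.ne 1 h.lt (by have := h.fst_succ; simpa [hg.fst_zero] using this)
    have := h.snd_succ
    simp [h1] at this

lemma IsPivot.lt (hn : 0 < n) (hg : Good n m a b) (h : IsPivot m a b k) : k < m := by
  rcases h with h | h
  · obtain ⟨i, hi, h1⟩ := hg.surj 1 hn
    have := hg.mono i k
    have := h.fst
    have := h.le
    grind
  · exact h.lt

/-- The value a k survives the deletion: it occurs earlier at a letter (0, true) for the first kind,
and at the next letter for the second. -/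
lemma IsPivot.good_del (hn : 0 < n) (hg : Good n (m + 1) a b) (h : IsPivot (m + 1) a b k) :
    Good n m (del k a) (del k b) where
  mono i j hij hj := by
    have h1 := hg.mono i j hij (by lia)
    have h2 := hg.mono i (j + 1) (by lia) (by lia)
    have h3 := hg.mono (i + 1) (j + 1) (by lia) (by lia)
    simp only [del]
    grind
  surj v hv := by
    obtain ⟨i, hi, h1⟩ := hg.surj v hv
    have hk : k < m + 1 := h.lt hn hg
    rcases lt_trichotomy i k with h2 | rfl | h2
    · exact ⟨i, by lia, by simp [del, h2, h1]⟩
    · rcases h with h | h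
      · obtain ⟨j, hj, h3, -⟩ := h.exists_lt
        exact ⟨j, by lia, by simp [del, hj, h3, ← h1, h.fst]⟩
      · exact ⟨i, by lia, by simp [del, h.fst_succ, h1]⟩
    · exact ⟨i - 1, by lia, by simp only [del]; grind⟩
  exists_true := by
    obtain ⟨i, hi, h1⟩ := hg.exists_true
    have := h.snd
    rcases lt_trichotomy i k with h2 | rfl | h2
    · exact ⟨i, by have := h.le; lia, by simp [del, h2, h1]⟩
    · grind
    · exact ⟨i - 1, by lia, by simp only [del]; grind⟩
  ne i hi := by
    have hk := h.pos hg
    have h1 := hg.ne i (by lia)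
    have h2 := hg.ne (i + 1) (by lia)
    -- The two letters that become adjacent differ in the first component for the first kind (the
    -- zero block ends at k), and in the second for the second kind (false, then true).
    have h4 : i + 1 = k → a i = a (i + 2) → b i ≠ b (i + 2) := by
      rintro rfl
      rcases h with h | h
      · have := h.ne_zero (i + 2) (by lia) (by lia)
        have := hg.mono i (i + 1) (by lia) h.le
        have := h.fst
        grind
      · have := h.snd i (by lia)
        have := h.snd_succ
        grind
    simp only [del]
    grind

/-- The shortened word remembers the pivot. For the first kind, k is the length of the remaining
zero block and the lost letter is (0, false). For the second, k is the position of the first true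
letter, whose first component the lost letter repeats. -/
lemma IsPivot.injective_del (hg : Good n (m + 1) a b) (hg' : Good n (m + 1) a' b')
    (h : IsPivot (m + 1) a b k) (h' : IsPivot (m + 1) a' b' k')
    (ha : ∀ i ≤ m, del k a i = del k' a' i) (hb : ∀ i ≤ m, del k b i = del k' b' i) :
    k = k' ∧ ∀ i ≤ m + 1, a i = a' i ∧ b i = b' i := by
  have key : k = k' → a k = a' k' → k = k' ∧ ∀ i ≤ m + 1, a i = a' i ∧ b i = b' i := by
    rintro rfl hk
    refine ⟨rfl, fun i hi => ?_⟩
    have h1 := h.snd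
    have h2 := h'.snd
    have h3 := ha i; have h4 := ha (i - 1); have h5 := hb i; have h6 := hb (i - 1)
    have := h.le
    simp only [del] at h3 h4 h5 h6
    grind
  have aux : ∀ {a a' : ℕ → ℕ} {b b' : ℕ → Bool} {k k' : ℕ}, IsPivot₁ (m + 1) a b k →
      IsPivot₂ (m + 1) a' b' k' → (∀ i ≤ m, del k a i = del k' a' i) →
      (∀ i ≤ m, del k b i = del k' b' i) → False := by
    intro a a' b b' k k' h h' ha hb
    obtain ⟨i, hi, h1, h2⟩ := h.exists_lt
    have h3 := ha i (by have := h.le; lia)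
    have h4 := hb i (by have := h.le; lia)
    have h5 := h'.ne i (by have := h.le; lia)
    have h6 := h'.ne (i + 1) (by have := h.le; lia)
    simp only [del] at h3 h4
    grind
  rcases h with h | h <;> rcases h' with h' | h'
  · have e : k = k' := by
      have h1 := ha k; have h2 := ha k'
      have := h.le; have := h'.le
      have h3 := hg.mono k' k; have h4 := hg'.mono k k'
      have h5 := h.ne_zero (k' + 1); have h6 := h'.ne_zero (k + 1)
      have := h.ne_zero (k + 1); have := h'.ne_zero (k' + 1)
      have := h.fst; have := h'.fst
      simp only [del] at h1 h2
      grind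
    exact key e (by rw [h.fst, h'.fst])
  · exact (aux h h' ha hb).elim
  · exact (aux h' h (fun i hi => (ha i hi).symm) (fun i hi => (hb i hi).symm)).elim
  · have e : k = k' := by
      have h1 := hb k; have h2 := hb k'
      have := h.lt; have := h'.lt
      have h3 := h.snd k'; have h4 := h'.snd k
      have := h.snd_succ; have := h'.snd_succ
      simp only [del] at h1 h2
      grind
    subst e
    refine key rfl ?_
    have h1 := ha k (by have := h.lt; lia)
    simp only [del, lt_self_iff_false, if_false] at h1
    rw [← h.fst_succ, ← h'.fst_succ, h1]

/-- The letter before the pivot differs from it. For the first kind it is therefore (0, true), and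
the shortened zero block ends with a true letter. For the second kind it is false with another first
component, so it no longer matches the first true letter. -/
lemma IsPivot.not_isPivot_del (hg : Good n (m + 1) a b) (h : IsPivot (m + 1) a b k) :
    ¬ IsPivot m (del k a) (del k b) k' := by
  intro h'
  have hk := h.pos hg
  have hne := hg.ne (k - 1) (by have := h.le; lia)
  have hm := hg.mono (k - 1) k (by lia) h.le
  rcases h with h | h <;> rcases h' with h' | h'
  · have h1 := h'.ne_zero (k - 1); have h2 := h'.fst; have h3 := h'.snd
    have := h.fst; have := h.snd; have := h.le; have := h'.le
    have h4 := h.ne_zero (k' + 1)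
    simp only [del] at h1 h2 h3
    grind
  · obtain ⟨i, hi, h1, h2⟩ := h.exists_lt
    have h3 := h'.ne i (by have := h.le; lia)
    simp only [del] at h3
    grind
  · obtain ⟨i, hi, h1, h2⟩ := h'.exists_lt
    have h3 := h.ne i (by have := h'.le; lia)
    have h4 := h.ne (i + 1) (by have := h'.le; lia)
    simp only [del] at h1 h2
    grind
  · have h1 := h'.snd k; have h2 := h'.fst_succ; have h3 := h'.snd_succ
    have h4 := h.snd k'; have h5 := h.snd (k' + 1); have := h.fst_succ; have := h.snd_succ
    have h6 := h.snd (k - 1); have h7 := h.snd k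
    simp only [del] at h1 h2 h3
    grind

/-- Removing another false letter destroys neither the letter (0, true) nor the first true letter,
so the pivot only shifts. The well-foundedness of the pairing rests on this. -/
lemma IsPivot.exists_isPivot_del {j : ℕ} (h : IsPivot (m + 1) a b k) (hj : j ≠ k)
    (hj' : b j = false) (hjm : j ≤ m + 1) :
    ∃ k', IsPivot m (del j a) (del j b) k' := by
  refine ⟨if j < k then k - 1 else k, ?_⟩
  rcases h with h | h
  · left
    refine ⟨?_, ?_, ?_, ?_, ?_⟩
    · have := h.le
      grind
    · have := h.fst
      simp only [del]; grind
    · have := h.snd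
      simp only [del]; grind
    · obtain ⟨i, hi, h1, h2⟩ := h.exists_lt
      refine ⟨if j < i then i - 1 else i, ?_, ?_, ?_⟩
      · grind
      · simp only [del]; grind
      · simp only [del]; grind
    · intro i hi hi'
      have h1 := h.ne_zero i; have h2 := h.ne_zero (i + 1)
      simp only [del]; grind
  · right
    have h2 := h.snd_succ
    have h1 := h.fst_succ
    have := h.lt
    refine ⟨?_, ?_, ?_, ?_, ?_⟩
    · grind
    · intro i hi
      have h1 := h.ne i; have h2 := h.ne (i + 1)
      simp only [del]; grind
    · intro i hi
      have h1 := h.snd i; have h2 := h.snd (i + 1)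
      simp only [del]; grind
    · simp only [del]; grind
    · simp only [del]; grind

lemma del_ins {α : Type*} (k : ℕ) (v : α) (f : ℕ → α) : del k (ins k v f) = f := by
  ext i
  simp only [del, ins]
  grind

lemma Good.exists_isPivot_ins (hn : 0 < n) (hg : Good n m a b)
    (h : ∀ k, ¬ IsPivot m a b k) :
    ∃ k v, k ≤ m + 1 ∧ Good n (m + 1) (ins k v a) (ins k false b) ∧
      IsPivot (m + 1) (ins k v a) (ins k false b) k := by
  -- A false letter may be inserted between two letters if it respects monotonicity and any
  -- neighbour with the same first component is true.
  have key : ∀ k v, 0 < k → k ≤ m → a (k - 1) ≤ v → v ≤ a k →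
      (v = a (k - 1) → b (k - 1) = true) → (v = a k → b k = true) →
      Good n (m + 1) (ins k v a) (ins k false b) := by
    intro k v hk hk' h1 h2 h3 h4
    refine ⟨fun i j hij hj => ?_, fun w hw => ?_, ?_, fun i hi => ?_⟩
    · have h1 := hg.mono i j; have h2 := hg.mono i (j - 1); have h3 := hg.mono (i - 1) (j - 1)
      have h4 := hg.mono i (k - 1); have h5 := hg.mono k (j - 1)
      simp only [ins]; grind
    · obtain ⟨i, hi, hi'⟩ := hg.surj w hw
      refine ⟨if i < k then i else i + 1, by grind, ?_⟩
      simp only [ins]; grind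
    · obtain ⟨i, hi, hi'⟩ := hg.exists_true
      refine ⟨if i < k then i else i + 1, by grind, ?_⟩
      simp only [ins]; grind
    · have h1 := hg.ne i; have h2 := hg.ne (i - 1)
      simp only [ins]; grind
  by_cases h0 : ∃ i ≤ m, a i = 0 ∧ b i = true
  · have h1 : ∃ k, k ≤ m ∧ a k ≠ 0 := by
      obtain ⟨k, hk, hk'⟩ := hg.surj 1 hn
      exact ⟨k, hk, by lia⟩
    classical
    -- The first position after the zero block. The last zero letter is true, since otherwise it
    -- would be a pivot; hence (0, false) can be inserted at k.
    let k := Nat.find h1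
    obtain ⟨hk, hk'⟩ : k ≤ m ∧ a k ≠ 0 := Nat.find_spec h1
    have hmin : ∀ i < k, a i = 0 := fun i hi => by
      have := Nat.find_min h1 hi
      by_contra hi'
      exact this ⟨by lia, hi'⟩
    have hpos : 0 < k := by
      by_contra hpos
      have hk0 : k = 0 := by lia
      exact hk' (hk0 ▸ hg.fst_zero)
    have hge : ∀ i, k ≤ i → i ≤ m → a i ≠ 0 := fun i hi hi' => by
      have := hg.mono k i hi hi'
      lia
    obtain ⟨i, hi, hi0, hi1⟩ := h0
    have hik : i < k := by
      by_contra hik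
      exact hge i (by lia) hi hi0
    have hb : b (k - 1) = true := by
      by_contra hb
      refine h (k - 1) (Or.inl ⟨by lia, hmin _ (by lia), by simpa using hb, ⟨i, ?_, hi0, hi1⟩,
        fun j hj hj' => hge j (by lia) hj'⟩)
      grind
    refine ⟨k, 0, by lia, key k 0 hpos hk (by rw [hmin _ (by lia)]) (by lia) (fun _ => hb)
      (fun h => (hk' h.symm).elim), Or.inl ⟨by lia, by simp [ins], by simp [ins],
      ⟨i, hik, by simp [ins, hik, hi0], by simp [ins, hik, hi1]⟩, fun j hj hj' => ?_⟩⟩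
    have := hge (j - 1)
    simp only [ins]; grind
  · have h0' : ∀ i ≤ m, a i = 0 → b i = false := fun i hi hi' => by
      by_contra hb
      exact h0 ⟨i, hi, hi', by simpa using hb⟩
    have h1 := hg.exists_true
    classical
    -- The position of the first true letter. The preceding letter has another first component,
    -- since otherwise it would be a pivot; hence (a k, false) can be inserted at k.
    let k := Nat.find h1
    obtain ⟨hk, hk'⟩ : k ≤ m ∧ b k = true := Nat.find_spec h1
    have hmin : ∀ i < k, b i = false := fun i hi => by
      have := Nat.find_min h1 hi
      by_contra hi'
      exact this ⟨by lia, by simpa using hi'⟩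
    have hpos : 0 < k := by
      by_contra hpos
      obtain hk0 : k = 0 := by lia
      have := h0' 0 (by lia) hg.fst_zero
      rw [hk0] at hk'
      simp [this] at hk'
    have hak : a (k - 1) ≠ a k := fun hak =>
      h (k - 1) (Or.inr ⟨by lia, h0', fun i hi => hmin i (by lia),
        by rw [Nat.sub_add_cancel hpos, hak], by rwa [Nat.sub_add_cancel hpos]⟩)
    refine ⟨k, a k, by lia, key k (a k) hpos hk (hg.mono _ _ (by lia) hk) le_rfl
      (fun h => (hak h.symm).elim) (fun _ => hk'), Or.inr ⟨by lia, fun i hi => ?_,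
      fun i hi => ?_, by simp [ins], by simp [ins, hk']⟩⟩
    · have h1 := h0' i; have h2 := h0' (i - 1)
      simp only [ins]; grind
    · have h1 := hmin i
      simp only [ins]; grind

end PivotWord

/-! ### Simplicial sets whose simplices are determined by their vertices -/

namespace SSet

section Vertex

variable {X : SSet.{u}} {m : ℕ}

/-- The `i`-th vertex of a simplex. -/
def vertex (x : X _⦋m⦌) (i : Fin (m + 1)) : X _⦋0⦌ :=
  X.map (SimplexCategory.const ⦋0⦌ ⦋m⦌ i).op x

lemma vertex_map {k : ℕ} (f : ⦋k⦌ ⟶ ⦋m⦌) (x : X _⦋m⦌) (i : Fin (k + 1)) :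
    vertex (X.map f.op x) i = vertex x (f i) := by
  simp only [vertex, ← Functor.map_comp_apply, ← op_comp]
  rfl

lemma vertex_δ (x : X _⦋m + 1⦌) (k : Fin (m + 2)) (i : Fin (m + 1)) :
    vertex (X.δ k x) i = vertex x (k.succAbove i) :=
  vertex_map _ _ _

lemma vertex_σ (x : X _⦋m⦌) (k : Fin (m + 1)) (i : Fin (m + 2)) :
    vertex (X.σ k x) i = vertex x (k.predAbove i) :=
  vertex_map _ _ _

lemma vertex_app {Y : SSet.{u}} (f : X ⟶ Y) (x : X _⦋m⦌) (i : Fin (m + 1)) :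
    vertex (f.app _ x) i = f.app _ (vertex x i) :=
  (NatTrans.naturality_apply f _ _).symm

variable (X) in
/-- Simplicial sets whose simplices are determined by their vertices. -/
class VertexDetermined : Prop where
  ext {m : ℕ} {x y : X _⦋m⦌} (h : ∀ i, vertex x i = vertex y i) : x = y

instance {Y : SSet.{u}} [VertexDetermined X] [VertexDetermined Y] : VertexDetermined (X ⊗ Y) where
  ext h := Prod.ext (VertexDetermined.ext fun i => congrArg Prod.fst (h i))
    (VertexDetermined.ext fun i => congrArg Prod.snd (h i))

instance (n : ℕ) : VertexDetermined (Δ[n] : SSet.{u}) where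
  ext h := by
    ext i : 1
    exact congrArg (fun z : Δ[n] _⦋0⦌ => z 0) (h i)

instance : VertexDetermined coherentIso.{u} where
  ext h := by
    refine Codiscrete.equivFun.injective (funext fun i => ?_)
    exact congrArg (fun z : coherentIso.{u} _⦋0⦌ => Codiscrete.equivFun z 0) (h i)

variable [VertexDetermined X]

/-- If the vertices i and i + 1 agree, the simplex has the same vertices as the i-th degeneracy of
its i-th face, hence equals it. -/
lemma mem_nonDegenerate_iff_vertex_ne (x : X _⦋m⦌) :
    x ∈ X.nonDegenerate m ↔
      ∀ (i : ℕ) (hi : i < m), vertex x ⟨i, by lia⟩ ≠ vertex x ⟨i + 1, by lia⟩ := by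
  obtain _ | m := m
  · simp
  · rw [← not_iff_not, ← mem_degenerate_iff_notMem_nonDegenerate, degenerate_eq_iUnion_range_σ,
      Set.mem_iUnion]
    push Not
    constructor
    · rintro ⟨i, y, rfl⟩
      refine ⟨i, i.2, ?_⟩
      rw [vertex_σ, vertex_σ]
      congr 1
      have h1 : i.predAbove (i.castSucc) = i := Fin.predAbove_castSucc_self i
      have h2 : i.predAbove (i.succ) = i := Fin.predAbove_succ_self i
      exact h1.trans h2.symm
    · rintro ⟨i, hi, h⟩
      let k : Fin (m + 1) := ⟨i, hi⟩
      change vertex x k.castSucc = vertex x k.succ at h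
      refine ⟨k, X.δ k.castSucc x, VertexDetermined.ext fun j => ?_⟩
      rw [vertex_σ, vertex_δ]
      by_cases hj : j = k.castSucc
      · subst hj
        rw [Fin.predAbove_castSucc_self, Fin.succAbove_castSucc_self, h]
      · congr 1
        exact Fin.succAbove_predAbove hj

/-- For i < j, the i-th vertices of the faces opposite i and j are the vertices i + 1 and i of x,
which differ. This makes every pairing below proper. -/
lemma δ_injective_of_nonDegenerate {x : X _⦋m + 1⦌} (hx : x ∈ X.nonDegenerate (m + 1))
    {i j : Fin (m + 2)} (h : X.δ i x = X.δ j x) : i = j := by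
  rw [mem_nonDegenerate_iff_vertex_ne] at hx
  have key : ∀ {i j : Fin (m + 2)}, X.δ i x = X.δ j x → ¬ i < j := by
    intro i j h hij
    have h1 := congrArg (fun y => vertex y ⟨i, by lia⟩) h
    simp only [vertex_δ] at h1
    rw [Fin.succAbove_of_le_castSucc i ⟨i, _⟩ (le_of_eq (Fin.ext rfl)),
      Fin.succAbove_of_castSucc_lt j ⟨i, _⟩ hij] at h1
    exact hx i (by lia) h1.symm
  exact le_antisymm (not_lt.1 (key h.symm)) (not_lt.1 (key h))

lemma isUniquelyCodimOneFace_δ {x : X _⦋m + 1⦌} (hx : x ∈ X.nonDegenerate (m + 1))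
    (i : Fin (m + 2)) : S.IsUniquelyCodimOneFace (S.mk (X.δ i x)) (S.mk x) := by
  rw [S.IsUniquelyCodimOneFace.iff]
  exact ⟨i, rfl, fun j hj => δ_injective_of_nonDegenerate hx hj⟩

end Vertex

end SSet

namespace SSet

/-! ### The walking isomorphism -/

namespace coherentIso

/-- The boolean labels of the vertices of a simplex of `E[1]`. -/
def label {m : ℕ} (x : coherentIso.{u} _⦋m⦌) (i : Fin (m + 1)) : Bool :=
  (Codiscrete.equivFun x i).down

/-- The simplex of `E[1]` with given labels of vertices. -/
def ofLabel {m : ℕ} (f : Fin (m + 1) → Bool) : coherentIso.{u} _⦋m⦌ :=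
  Codiscrete.equivFun.symm (fun i => ULift.up (f i))

@[simp]
lemma label_ofLabel {m : ℕ} (f : Fin (m + 1) → Bool) (i : Fin (m + 1)) :
    label (ofLabel.{u} f) i = f i := rfl

lemma label_ext {m : ℕ} {x y : coherentIso.{u} _⦋m⦌} (h : ∀ i, label x i = label y i) : x = y :=
  Codiscrete.equivFun.injective (funext fun i => ULift.ext _ _ (h i))

lemma label_map {m k : ℕ} (f : ⦋k⦌ ⟶ ⦋m⦌) (x : coherentIso.{u} _⦋m⦌) (i : Fin (k + 1)) :
    label (coherentIso.map f.op x) i = label x (f i) := rfl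

lemma label_δ {m : ℕ} (x : coherentIso.{u} _⦋m + 1⦌) (k : Fin (m + 2)) (i : Fin (m + 1)) :
    label (coherentIso.δ k x) i = label x (k.succAbove i) := rfl

lemma vertex_eq_iff {m : ℕ} (x : coherentIso.{u} _⦋m⦌) (i j : Fin (m + 1)) :
    vertex x i = vertex x j ↔ label x i = label x j := by
  constructor
  · intro h
    exact congrArg (fun y => label y 0) h
  · intro h
    refine label_ext fun k => ?_
    exact h

variable (u) in
/-- The vertex `0` of `E[1]`, as a subcomplex. -/
def zero : (coherentIso.{u}).Subcomplex := Subcomplex.ofSimplex x₀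

lemma mem_zero_iff {m : ℕ} (x : coherentIso.{u} _⦋m⦌) :
    x ∈ (zero.{u}).obj _ ↔ ∀ i, label x i = false := by
  rw [zero, Subcomplex.mem_ofSimplex_obj_iff]
  constructor
  · rintro ⟨f, rfl⟩ i
    rfl
  · intro h
    exact ⟨SimplexCategory.const _ _ 0, label_ext fun i => (h i).symm⟩

end coherentIso

/-! ### The inclusion of ∂Δ[n] × E[1] ∪ Δ[n] × {0} in Δ[n] × E[1] -/

namespace stdSimplexProdCoherentIso

open PivotWord coherentIso

variable {n m : ℕ}

/-- The first components of the word attached to a simplex of `Δ[n] ⊗ E[1]`. -/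
def fstWord (x : (Δ[n] ⊗ coherentIso.{u} : SSet.{u}) _⦋m⦌) (i : ℕ) : ℕ :=
  (x.1 ⟨min i m, by lia⟩ : Fin (n + 1))

/-- The second components of the word attached to a simplex of `Δ[n] ⊗ E[1]`. -/
def sndWord (x : (Δ[n] ⊗ coherentIso.{u} : SSet.{u}) _⦋m⦌) (i : ℕ) : Bool :=
  label x.2 ⟨min i m, by lia⟩

lemma ext_word {x y : (Δ[n] ⊗ coherentIso.{u} : SSet.{u}) _⦋m⦌}
    (h : ∀ i ≤ m, fstWord x i = fstWord y i ∧ sndWord x i = sndWord y i) : x = y := by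
  refine Prod.ext ?_ ?_
  · ext ⟨i, hi⟩
    simpa [fstWord, min_eq_left (Nat.lt_succ_iff.1 hi)] using (h i (by lia)).1
  · refine label_ext ?_
    rintro ⟨i, hi⟩
    simpa [sndWord, min_eq_left (Nat.lt_succ_iff.1 hi)] using (h i (by lia)).2

lemma fstWord_map {k : ℕ} (f : ⦋k⦌ ⟶ ⦋m⦌) (x : (Δ[n] ⊗ coherentIso.{u} : SSet.{u}) _⦋m⦌)
    (i : ℕ) (hi : i ≤ k) :
    fstWord ((Δ[n] ⊗ coherentIso.{u} : SSet.{u}).map f.op x) i =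
      fstWord x (f ⟨i, by lia⟩ : Fin (m + 1)) := by
  have h : min ((f ⟨i, by lia⟩ : Fin (m + 1)) : ℕ) m = (f ⟨i, by lia⟩ : Fin (m + 1)) := by lia
  simp only [fstWord, min_eq_left hi, h]
  rfl

lemma sndWord_map {k : ℕ} (f : ⦋k⦌ ⟶ ⦋m⦌) (x : (Δ[n] ⊗ coherentIso.{u} : SSet.{u}) _⦋m⦌)
    (i : ℕ) (hi : i ≤ k) :
    sndWord ((Δ[n] ⊗ coherentIso.{u} : SSet.{u}).map f.op x) i =
      sndWord x (f ⟨i, by lia⟩ : Fin (m + 1)) := by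
  have h : min ((f ⟨i, by lia⟩ : Fin (m + 1)) : ℕ) m = (f ⟨i, by lia⟩ : Fin (m + 1)) := by lia
  simp only [sndWord, min_eq_left hi, h]
  rfl

lemma val_succAbove (k : Fin (m + 2)) (i : ℕ) (hi : i < m + 1) :
    ((k.succAbove ⟨i, hi⟩ : Fin (m + 2)) : ℕ) = if i < k then i else i + 1 := by
  simp only [Fin.succAbove, Fin.lt_def, Fin.val_castSucc]
  split_ifs <;> rfl

lemma fstWord_δ (x : (Δ[n] ⊗ coherentIso.{u} : SSet.{u}) _⦋m + 1⦌) (k : Fin (m + 2))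
    (i : ℕ) (hi : i ≤ m) :
    fstWord ((Δ[n] ⊗ coherentIso.{u} : SSet.{u}).δ k x) i = del k (fstWord x) i := by
  refine (fstWord_map (SimplexCategory.δ k) x i hi).trans ?_
  change fstWord x ((k.succAbove ⟨i, _⟩ : Fin (m + 2)) : ℕ) = _
  rw [val_succAbove, del]
  split_ifs <;> rfl

lemma sndWord_δ (x : (Δ[n] ⊗ coherentIso.{u} : SSet.{u}) _⦋m + 1⦌) (k : Fin (m + 2))
    (i : ℕ) (hi : i ≤ m) :
    sndWord ((Δ[n] ⊗ coherentIso.{u} : SSet.{u}).δ k x) i = del k (sndWord x) i := by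
  refine (sndWord_map (SimplexCategory.δ k) x i hi).trans ?_
  change sndWord x ((k.succAbove ⟨i, _⟩ : Fin (m + 2)) : ℕ) = _
  rw [val_succAbove, del]
  split_ifs <;> rfl

/-- The subcomplex `∂Δ[n] × E[1] ∪ Δ[n] × {0}`. -/
abbrev union (n : ℕ) : (Δ[n] ⊗ coherentIso.{u} : SSet.{u}).Subcomplex :=
  Subcomplex.unionProd ∂Δ[n] coherentIso.zero

/-- Avoiding ∂Δ[n] × E[1] means that the first component is surjective, avoiding Δ[n] × {0} that
some label is true, and nondegeneracy that consecutive letters differ. Monotonicity is automatic. -/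
lemma good_iff (x : (Δ[n] ⊗ coherentIso.{u} : SSet.{u}) _⦋m⦌) :
    Good n m (fstWord x) (sndWord x) ↔
      x ∈ (Δ[n] ⊗ coherentIso.{u} : SSet.{u}).nonDegenerate m ∧ x ∉ (union n).obj _ := by
  have h1 : x ∉ (union n).obj _ ↔
      (∀ v ≤ n, ∃ i ≤ m, fstWord x i = v) ∧ ∃ i ≤ m, sndWord x i = true := by
    refine (Subcomplex.mem_unionProd_iff _ _ x).not.trans ?_
    rw [not_or, mem_boundary_iff_notMem_range, coherentIso.mem_zero_iff, and_comm]
    refine and_congr ?_ ?_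
    · push Not
      refine ⟨fun h v hv => ?_, fun h v => ?_⟩
      · obtain ⟨i, hi⟩ := h ⟨v, by lia⟩
        refine ⟨i, by lia, ?_⟩
        have h2 : (⟨min (i : ℕ) m, by lia⟩ : Fin (m + 1)) = i := Fin.ext (by simp; lia)
        rw [fstWord, h2, hi]
      · obtain ⟨i, hi, h2⟩ := h v (by lia)
        exact ⟨_, Fin.ext h2⟩
    · push Not
      refine ⟨fun ⟨i, hi⟩ => ⟨i, by lia, ?_⟩, fun ⟨i, hi, h⟩ => ⟨_, by rw [← sndWord, h]; simp⟩⟩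
      have h2 : (⟨min (i : ℕ) m, by lia⟩ : Fin (m + 1)) = i := Fin.ext (by simp; lia)
      rw [sndWord, h2]
      simpa using hi
  have h2 : x ∈ (Δ[n] ⊗ coherentIso.{u} : SSet.{u}).nonDegenerate m ↔
      ∀ i < m, fstWord x i = fstWord x (i + 1) → sndWord x i ≠ sndWord x (i + 1) := by
    rw [mem_nonDegenerate_iff_vertex_ne]
    refine forall_congr' fun i => forall_congr' fun hi => ?_
    simp only [fstWord, sndWord, min_eq_left hi.le, min_eq_left (Nat.succ_le_of_lt hi)]
    rw [← not_iff_not]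
    push Not
    rw [← vertex_eq_iff]
    constructor
    · intro h
      exact ⟨congrArg (fun z : (Δ[n] ⊗ coherentIso.{u} : SSet.{u}) _⦋0⦌ => (z.1 0 : ℕ)) h,
        congrArg Prod.snd h⟩
    · rintro ⟨h3, h4⟩
      refine Prod.ext ?_ h4
      ext j
      exact h3
  rw [h1, h2]
  constructor
  · intro h
    exact ⟨h.ne, h.surj, h.exists_true⟩
  · rintro ⟨h3, h4, h5⟩
    refine ⟨fun i j hij hj => ?_, h4, h5, h3⟩
    exact stdSimplex.monotone_apply x.1 (show (⟨min i m, by lia⟩ : Fin (m + 1)) ≤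
      ⟨min j m, by lia⟩ by simp only [Fin.mk_le_mk]; lia)

lemma exists_of_good {a : ℕ → ℕ} {b : ℕ → Bool} (h : Good n m a b) (ha : ∀ i ≤ m, a i ≤ n) :
    ∃ x : (Δ[n] ⊗ coherentIso.{u} : SSet.{u}) _⦋m⦌,
      ∀ i ≤ m, fstWord x i = a i ∧ sndWord x i = b i := by
  refine ⟨⟨stdSimplex.objMk ⟨fun i => ⟨a i, by have := ha i (by lia); lia⟩, fun i j hij => ?_⟩,
    ofLabel fun i => b i⟩, fun i hi => ⟨?_, ?_⟩⟩
  · exact h.mono i j hij (by lia)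
  · exact congrArg a (min_eq_left hi)
  · exact congrArg b (min_eq_left hi)

end stdSimplexProdCoherentIso
end SSet

namespace SSet
namespace stdSimplexProdCoherentIso

open PivotWord coherentIso

variable {n m : ℕ}

/-- Words are functions on all of ℕ of which only the letters up to m count, so two words are
compared only up to that position. -/
lemma isPivot_congr {a a' : ℕ → ℕ} {b b' : ℕ → Bool} {k : ℕ}
    (h : ∀ i ≤ m, a i = a' i ∧ b i = b' i) (hp : IsPivot m a b k) : IsPivot m a' b' k := by
  rcases hp with hp | hp
  · refine Or.inl ⟨hp.le, (h k hp.le).1 ▸ hp.fst, (h k hp.le).2 ▸ hp.snd, ?_, fun i hi hi' => ?_⟩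
    · obtain ⟨i, hi, h1, h2⟩ := hp.exists_lt
      have := h i (by have := hp.le; lia)
      exact ⟨i, hi, this.1 ▸ h1, this.2 ▸ h2⟩
    · exact (h i hi').1 ▸ hp.ne_zero i hi hi'
  · have hk := hp.lt
    refine Or.inr ⟨hk, fun i hi => ?_, fun i hi => ?_, ?_, ?_⟩
    · rw [← (h i hi).1, ← (h i hi).2]
      exact hp.ne i hi
    · rw [← (h i (by lia)).2]
      exact hp.snd i hi
    · rw [← (h _ hk).1, ← (h _ hk.le).1]
      exact hp.fst_succ
    · rw [← (h _ hk).2]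
      exact hp.snd_succ

lemma good_congr {a a' : ℕ → ℕ} {b b' : ℕ → Bool}
    (h : ∀ i ≤ m, a i = a' i ∧ b i = b' i) (hg : Good n m a b) : Good n m a' b' where
  mono i j hij hj := by
    rw [← (h i (by lia)).1, ← (h j hj).1]
    exact hg.mono i j hij hj
  surj v hv := by
    obtain ⟨i, hi, h1⟩ := hg.surj v hv
    exact ⟨i, hi, (h i hi).1 ▸ h1⟩
  exists_true := by
    obtain ⟨i, hi, h1⟩ := hg.exists_true
    exact ⟨i, hi, (h i hi).2 ▸ h1⟩
  ne i hi := by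
    rw [← (h i hi.le).1, ← (h _ hi).1, ← (h i hi.le).2, ← (h _ hi).2]
    exact hg.ne i hi

lemma fstWord_le (x : (Δ[n] ⊗ coherentIso.{u} : SSet.{u}) _⦋m⦌) (i : ℕ) : fstWord x i ≤ n :=
  Nat.lt_succ_iff.1 (x.1 ⟨min i m, by lia⟩ : Fin (n + 1)).2

lemma word_δ (x : (Δ[n] ⊗ coherentIso.{u} : SSet.{u}) _⦋m + 1⦌) (k : Fin (m + 2)) :
    ∀ i ≤ m, del k (fstWord x) i = fstWord ((Δ[n] ⊗ coherentIso.{u} : SSet.{u}).δ k x) i ∧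
      del k (sndWord x) i = sndWord ((Δ[n] ⊗ coherentIso.{u} : SSet.{u}).δ k x) i :=
  fun i hi => ⟨(fstWord_δ x k i hi).symm, (sndWord_δ x k i hi).symm⟩

variable (n) in
/-- The simplices of `Δ[n] ⊗ E[1]` with a pivot. -/
structure PivotSimplex : Type u where
  d : ℕ
  x : (Δ[n] ⊗ coherentIso.{u} : SSet.{u}) _⦋d + 1⦌
  good : Good n (d + 1) (fstWord x) (sndWord x)
  k : Fin (d + 2)
  isPivot : IsPivot (d + 1) (fstWord x) (sndWord x) k

namespace PivotSimplex

/-- The face opposite to the pivot. -/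
abbrev face (s : PivotSimplex.{u} n) : (Δ[n] ⊗ coherentIso.{u} : SSet.{u}) _⦋s.d⦌ :=
  (Δ[n] ⊗ coherentIso.{u} : SSet.{u}).δ s.k s.x

lemma good_face (hn : 0 < n) (s : PivotSimplex.{u} n) :
    Good n s.d (fstWord s.face) (sndWord s.face) :=
  good_congr (word_δ s.x s.k) (s.isPivot.good_del hn s.good)

lemma not_isPivot_face (s : PivotSimplex.{u} n) (k : ℕ) :
    ¬ IsPivot s.d (fstWord s.face) (sndWord s.face) k :=
  fun h => s.isPivot.not_isPivot_del s.good
    (isPivot_congr (fun i hi => ⟨(word_δ s.x s.k i hi).1.symm, (word_δ s.x s.k i hi).2.symm⟩) h)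

lemma eq_of_x_eq {s t : PivotSimplex.{u} n} (h : S.mk s.x = S.mk t.x) : s = t := by
  obtain ⟨d, x, hx, k, hk⟩ := s
  obtain ⟨d', x', hx', k', hk'⟩ := t
  obtain rfl : d = d' := by simpa using S.dim_eq_of_mk_eq h
  obtain rfl : x = x' := (S.ext_iff _ _).1 h
  obtain rfl : k = k' := Fin.ext (hk.unique hk')
  rfl

lemma eq_of_face_eq {s t : PivotSimplex.{u} n} (h : S.mk s.face = S.mk t.face) : s = t := by
  obtain ⟨d, x, hx, k, hk⟩ := s
  obtain ⟨d', x', hx', k', hk'⟩ := t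
  obtain rfl : d = d' := by simpa using S.dim_eq_of_mk_eq h
  replace h : (Δ[n] ⊗ coherentIso.{u} : SSet.{u}).δ k x =
    (Δ[n] ⊗ coherentIso.{u} : SSet.{u}).δ k' x' := (S.ext_iff _ _).1 h
  obtain ⟨h1, h2⟩ := hk.injective_del hx hx' hk'
    (fun i hi => by rw [(word_δ x k i hi).1, (word_δ x' k' i hi).1, h])
    (fun i hi => by rw [(word_δ x k i hi).2, (word_δ x' k' i hi).2, h])
  obtain rfl : x = x' := ext_word h2
  obtain rfl : k = k' := Fin.ext h1
  rfl

lemma exists_face_eq (hn : 0 < n) (x : (Δ[n] ⊗ coherentIso.{u} : SSet.{u}) _⦋m⦌)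
    (hx : Good n m (fstWord x) (sndWord x)) (hx' : ∀ k, ¬ IsPivot m (fstWord x) (sndWord x) k) :
    ∃ s : PivotSimplex.{u} n, S.mk x = S.mk s.face := by
  obtain ⟨k, v, hk, hg, hp⟩ := hx.exists_isPivot_ins hn hx'
  -- Only the inserted letter could exceed n. It is not the last one, because pivots are inner, so
  -- it is bounded by its successor, a letter of x.
  obtain ⟨y, hy⟩ := exists_of_good.{u} hg (fun i hi => by
    obtain ⟨j, hj, h⟩ := (hp.good_del hn hg).surj n le_rfl
    rw [del_ins] at h
    obtain ⟨j', hj', h'⟩ := hg.surj n le_rfl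
    by_contra h2
    have h3 := fstWord_le x i
    have h4 := fstWord_le x (i - 1)
    simp only [ins] at h2
    have hik : i = k := by grind
    subst hik
    have h5 := hp.lt hn hg
    have h6 := hg.mono i (i + 1) (by lia) h5
    have h7 := fstWord_le x i
    simp [ins] at h6 h2
    lia)
  have hy' : ∀ i ≤ m + 1, ins k v (fstWord x) i = fstWord y i ∧
      ins k false (sndWord x) i = sndWord y i := fun i hi => ⟨(hy i hi).1.symm, (hy i hi).2.symm⟩
  refine ⟨⟨m, y, good_congr hy' hg, ⟨k, by lia⟩, isPivot_congr hy' hp⟩, ?_⟩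
  congr 1
  refine ext_word fun i hi => ?_
  rw [← (word_δ y _ i hi).1, ← (word_δ y _ i hi).2]
  have h1 := hy i (by lia)
  have h2 := hy (i + 1) (by lia)
  have h3 := congrFun (del_ins k v (fstWord x)) i
  have h4 := congrFun (del_ins k false (sndWord x)) i
  rw [← h3, ← h4]
  simp only [del]
  grind

end PivotSimplex

open PivotSimplex in
/-- The pairing of the simplices which do not belong to `∂Δ[n] × E[1] ∪ Δ[n] × {0}`. -/
def pairingCore (hn : 0 < n) : (union.{u} n).PairingCore where
  ι := PivotSimplex.{u} n
  dim s := s.d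
  simplex s := s.x
  index s := s.k
  nonDegenerate₁ s := ((good_iff _).1 s.good).1
  nonDegenerate₂ s := ((good_iff _).1 (s.good_face hn)).1
  notMem₁ s := ((good_iff _).1 s.good).2
  notMem₂ s := ((good_iff _).1 (s.good_face hn)).2
  injective_type₁' h := eq_of_x_eq h
  injective_type₂' h := eq_of_face_eq h
  type₁_ne_type₂' s t h := by
    obtain ⟨d, x, hx, k, hk⟩ := s
    obtain ⟨d', x', hx', k', hk'⟩ := t
    obtain rfl : d + 1 = d' := S.dim_eq_of_mk_eq h
    obtain rfl := (S.ext_iff _ _).1 h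
    exact not_isPivot_face ⟨_, x', hx', k', hk'⟩ _ hk
  surjective' x := by
    obtain ⟨m, x, hx, hx', rfl⟩ := x.mk_surjective
    have hg := (good_iff x).2 ⟨hx, hx'⟩
    by_cases h : ∃ k, IsPivot m (fstWord x) (sndWord x) k
    · obtain ⟨k, hk⟩ := h
      obtain _ | m := m
      · have := hk.lt hn hg
        lia
      · exact ⟨⟨m, x, hg, ⟨k, by have := hk.le; lia⟩, hk⟩, Or.inl rfl⟩
    · push Not at h
      obtain ⟨s, hs⟩ := exists_face_eq hn x hg h
      exact ⟨s, Or.inr hs⟩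

instance (hn : 0 < n) : (pairingCore.{u} hn).IsProper where
  isUniquelyCodimOneFace s := isUniquelyCodimOneFace_δ ((good_iff _).1 s.good).1 s.k

instance (hn : 0 < n) : (pairingCore.{u} hn).IsInner where
  ne_zero s h := by
    have := s.isPivot.pos s.good
    simp only [pairingCore] at h
    simp [h] at this
  ne_last s h := by
    have := s.isPivot.lt hn s.good
    simp only [pairingCore] at h
    simp [h] at this

/-- The number of vertices of a simplex over the vertex `1`. -/
def countTrue (x : (Δ[n] ⊗ coherentIso.{u} : SSet.{u}) _⦋m⦌) : ℕ :=
  (Finset.univ.filter fun i => label x.2 i = true).card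

lemma countTrue_map_le {k : ℕ} (f : ⦋k⦌ ⟶ ⦋m⦌) (hf : Function.Injective f)
    (x : (Δ[n] ⊗ coherentIso.{u} : SSet.{u}) _⦋m⦌) :
    countTrue ((Δ[n] ⊗ coherentIso.{u} : SSet.{u}).map f.op x) ≤ countTrue x := by
  refine Finset.card_le_card_of_injOn f (fun i hi => ?_) hf.injOn
  simpa [label_map] using (Finset.mem_filter.1 hi).2

lemma exists_of_countTrue_eq {k : ℕ} (f : ⦋k⦌ ⟶ ⦋m⦌) (hf : Function.Injective f)
    (x : (Δ[n] ⊗ coherentIso.{u} : SSet.{u}) _⦋m⦌)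
    (h : countTrue ((Δ[n] ⊗ coherentIso.{u} : SSet.{u}).map f.op x) = countTrue x)
    (j : Fin (m + 1)) (hj : label x.2 j = true) : ∃ i : Fin (k + 1), f i = j := by
  have h1 := Finset.surjOn_of_injOn_of_card_le
    (s := Finset.univ.filter fun i =>
      label ((Δ[n] ⊗ coherentIso.{u} : SSet.{u}).map f.op x).2 i = true)
    (t := Finset.univ.filter fun i => label x.2 i = true) f
    (fun i hi => by simpa [label_map] using (Finset.mem_filter.1 hi).2) hf.injOn h.ge
  obtain ⟨i, -, hi⟩ := h1 (show j ∈ _ by simpa using hj)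
  exact ⟨i, hi⟩

lemma sndWord_val (x : (Δ[n] ⊗ coherentIso.{u} : SSet.{u}) _⦋m⦌) (i : Fin (m + 1)) :
    sndWord x i = label x.2 i := by
  rw [sndWord]
  congr 1
  exact Fin.ext (by simp; lia)

/-- The pivot is a false letter, so its removal costs no true vertex. -/
lemma countTrue_face (s : PivotSimplex.{u} n) : countTrue s.face = countTrue s.x := by
  refine le_antisymm (countTrue_map_le (SimplexCategory.δ s.k) Fin.succAbove_right_injective _) ?_
  refine Finset.card_le_card_of_surjOn s.k.succAbove fun j hj => ?_
  have hj := (Finset.mem_filter.1 hj).2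
  have hk : j ≠ s.k := by
    rintro rfl
    rw [← sndWord_val, s.isPivot.snd] at hj
    simp at hj
  obtain ⟨i, rfl⟩ := Fin.exists_succAbove_eq hk
  exact ⟨i, Finset.mem_filter.2 ⟨Finset.mem_univ _, hj⟩, rfl⟩

/-- Passing to a face cannot create true vertices. If their number and the dimension both stay the
same, then s.face is obtained from t.x by removing one false letter. It is not the pivot, as s ≠ t,
so a pivot would survive in s.face, which has none. The ancestral relation therefore decreases
lexicographically. -/
lemma countTrue_lt_or_lt {s t : PivotSimplex.{u} n} (hne : s ≠ t) (f : ⦋s.d⦌ ⟶ ⦋t.d + 1⦌)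
    [Mono f] (hf : (Δ[n] ⊗ coherentIso.{u} : SSet.{u}).map f.op t.x = s.face)
    (hst : s.d ≤ t.d) :
    countTrue s.face < countTrue t.face ∨ countTrue s.face = countTrue t.face ∧ s.d < t.d := by
  have hf' : Function.Injective f := SimplexCategory.mono_iff_injective.1 inferInstance
  rcases (countTrue_map_le f hf' t.x).lt_or_eq with h | h
  · left
    rwa [countTrue_face t, ← hf]
  · right
    refine ⟨by rw [← hf, h, countTrue_face], lt_of_le_of_ne hst fun hd => ?_⟩
    obtain ⟨d, x, hx, k, hk⟩ := s
    obtain ⟨d', x', hx', k', hk'⟩ := t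
    obtain rfl : d = d' := hd
    obtain ⟨j, rfl⟩ := SimplexCategory.eq_δ_of_mono f
    by_cases hjk : j = k'
    · subst hjk
      exact hne (PivotSimplex.eq_of_face_eq (by rw [← hf]; rfl))
    · have hj : sndWord x' j = false := by
        by_contra hj
        rw [sndWord_val] at hj
        obtain ⟨i, hi⟩ := exists_of_countTrue_eq _ hf' _ h j (by simpa using hj)
        exact Fin.succAbove_ne j i hi
      obtain ⟨k₀, hk₀⟩ := hk'.exists_isPivot_del (by simpa [Fin.ext_iff] using hjk) hj (by lia)
      refine PivotSimplex.not_isPivot_face ⟨d, x, hx, k, hk⟩ k₀ ?_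
      rw [← hf]
      exact isPivot_congr (word_δ x' j) hk₀

instance (hn : 0 < n) : (pairingCore.{u} hn).IsRegular where
  wf := by
    refine Subrelation.wf (r := InvImage (Prod.Lex (· < ·) (· < ·))
      (fun s : PivotSimplex.{u} n => (countTrue s.face, s.d))) ?_
      (InvImage.wf _ (WellFounded.prod_lex wellFounded_lt wellFounded_lt))
    rintro (s : PivotSimplex.{u} n) (t : PivotSimplex.{u} n) ⟨hne, hlt⟩
    have hd : s.d < t.d + 1 := SSet.N.dim_lt_of_lt hlt
    obtain ⟨f, hmono, hf⟩ := SSet.N.le_iff_exists_mono.1 (Subcomplex.N.le_iff.1 hlt.le)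
    rcases @countTrue_lt_or_lt _ s t hne f hmono hf (by lia) with h | h
    · exact Prod.Lex.left _ _ h
    · exact Prod.lex_iff.2 (Or.inr h)

/-- The case n = 0 has to be excluded: {0} ⊂ E[1] is not surjective on vertices, hence not inner
anodyne. -/
lemma innerAnodyneExtensions_union_ι (hn : 0 < n) : innerAnodyneExtensions (union.{u} n).ι :=
  (pairingCore hn).pairing.innerAnodyneExtensions

end stdSimplexProdCoherentIso
end SSet

/-! ### Simplices of a join -/

namespace SSet

variable {K L K' L' : SSet.{u}}

namespace JoinSimplex

variable {n : ℕ}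

/-- The part of the join to which a vertex belongs. -/
def cutAt (z : JoinSimplex K L Δ[n]) (i : Fin (n + 1)) : Fin 2 :=
  (yonedaEquiv z.cut : Δ[1] _⦋n⦌) i

lemma cutAt_monotone (z : JoinSimplex K L Δ[n]) : Monotone z.cutAt :=
  stdSimplex.monotone_apply (yonedaEquiv z.cut)

lemma cut_app_apply (z : JoinSimplex K L Δ[n]) {d : ℕ} (y : Δ[n] _⦋d⦌) (i : Fin (d + 1)) :
    (z.cut.app _ y : Δ[1] _⦋d⦌) i = z.cutAt (y i) := by
  have h : z.cut.app _ y = Δ[1].map (stdSimplex.objEquiv y).op (yonedaEquiv z.cut) := by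
    rw [stdSimplex.map_objEquiv_op_apply, Equiv.symm_apply_apply]
  rw [h]
  rfl

lemma mem_cutFiber_iff (z : JoinSimplex K L Δ[n]) (e : Fin 2) {d : ℕ} (y : Δ[n] _⦋d⦌) :
    y ∈ (cutFiber z.cut e).obj _ ↔ ∀ i, z.cutAt (y i) = e := by
  refine (stdSimplex.mem_face_iff.{u} {e} (z.cut.app _ y)).trans ?_
  simp only [Finset.mem_singleton, cut_app_apply]

/-- The face in `K` of a simplex of the join. -/
def leftAt (z : JoinSimplex K L Δ[n]) {d : ℕ} (f : ⦋d⦌ ⟶ ⦋n⦌) (hf : ∀ i, z.cutAt (f i) = 0) :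
    K _⦋d⦌ :=
  z.left.app _ ⟨stdSimplex.objEquiv.symm f, (z.mem_cutFiber_iff 0 _).2 hf⟩

/-- The face in `L` of a simplex of the join. -/
def rightAt (z : JoinSimplex K L Δ[n]) {d : ℕ} (f : ⦋d⦌ ⟶ ⦋n⦌) (hf : ∀ i, z.cutAt (f i) = 1) :
    L _⦋d⦌ :=
  z.right.app _ ⟨stdSimplex.objEquiv.symm f, (z.mem_cutFiber_iff 1 _).2 hf⟩

lemma leftAt_comp (z : JoinSimplex K L Δ[n]) {d e : ℕ} (g : ⦋e⦌ ⟶ ⦋d⦌) (f : ⦋d⦌ ⟶ ⦋n⦌)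
    (hf : ∀ i, z.cutAt (f i) = 0) :
    z.leftAt (g ≫ f) (fun i => hf (g i)) = K.map g.op (z.leftAt f hf) :=
  NatTrans.naturality_apply z.left g.op ⟨stdSimplex.objEquiv.symm f, (z.mem_cutFiber_iff 0 _).2 hf⟩

lemma rightAt_comp (z : JoinSimplex K L Δ[n]) {d e : ℕ} (g : ⦋e⦌ ⟶ ⦋d⦌) (f : ⦋d⦌ ⟶ ⦋n⦌)
    (hf : ∀ i, z.cutAt (f i) = 1) :
    z.rightAt (g ≫ f) (fun i => hf (g i)) = L.map g.op (z.rightAt f hf) :=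
  NatTrans.naturality_apply z.right g.op ⟨stdSimplex.objEquiv.symm f, (z.mem_cutFiber_iff 1 _).2 hf⟩

/-- The two partial maps are tested on all faces lying in the initial or the terminal part, which
covers the case of an empty part without a separate argument. -/
lemma ext_at {z w : JoinSimplex K L Δ[n]} (h : ∀ i, z.cutAt i = w.cutAt i)
    (hl : ∀ (d : ℕ) (f : ⦋d⦌ ⟶ ⦋n⦌) (hz : ∀ i, z.cutAt (f i) = 0) (hw : ∀ i, w.cutAt (f i) = 0),
      z.leftAt f hz = w.leftAt f hw)
    (hr : ∀ (d : ℕ) (f : ⦋d⦌ ⟶ ⦋n⦌) (hz : ∀ i, z.cutAt (f i) = 1) (hw : ∀ i, w.cutAt (f i) = 1),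
      z.rightAt f hz = w.rightAt f hw) : z = w := by
  refine ext' (yonedaEquiv.injective ?_) ?_ ?_
  · ext i : 1
    exact h i
  · rintro ⟨⟨d⟩⟩ y hy hy'
    obtain ⟨f, rfl⟩ := stdSimplex.objEquiv.symm.surjective y
    exact hl d f ((z.mem_cutFiber_iff 0 _).1 hy) ((w.mem_cutFiber_iff 0 _).1 hy')
  · rintro ⟨⟨d⟩⟩ y hy hy'
    obtain ⟨f, rfl⟩ := stdSimplex.objEquiv.symm.surjective y
    exact hr d f ((z.mem_cutFiber_iff 1 _).1 hy) ((w.mem_cutFiber_iff 1 _).1 hy')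

lemma leftAt_congr {z w : JoinSimplex K L Δ[n]} (h : z = w) {d : ℕ} (f : ⦋d⦌ ⟶ ⦋n⦌)
    (hf : ∀ i, z.cutAt (f i) = 0) : z.leftAt f hf = w.leftAt f (h ▸ hf) := by
  subst h; rfl

lemma rightAt_congr {z w : JoinSimplex K L Δ[n]} (h : z = w) {d : ℕ} (f : ⦋d⦌ ⟶ ⦋n⦌)
    (hf : ∀ i, z.cutAt (f i) = 1) : z.rightAt f hf = w.rightAt f (h ▸ hf) := by
  subst h; rfl

/-- The simplex of the join given by a pair of simplices and a cut. -/
def ofPair {T : SSet.{u}} (c : T ⟶ Δ[1]) (l : T ⟶ K) (r : T ⟶ L) : JoinSimplex K L T where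
  cut := c
  left := Subcomplex.ι _ ≫ l
  right := Subcomplex.ι _ ≫ r

/-- A `T`-simplex of `L`, as a `T`-simplex of the join whose initial part is empty. -/
def inr {T : SSet.{u}} (x : T ⟶ L) : JoinSimplex K L T where
  cut := const (stdSimplex.obj₀Equiv.symm 1)
  left := (isInitialOfNotNonempty (by
    rw [not_nonempty_iff]
    refine ⟨?_⟩
    rintro ⟨z, hz⟩
    have h : (1 : Fin 2) ∈ ({0} : Finset (Fin 2)) :=
      (stdSimplex.mem_face_iff.{u} {0} _).1 hz 0
    simp at h)).to K
  right := Subcomplex.ι _ ≫ x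

lemma restrict_inr {S T : SSet.{u}} (f : S ⟶ T) (x : T ⟶ L) :
    (inr x : JoinSimplex K L T).restrict f = inr (f ≫ x) := by
  refine ext' rfl (fun m z _ hy => ?_) (fun _ _ _ _ => rfl)
  obtain ⟨m⟩ := m
  have h : (1 : Fin 2) ∈ ({0} : Finset (Fin 2)) :=
    (stdSimplex.mem_face_iff.{u} (d := m.len) {0} _).1 hy 0
  simp at h

end JoinSimplex

/-- The inclusion of `L` into `K ⋆ L`. -/
def joinInr (K L : SSet.{u}) : L ⟶ join K L where
  app n := ↾fun x => joinEquiv K L n.unop (JoinSimplex.inr (yonedaEquiv.symm x))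
  naturality m n f := by
    ext x
    change JoinSimplex.inr (yonedaEquiv.symm (L.map f x)) =
      (JoinSimplex.inr (yonedaEquiv.symm x)).restrict (stdSimplex.{u}.map f.unop)
    rw [JoinSimplex.restrict_inr]
    exact congrArg JoinSimplex.inr (yonedaEquiv_symm_naturality_left f.unop x).symm

namespace join

open JoinSimplex SimplexCategory

/-- The map `⦋p + 1 + q⦌ ⟶ ⦋1⦌` which sends `0, …, p` to `0`. -/
def cutHom (p q : ℕ) : ⦋p + 1 + q⦌ ⟶ ⦋1⦌ :=
  Hom.mk ⟨fun i => if (i : ℕ) ≤ p then 0 else 1, fun i j hij => by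
    have : (i : ℕ) ≤ j := hij
    dsimp only
    split_ifs <;> lia⟩

/-- The retraction of `⦋p + 1 + q⦌` onto the initial part. -/
def projL (p q : ℕ) : ⦋p + 1 + q⦌ ⟶ ⦋p⦌ :=
  Hom.mk ⟨fun i => ⟨min i p, by lia⟩, fun i j hij => by
    have : (i : ℕ) ≤ j := hij
    simp only [Fin.mk_le_mk]
    lia⟩

/-- The retraction of `⦋p + 1 + q⦌` onto the terminal part. -/
def projR (p q : ℕ) : ⦋p + 1 + q⦌ ⟶ ⦋q⦌ :=
  Hom.mk ⟨fun i => ⟨i - (p + 1), by have : (i : ℕ) < p + 1 + q + 1 := i.2; lia⟩, fun i j hij => by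
    have : (i : ℕ) ≤ j := hij
    simp only [Fin.mk_le_mk]
    lia⟩

/-- The inclusion of the initial part. -/
def incL (p q : ℕ) : ⦋p⦌ ⟶ ⦋p + 1 + q⦌ :=
  Hom.mk ⟨fun i => ⟨i, by have : (i : ℕ) < p + 1 := i.2; lia⟩, fun i j hij => hij⟩

/-- The inclusion of the terminal part. -/
def incR (p q : ℕ) : ⦋q⦌ ⟶ ⦋p + 1 + q⦌ :=
  Hom.mk ⟨fun i => ⟨p + 1 + i, by have : (i : ℕ) < q + 1 := i.2; lia⟩, fun i j hij => by
    have : (i : ℕ) ≤ j := hij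
    simp only [Fin.mk_le_mk]
    lia⟩

variable {p q : ℕ}

lemma incL_projL : incL p q ≫ projL p q = 𝟙 _ := by
  ext i : 3
  exact Fin.ext (min_eq_left (Nat.lt_succ_iff.1 i.2))

lemma incR_projR : incR p q ≫ projR p q = 𝟙 _ := by
  ext i : 3
  exact Fin.ext (Nat.add_sub_cancel_left _ _)

lemma cutHom_eq_zero_iff (i : Fin (p + 1 + q + 1)) : cutHom p q i = (0 : Fin 2) ↔ (i : ℕ) ≤ p := by
  change (if (i : ℕ) ≤ p then (0 : Fin 2) else 1) = 0 ↔ _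
  split_ifs with h
  · simpa using h
  · simpa using h

lemma cutHom_eq_one_iff (i : Fin (p + 1 + q + 1)) : cutHom p q i = (1 : Fin 2) ↔ p < (i : ℕ) := by
  change (if (i : ℕ) ≤ p then (0 : Fin 2) else 1) = 1 ↔ _
  split_ifs with h
  · simpa using h
  · simpa using h

/-- The simplex of the join `K ⋆ L` attached to simplices of `K` and `L`. -/
def mk (σ : K _⦋p⦌) (τ : L _⦋q⦌) : (join K L) _⦋p + 1 + q⦌ :=
  joinEquiv K L ⦋p + 1 + q⦌ (ofPair (SSet.stdSimplex.map (cutHom p q))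
    (SSet.stdSimplex.map (projL p q) ≫ yonedaEquiv.symm σ)
    (SSet.stdSimplex.map (projR p q) ≫ yonedaEquiv.symm τ))

/-- A simplex of the join as a `JoinSimplex`. -/
abbrev toJoinSimplex {n : ℕ} (z : (join K L) _⦋n⦌) : JoinSimplex K L Δ[n] := z

lemma cutAt_mk (σ : K _⦋p⦌) (τ : L _⦋q⦌) (i : Fin (p + 1 + q + 1)) :
    cutAt (toJoinSimplex (mk σ τ)) i = cutHom p q i := rfl

lemma leftAt_mk (σ : K _⦋p⦌) (τ : L _⦋q⦌) {d : ℕ} (f : ⦋d⦌ ⟶ ⦋p + 1 + q⦌)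
    (hf : ∀ i, cutAt (toJoinSimplex (mk σ τ)) (f i) = 0) :
    leftAt (toJoinSimplex (mk σ τ)) f hf = K.map (f ≫ projL p q).op σ := rfl

lemma rightAt_mk (σ : K _⦋p⦌) (τ : L _⦋q⦌) {d : ℕ} (f : ⦋d⦌ ⟶ ⦋p + 1 + q⦌)
    (hf : ∀ i, cutAt (toJoinSimplex (mk σ τ)) (f i) = 1) :
    rightAt (toJoinSimplex (mk σ τ)) f hf = L.map (f ≫ projR p q).op τ := rfl

lemma cutAt_map {n m : ℕ} (f : ⦋m⦌ ⟶ ⦋n⦌) (z : (join K L) _⦋n⦌) (i : Fin (m + 1)) :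
    cutAt (toJoinSimplex ((join K L).map f.op z)) i = cutAt (toJoinSimplex z) (f i) :=
  by
  have h1 : yonedaEquiv (SSet.stdSimplex.map f ≫ (toJoinSimplex z).cut) =
      (toJoinSimplex z).cut.app _ (stdSimplex.objEquiv.symm f) := by
    rw [yonedaEquiv_comp, yonedaEquiv_map]
  exact (congrArg (fun t : Δ[1] _⦋m⦌ => t i) h1).trans
    (cut_app_apply (toJoinSimplex z) (stdSimplex.objEquiv.symm f) i)

lemma leftAt_map {n m d : ℕ} (f : ⦋m⦌ ⟶ ⦋n⦌) (z : (join K L) _⦋n⦌) (g : ⦋d⦌ ⟶ ⦋m⦌) (h)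
    (h' : ∀ i, cutAt (toJoinSimplex z) ((g ≫ f) i) = 0) :
    leftAt (toJoinSimplex ((join K L).map f.op z)) g h = leftAt (toJoinSimplex z) (g ≫ f) h' := rfl

lemma rightAt_map {n m d : ℕ} (f : ⦋m⦌ ⟶ ⦋n⦌) (z : (join K L) _⦋n⦌) (g : ⦋d⦌ ⟶ ⦋m⦌) (h)
    (h' : ∀ i, cutAt (toJoinSimplex z) ((g ≫ f) i) = 1) :
    rightAt (toJoinSimplex ((join K L).map f.op z)) g h =
      rightAt (toJoinSimplex z) (g ≫ f) h' := rfl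

end join

end SSet

namespace SSet

variable {K L K' L' : SSet.{u}}

namespace join

open JoinSimplex SimplexCategory

variable {p q p' q' : ℕ}

/-- The join of two maps of simplices. -/
def star (f : ⦋p⦌ ⟶ ⦋p'⦌) (g : ⦋q⦌ ⟶ ⦋q'⦌) : ⦋p + 1 + q⦌ ⟶ ⦋p' + 1 + q'⦌ :=
  Hom.mk ⟨fun i => if h : (i : ℕ) ≤ p then
      ⟨(f ⟨i, by lia⟩ : Fin (p' + 1)), by lia⟩
    else ⟨p' + 1 + (g ⟨i - (p + 1), by have : (i : ℕ) < p + 1 + q + 1 := i.2; lia⟩ : Fin (q' + 1)),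
      by lia⟩, fun i j hij => by
    have hij' : (i : ℕ) ≤ j := hij
    dsimp only
    split_ifs with h1 h2 h2
    · have : f ⟨i, by lia⟩ ≤ f ⟨j, by lia⟩ := f.toOrderHom.monotone hij'
      exact this
    · simp only [Fin.mk_le_mk]
      lia
    · lia
    · have hi : (i : ℕ) < p + 1 + q + 1 := i.2
      have hj : (j : ℕ) < p + 1 + q + 1 := j.2
      have : g ⟨i - (p + 1), by lia⟩ ≤ g ⟨j - (p + 1), by lia⟩ :=
        g.toOrderHom.monotone (by simp only [Fin.mk_le_mk]; lia)
      simp only [Fin.mk_le_mk]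
      exact Nat.add_le_add_left this _⟩

lemma star_apply_of_le (f : ⦋p⦌ ⟶ ⦋p'⦌) (g : ⦋q⦌ ⟶ ⦋q'⦌) (i : Fin (p + 1 + q + 1))
    (h : (i : ℕ) ≤ p) :
    ((star f g i : Fin (p' + 1 + q' + 1)) : ℕ) = (f ⟨i, by lia⟩ : Fin (p' + 1)) := by
  have : (star f g i : Fin (p' + 1 + q' + 1)) = ⟨(f ⟨i, by lia⟩ : Fin (p' + 1)), by lia⟩ :=
    dif_pos h
  rw [this]

lemma star_apply_of_lt (f : ⦋p⦌ ⟶ ⦋p'⦌) (g : ⦋q⦌ ⟶ ⦋q'⦌) (i : Fin (p + 1 + q + 1))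
    (h : p < (i : ℕ)) :
    ((star f g i : Fin (p' + 1 + q' + 1)) : ℕ) =
      p' + 1 + (g ⟨i - (p + 1), by lia⟩ : Fin (q' + 1)) := by
  have : (star f g i : Fin (p' + 1 + q' + 1)) =
    ⟨p' + 1 + (g ⟨i - (p + 1), by lia⟩ : Fin (q' + 1)), by lia⟩ := dif_neg (by lia)
  rw [this]

lemma map_star_mk (f : ⦋p⦌ ⟶ ⦋p'⦌) (g : ⦋q⦌ ⟶ ⦋q'⦌) (σ : K _⦋p'⦌) (τ : L _⦋q'⦌) :
    (join K L).map (star f g).op (mk σ τ) = mk (K.map f.op σ) (L.map g.op τ) := by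
  refine ext_at (fun i => ?_) (fun d h hz hw => ?_) (fun d h hz hw => ?_)
  · refine (cutAt_map (star f g) (mk σ τ) i).trans ?_
    rw [cutAt_mk, cutAt_mk]
    by_cases hi : (i : ℕ) ≤ p
    · rw [(cutHom_eq_zero_iff _).2 hi, (cutHom_eq_zero_iff _).2]
      rw [star_apply_of_le _ _ _ hi]
      lia
    · rw [(cutHom_eq_one_iff _).2 (not_le.1 hi), (cutHom_eq_one_iff _).2]
      rw [star_apply_of_lt _ _ _ (not_le.1 hi)]
      lia
  · refine (leftAt_map (star f g) (mk σ τ) h hz hz).trans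
      ((leftAt_mk σ τ (h ≫ star f g) hz).trans ?_)
    rw [leftAt_mk, ← Functor.map_comp_apply, ← op_comp]
    refine congrArg (fun k : ⦋d⦌ ⟶ ⦋p'⦌ => K.map k.op σ) ?_
    ext i : 3
    have hi := (cutHom_eq_zero_iff _).1 (hw i)
    refine Fin.ext ?_
    change min ((star f g (h i) : Fin (p' + 1 + q' + 1)) : ℕ) p' =
      (f ⟨min (h i : Fin (p + 1 + q + 1)) p, _⟩ : Fin (p' + 1))
    rw [star_apply_of_le _ _ _ hi]
    simp only [min_eq_left hi]
    lia
  · refine (rightAt_map (star f g) (mk σ τ) h hz hz).trans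
      ((rightAt_mk σ τ (h ≫ star f g) hz).trans ?_)
    rw [rightAt_mk, ← Functor.map_comp_apply, ← op_comp]
    refine congrArg (fun k : ⦋d⦌ ⟶ ⦋q'⦌ => L.map k.op τ) ?_
    ext i : 3
    have hi := (cutHom_eq_one_iff _).1 (hw i)
    refine Fin.ext ?_
    change ((star f g (h i) : Fin (p' + 1 + q' + 1)) : ℕ) - (p' + 1) =
      (g ⟨(h i : Fin (p + 1 + q + 1)) - (p + 1), _⟩ : Fin (q' + 1))
    rw [star_apply_of_lt _ _ _ hi]
    lia

/-- The index of a face of `mk σ τ` obtained from a face of `τ`. -/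
def indexR (p : ℕ) {q : ℕ} (i : Fin (q + 2)) : Fin (p + 1 + q + 2) := ⟨p + 1 + i, by lia⟩

lemma star_id_δ (i : Fin (q + 2)) :
    star (𝟙 ⦋p⦌) (SimplexCategory.δ i) = SimplexCategory.δ (n := p + 1 + q) (indexR p i) := by
  ext j : 3
  refine Fin.ext ?_
  change _ = (((indexR p i).succAbove j : Fin _) : ℕ)
  have hj : (j : ℕ) < p + 1 + q + 1 := j.2
  by_cases h : (j : ℕ) ≤ p
  · refine (star_apply_of_le _ _ _ h).trans ?_
    rw [Fin.succAbove_of_castSucc_lt _ _ (by simp [Fin.lt_def, indexR]; lia)]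
    rfl
  · refine (star_apply_of_lt _ _ _ (not_le.1 h)).trans ?_
    change p + 1 + ((i.succAbove ⟨j - (p + 1), _⟩ : Fin (q + 2)) : ℕ) = _
    by_cases h' : (j : ℕ) < p + 1 + i
    · rw [Fin.succAbove_of_castSucc_lt (indexR p i) _ (by simp [Fin.lt_def, indexR]; lia),
        Fin.succAbove_of_castSucc_lt i _ (by simp [Fin.lt_def]; lia)]
      simp
      lia
    · rw [Fin.succAbove_of_le_castSucc (indexR p i) _ (by simp [Fin.le_def, indexR]; lia),
        Fin.succAbove_of_le_castSucc i _ (by simp [Fin.le_def]; lia)]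
      simp
      lia

/-- The shift of the index by p + 1 is the reason why joining turns the outer index 0 into an inner
one. -/
lemma δ_mk (σ : K _⦋p⦌) (τ : L _⦋q + 1⦌) (i : Fin (q + 2)) :
    (join K L).δ (n := p + 1 + q) (indexR p i) (mk σ τ) = mk σ (L.δ i τ) := by
  have := map_star_mk (𝟙 ⦋p⦌) (SimplexCategory.δ i) σ τ
  rw [star_id_δ] at this
  refine this.trans ?_
  simp
  rfl

lemma cutAt_incL (σ : K _⦋p⦌) (τ : L _⦋q⦌) (i : Fin (p + 1)) :
    cutAt (toJoinSimplex (mk σ τ)) (incL p q i) = 0 := by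
  rw [cutAt_mk, cutHom_eq_zero_iff]
  exact Nat.lt_succ_iff.1 i.2

lemma cutAt_incR (σ : K _⦋p⦌) (τ : L _⦋q⦌) (i : Fin (q + 1)) :
    cutAt (toJoinSimplex (mk σ τ)) (incR p q i) = 1 := by
  rw [cutAt_mk, cutHom_eq_one_iff]
  change p < p + 1 + (i : ℕ)
  lia

lemma leftAt_incL (σ : K _⦋p⦌) (τ : L _⦋q⦌) :
    leftAt (toJoinSimplex (mk σ τ)) (incL p q) (cutAt_incL σ τ) = σ := by
  rw [leftAt_mk, incL_projL]
  simp

lemma rightAt_incR (σ : K _⦋p⦌) (τ : L _⦋q⦌) :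
    rightAt (toJoinSimplex (mk σ τ)) (incR p q) (cutAt_incR σ τ) = τ := by
  rw [rightAt_mk, incR_projR]
  simp

/-- The number of vertices in the initial part. -/
def leftCard (z : (join K L).S) : ℕ :=
  (Finset.univ.filter fun i => cutAt (toJoinSimplex z.simplex) i = 0).card

lemma leftCard_mk (σ : K _⦋p⦌) (τ : L _⦋q⦌) : leftCard (S.mk (mk σ τ)) = p + 1 := by
  have : (Finset.univ.filter fun i => cutAt (toJoinSimplex (mk σ τ)) i = 0) =
      Finset.univ.map ⟨fun i : Fin (p + 1) => (⟨i, by lia⟩ : Fin (p + 1 + q + 1)), fun i j h => by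
        simpa [Fin.ext_iff] using h⟩ := by
    ext i
    rw [Finset.mem_filter, cutAt_mk, cutHom_eq_zero_iff]
    simp only [Finset.mem_univ, true_and, Finset.mem_map, Fin.ext_iff]
    refine ⟨fun h => ⟨⟨i, by lia⟩, rfl⟩, fun ⟨j, hj⟩ => ?_⟩
    replace hj : (j : ℕ) = i := hj
    lia
  refine (congrArg Finset.card this).trans ?_
  simp

/-- The number of vertices in the initial part recovers p, the total dimension then recovers q, and
the two simplices are the restrictions to the parts. -/
lemma S_mk_mk_eq {σ : K _⦋p⦌} {τ : L _⦋q⦌} {σ' : K _⦋p'⦌} {τ' : L _⦋q'⦌}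
    (h : S.mk (mk σ τ) = S.mk (mk σ' τ')) : S.mk σ = S.mk σ' ∧ S.mk τ = S.mk τ' := by
  have h1 := congrArg leftCard h
  rw [leftCard_mk, leftCard_mk] at h1
  obtain rfl : p = p' := by lia
  obtain rfl : q = q' := by have := S.dim_eq_of_mk_eq h; lia
  have h2 := (S.ext_iff _ _).1 h
  have h3 := leftAt_congr h2 (incL p q) (cutAt_incL σ τ)
  have h4 := rightAt_congr h2 (incR p q) (cutAt_incR σ τ)
  rw [S.ext_iff, S.ext_iff]
  exact ⟨(leftAt_incL σ τ).symm.trans (h3.trans (leftAt_incL σ' τ')),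
    (rightAt_incR σ τ).symm.trans (h4.trans (rightAt_incR σ' τ'))⟩

end join

end SSet

namespace SSet

variable {K L K' L' : SSet.{u}}

namespace join

open JoinSimplex SimplexCategory

variable {p q p' q' n : ℕ}

lemma cutAt_joinInl (σ : K _⦋n⦌) (i : Fin (n + 1)) :
    cutAt (toJoinSimplex ((joinInl K L).app _ σ)) i = 0 := rfl

lemma cutAt_joinInr (τ : L _⦋n⦌) (i : Fin (n + 1)) :
    cutAt (toJoinSimplex ((joinInr K L).app _ τ)) i = 1 := rfl

lemma leftAt_joinInl (σ : K _⦋n⦌) {d : ℕ} (f : ⦋d⦌ ⟶ ⦋n⦌) (hf) :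
    leftAt (toJoinSimplex ((joinInl K L).app _ σ)) f hf = K.map f.op σ := rfl

lemma rightAt_joinInr (τ : L _⦋n⦌) {d : ℕ} (f : ⦋d⦌ ⟶ ⦋n⦌) (hf) :
    rightAt (toJoinSimplex ((joinInr K L).app _ τ)) f hf = L.map f.op τ := rfl

lemma leftAt_congr_hom (z : JoinSimplex K L Δ[n]) {d : ℕ} {f g : ⦋d⦌ ⟶ ⦋n⦌} (h : f = g)
    (hf : ∀ i, z.cutAt (f i) = 0) : z.leftAt f hf = z.leftAt g (h ▸ hf) := by
  subst h; rfl

lemma rightAt_congr_hom (z : JoinSimplex K L Δ[n]) {d : ℕ} {f g : ⦋d⦌ ⟶ ⦋n⦌} (h : f = g)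
    (hf : ∀ i, z.cutAt (f i) = 1) : z.rightAt f hf = z.rightAt g (h ▸ hf) := by
  subst h; rfl

lemma eq_joinInl (z : (join K L) _⦋n⦌) (h : ∀ i, cutAt (toJoinSimplex z) i = 0) :
    z = (joinInl K L).app _ (leftAt (toJoinSimplex z) (𝟙 _) h) := by
  refine ext_at (fun i => h i) (fun d f hz hw => ?_) (fun d f hz hw => ?_)
  · rw [leftAt_joinInl]
    exact (leftAt_congr_hom (toJoinSimplex z) (Category.comp_id f).symm hz).trans
      (leftAt_comp (toJoinSimplex z) f (𝟙 _) h)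
  · exact absurd (hw 0) (by rw [cutAt_joinInl]; simp)

lemma eq_joinInr (z : (join K L) _⦋n⦌) (h : ∀ i, cutAt (toJoinSimplex z) i = 1) :
    z = (joinInr K L).app _ (rightAt (toJoinSimplex z) (𝟙 _) h) := by
  refine ext_at (fun i => h i) (fun d f hz hw => ?_) (fun d f hz hw => ?_)
  · exact absurd (hw 0) (by rw [cutAt_joinInr]; simp)
  · rw [rightAt_joinInr]
    exact (rightAt_congr_hom (toJoinSimplex z) (Category.comp_id f).symm hz).trans
      (rightAt_comp (toJoinSimplex z) f (𝟙 _) h)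

lemma eq_mk (z : (join K L) _⦋p + 1 + q⦌)
    (h0 : ∀ i, cutAt (toJoinSimplex z) (incL p q i) = 0)
    (h1 : ∀ i, cutAt (toJoinSimplex z) (incR p q i) = 1) :
    z = mk (leftAt (toJoinSimplex z) _ h0) (rightAt (toJoinSimplex z) _ h1) := by
  have hc : ∀ i : Fin (p + 1 + q + 1), cutAt (toJoinSimplex z) i = cutHom p q i := by
    intro i
    by_cases hi : (i : ℕ) ≤ p
    · rw [(cutHom_eq_zero_iff i).2 hi]
      exact h0 ⟨i, by lia⟩
    · rw [(cutHom_eq_one_iff i).2 (not_le.1 hi)]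
      refine Eq.trans (congrArg _ (Fin.ext ?_)) (h1 ⟨i - (p + 1), by lia⟩)
      change (i : ℕ) = p + 1 + (i - (p + 1))
      lia
  refine ext_at (fun i => ?_) (fun d f hz hw => ?_) (fun d f hz hw => ?_)
  · rw [cutAt_mk]
    exact hc i
  · rw [leftAt_mk]
    refine Eq.trans ?_ (leftAt_comp (toJoinSimplex z) (f ≫ projL p q) (incL p q) h0)
    refine leftAt_congr_hom _ ?_ _
    ext i : 3
    have hi := (cutHom_eq_zero_iff _).1 (hw i)
    exact Fin.ext (min_eq_left hi).symm
  · rw [rightAt_mk]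
    refine Eq.trans ?_ (rightAt_comp (toJoinSimplex z) (f ≫ projR p q) (incR p q) h1)
    refine rightAt_congr_hom _ ?_ _
    ext i : 3
    have hi := (cutHom_eq_one_iff _).1 (hw i)
    refine Fin.ext ?_
    change ((f i : Fin (p + 1 + q + 1)) : ℕ) = p + 1 + ((f i : Fin (p + 1 + q + 1)) - (p + 1))
    lia

/-- The cut is monotone. If it takes both values, the initial part stops just before the first
vertex with value 1. -/
lemma cases {P : ∀ n : ℕ, (join K L) _⦋n⦌ → Prop}
    (inl : ∀ (n : ℕ) (σ : K _⦋n⦌), P n ((joinInl K L).app _ σ))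
    (inr : ∀ (n : ℕ) (τ : L _⦋n⦌), P n ((joinInr K L).app _ τ))
    (mk : ∀ (p q : ℕ) (σ : K _⦋p⦌) (τ : L _⦋q⦌), P (p + 1 + q) (mk σ τ))
    (z : (join K L) _⦋n⦌) : P n z := by
  by_cases h0 : ∀ i, cutAt (toJoinSimplex z) i = 0
  · rw [eq_joinInl z h0]
    exact inl _ _
  by_cases h1 : ∀ i, cutAt (toJoinSimplex z) i = 1
  · rw [eq_joinInr z h1]
    exact inr _ _
  push Not at h0 h1
  obtain ⟨p, q, rfl, hp, hq⟩ : ∃ p q : ℕ, ∃ (h : p + 1 + q = n),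
      (∀ i : Fin (n + 1), (i : ℕ) ≤ p → cutAt (toJoinSimplex z) i = 0) ∧
      (∀ i : Fin (n + 1), p < (i : ℕ) → cutAt (toJoinSimplex z) i = 1) := by
    have hex : ∃ k : ℕ, ∃ hk : k < n + 1, cutAt (toJoinSimplex z) ⟨k, hk⟩ = 1 := by
      obtain ⟨i, hi⟩ := h0
      exact ⟨i, i.2, Fin.eq_one_of_ne_zero _ hi⟩
    classical
    obtain ⟨hk, hk'⟩ := Nat.find_spec hex
    obtain ⟨j, hj⟩ := h1
    have key : ∀ i : Fin (n + 1), Nat.find hex ≤ (i : ℕ) → cutAt (toJoinSimplex z) i = 1 := by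
      intro i hi
      have := cutAt_monotone (toJoinSimplex z) (show (⟨Nat.find hex, hk⟩ : Fin (n + 1)) ≤ i from hi)
      rw [hk'] at this
      lia
    have hpos : Nat.find hex ≠ 0 := fun h => hj (key j (by lia))
    refine ⟨Nat.find hex - 1, n - Nat.find hex, by lia, fun i hi => ?_, fun i hi => key i (by lia)⟩
    have := Nat.find_min hex (m := i) (by lia)
    push Not at this
    have := this i.2
    by_contra h
    exact this (Fin.eq_one_of_ne_zero _ h)
  rw [eq_mk z (fun i => hp _ (Nat.lt_succ_iff.1 i.2)) (fun i => hq _ (by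
    change p < p + 1 + (i : ℕ)
    lia))]
  exact mk _ _ _ _

/-- If the join of σ and τ is a degeneracy of w, both parts of w are nonempty, so w is itself a join
of two simplices, and one of the two dimensions must drop. -/
lemma mk_mem_nonDegenerate_iff (σ : K _⦋p⦌) (τ : L _⦋q⦌) :
    mk σ τ ∈ (join K L).nonDegenerate (p + 1 + q) ↔
      σ ∈ K.nonDegenerate p ∧ τ ∈ L.nonDegenerate q := by
  simp only [mem_nonDegenerate_iff_notMem_degenerate]
  rw [← not_or, not_iff_not]
  constructor
  · rintro ⟨m, hm, f, w, hw⟩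
    revert f hm
    refine cases (P := fun m w => ∀ (hm : m < p + 1 + q) (f : ⦋p + 1 + q⦌ ⟶ ⦋m⦌),
      (join K L).map f.op w = mk σ τ → σ ∈ K.degenerate p ∨ τ ∈ L.degenerate q) ?_ ?_ ?_ w
    · intro n σ' hm f h
      have h1 := cutAt_incR σ τ 0
      rw [← h] at h1
      have := (cutAt_map f _ _).symm.trans h1
      rw [cutAt_joinInl] at this
      simp at this
    · intro n τ' hm f h
      have h1 := cutAt_incL σ τ 0
      rw [← h] at h1
      have := (cutAt_map f _ _).symm.trans h1
      rw [cutAt_joinInr] at this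
      simp at this
    · intro p' q' σ' τ' hm f h
      have h1 := leftAt_congr h.symm (incL p q) (cutAt_incL σ τ)
      have h2 := rightAt_congr h.symm (incR p q) (cutAt_incR σ τ)
      rw [leftAt_incL] at h1
      rw [rightAt_incR] at h2
      by_cases hp : p' < p
      · exact Or.inl ⟨p', hp, incL p q ≫ f ≫ projL p' q', σ', h1.symm⟩
      · exact Or.inr ⟨q', by lia, incR p q ≫ f ≫ projR p' q', τ', h2.symm⟩
  · rintro (⟨m, hm, f, σ', rfl⟩ | ⟨m, hm, f, τ', rfl⟩)
    · exact ⟨m + 1 + q, by lia, star f (𝟙 _), mk σ' τ, by rw [map_star_mk]; simp⟩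
    · exact ⟨p + 1 + m, by lia, star (𝟙 _) f, mk σ τ', by rw [map_star_mk]; simp⟩

lemma joinMap_mk (f : K ⟶ K') (g : L ⟶ L') (σ : K _⦋p⦌) (τ : L _⦋q⦌) :
    (joinMap f g).app _ (mk σ τ) = mk (f.app _ σ) (g.app _ τ) := by
  refine ext_at (fun i => rfl) (fun d h hz hw => ?_) (fun d h hz hw => ?_)
  · exact NatTrans.naturality_apply f (h ≫ projL p q).op σ
  · exact NatTrans.naturality_apply g (h ≫ projR p q).op τ

lemma joinInl_joinMap (f : K ⟶ K') (g : L ⟶ L') :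
    joinInl K L ≫ joinMap f g = f ≫ joinInl K' L' := by
  ext ⟨⟨n⟩⟩ σ
  refine ext_at (fun i => rfl) (fun d h hz hw => ?_) (fun d h hz hw => ?_)
  · exact NatTrans.naturality_apply f h.op σ
  · exact absurd (show (0 : Fin 2) = 1 from hw 0) (by simp)

lemma joinInr_joinMap (f : K ⟶ K') (g : L ⟶ L') :
    joinInr K L ≫ joinMap f g = g ≫ joinInr K' L' := by
  ext ⟨⟨n⟩⟩ σ
  refine ext_at (fun i => rfl) (fun d h hz hw => ?_) (fun d h hz hw => ?_)
  · exact absurd (show (1 : Fin 2) = 0 from hw 0) (by simp)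
  · exact NatTrans.naturality_apply g h.op σ

end join

end SSet

/-! ### Pairings on joins -/

namespace SSet

namespace join

open JoinSimplex SimplexCategory

variable {B : SSet.{u}} (K : SSet.{u}) (A : B.Subcomplex) {p q n : ℕ}

/-- The subcomplex `K ⋆ A ∪ B` of `K ⋆ B`. -/
def union : (join K B).Subcomplex :=
  Subcomplex.range (joinMap (𝟙 K) A.ι) ⊔ Subcomplex.range (joinInr K B)

variable {K A}

lemma mk_mem_union_iff (σ : K _⦋p⦌) (τ : B _⦋q⦌) :
    mk σ τ ∈ (union K A).obj _ ↔ τ ∈ A.obj _ := by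
  constructor
  · rintro (⟨w, hw⟩ | ⟨w, hw⟩)
    · have h1 : ∀ i, cutAt (toJoinSimplex w) (incR p q i) = 1 := by
        have := cutAt_incR σ τ
        rw [← hw] at this
        exact this
      have h2 := rightAt_congr hw.symm (incR p q) (cutAt_incR σ τ)
      rw [rightAt_incR] at h2
      rw [h2]
      exact (rightAt (toJoinSimplex w) (incR p q) h1).2
    · have := cutAt_incL σ τ 0
      rw [← hw] at this
      exact absurd (show (1 : Fin 2) = 0 from this) (by simp)
  · intro h
    exact Or.inl ⟨mk σ ⟨τ, h⟩, joinMap_mk (𝟙 K) A.ι σ ⟨τ, h⟩⟩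

lemma joinInl_mem_union (σ : K _⦋n⦌) : (joinInl K B).app _ σ ∈ (union K A).obj _ :=
  Or.inl ⟨(joinInl K A).app _ σ,
    congrArg (fun f : K ⟶ join K B => f.app _ σ) (joinInl_joinMap (𝟙 K) A.ι)⟩

lemma joinInr_mem_union (τ : B _⦋n⦌) : (joinInr K B).app _ τ ∈ (union K A).obj _ :=
  Or.inr ⟨τ, rfl⟩

lemma mk_injective {σ σ' : K _⦋p⦌} {τ τ' : B _⦋q⦌} (h : mk σ τ = mk σ' τ') :
    σ = σ' ∧ τ = τ' := by
  obtain ⟨h1, h2⟩ := S_mk_mk_eq ((S.ext_iff _ _).2 h)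
  exact ⟨(S.ext_iff _ _).1 h1, (S.ext_iff _ _).1 h2⟩

/-- Deleting a vertex of the initial part would leave only p vertices there, whereas the right-hand
side has p + 1. -/
lemma exists_indexR_of_δ_mk_eq {σ σ' : K _⦋p⦌} {τ : B _⦋q + 1⦌} {τ' : B _⦋q⦌}
    {j : Fin (p + 1 + q + 2)} (h : (join K B).δ (n := p + 1 + q) j (mk σ τ) = mk σ' τ') :
    ∃ i : Fin (q + 2), j = indexR p i := by
  have hj : p < (j : ℕ) := by
    by_contra! hj
    have h1 := cutAt_incL σ' τ' (Fin.last p)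
    rw [← h] at h1
    have h2 := (cutAt_map (SimplexCategory.δ j) _ _).symm.trans h1
    rw [cutAt_mk, cutHom_eq_zero_iff] at h2
    change ((j.succAbove ⟨p, _⟩ : Fin _) : ℕ) ≤ p at h2
    rw [Fin.succAbove_of_le_castSucc j _ (by simpa [Fin.le_def] using hj)] at h2
    simp at h2
  refine ⟨⟨j - (p + 1), by lia⟩, Fin.ext ?_⟩
  simp only [indexR]
  lia

/-- The pairing of the simplices of `K ⋆ B` which do not belong to `K ⋆ A ∪ B` which is induced
by a pairing of the simplices of `B` which do not belong to `A`. -/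
def pairingCore (K : SSet.{u}) (h : A.PairingCore) : (union K A).PairingCore where
  ι := K.N × h.ι
  dim s := s.1.dim + 1 + h.dim s.2
  simplex s := mk s.1.simplex (h.simplex s.2)
  index s := indexR _ (h.index s.2)
  nonDegenerate₁ s := (mk_mem_nonDegenerate_iff _ _).2 ⟨s.1.nonDegenerate, h.nonDegenerate₁ _⟩
  nonDegenerate₂ s := by
    rw [δ_mk]
    exact (mk_mem_nonDegenerate_iff _ _).2 ⟨s.1.nonDegenerate, h.nonDegenerate₂ _⟩
  notMem₁ s := fun hs => h.notMem₁ s.2 ((mk_mem_union_iff _ _).1 hs)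
  notMem₂ s := by
    rw [δ_mk]
    exact fun hs => h.notMem₂ s.2 ((mk_mem_union_iff _ _).1 hs)
  injective_type₁' {s t} hst := by
    obtain ⟨h1, h2⟩ := S_mk_mk_eq hst
    exact Prod.ext ((SSet.N.ext_iff _ _).2 h1) (h.injective_type₁' h2)
  injective_type₂' {s t} hst := by
    rw [δ_mk, δ_mk] at hst
    obtain ⟨h1, h2⟩ := S_mk_mk_eq hst
    exact Prod.ext ((SSet.N.ext_iff _ _).2 h1) (h.injective_type₂' h2)
  type₁_ne_type₂' s t hst := by
    rw [δ_mk] at hst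
    exact h.type₁_ne_type₂' _ _ (S_mk_mk_eq hst).2
  surjective' x := by
    obtain ⟨m, x, hx, hx', rfl⟩ := x.mk_surjective
    revert hx hx'
    refine cases (P := fun m x => ∀ (hx : x ∈ (join K B).nonDegenerate m)
      (hx' : x ∉ (union K A).obj _), ∃ s : K.N × h.ι, (Subcomplex.N.mk x hx hx').toS =
        S.mk (mk s.1.simplex (h.simplex s.2)) ∨ (Subcomplex.N.mk x hx hx').toS =
          S.mk ((join K B).δ (n := s.1.dim + 1 + h.dim s.2) (indexR _ (h.index s.2))
            (mk s.1.simplex (h.simplex s.2)))) ?_ ?_ ?_ x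
    · exact fun _ σ _ h => absurd (joinInl_mem_union σ) h
    · exact fun _ τ _ h => absurd (joinInr_mem_union τ) h
    · intro p q σ τ hx hx'
      rw [mk_mem_nonDegenerate_iff] at hx
      rw [mk_mem_union_iff] at hx'
      obtain ⟨s, hs | hs⟩ := h.surjective' (Subcomplex.N.mk τ hx.2 hx')
      · refine ⟨⟨SSet.N.mk σ hx.1, s⟩, Or.inl ?_⟩
        obtain rfl : q = h.dim s + 1 := S.dim_eq_of_mk_eq hs
        obtain rfl : τ = h.simplex s := (S.ext_iff _ _).1 hs
        rfl
      · refine ⟨⟨SSet.N.mk σ hx.1, s⟩, Or.inr ?_⟩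
        rw [δ_mk]
        obtain rfl : q = h.dim s := S.dim_eq_of_mk_eq hs
        obtain rfl : τ = B.δ (h.index s) (h.simplex s) := (S.ext_iff _ _).1 hs
        rfl

instance (h : A.PairingCore) [h.IsProper] : (pairingCore K h).IsProper where
  isUniquelyCodimOneFace s := by
    refine (S.IsUniquelyCodimOneFace.iff _ _).2 ⟨_, rfl, fun j hj => ?_⟩
    have hj' := hj.trans (δ_mk s.1.simplex (h.simplex s.2) (h.index s.2))
    obtain ⟨i, rfl⟩ := exists_indexR_of_δ_mk_eq hj'
    have h1 := (mk_injective ((δ_mk _ _ _).symm.trans hj')).2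
    have h2 := (S.IsUniquelyCodimOneFace.iff _ _).1 (h.isUniquelyCodimOneFace s.2)
    exact congrArg (indexR _) (h2.unique h1 rfl)

/-- Along the ancestral relation the component in K can only pass to a face. Either its dimension
drops, or it is unchanged and the components in B are ancestrally related. -/
instance (h : A.PairingCore) [h.IsRegular] : (pairingCore K h).IsRegular where
  wf := by
    refine Subrelation.wf (r := InvImage (Prod.Lex (· < ·) h.AncestralRel)
      (fun s : K.N × h.ι => (s.1.dim, s.2))) ?_
      (InvImage.wf _ (WellFounded.prod_lex wellFounded_lt (Subcomplex.PairingCore.IsRegular.wf h)))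
    rintro (s : K.N × h.ι) (t : K.N × h.ι) ⟨hne, hlt⟩
    obtain ⟨f, hmono, hf⟩ := SSet.N.le_iff_exists_mono.1 (Subcomplex.N.le_iff.1 hlt.le)
    replace hf : (join K B).map f.op (mk t.1.simplex (h.simplex t.2)) =
      mk s.1.simplex (B.δ (h.index s.2) (h.simplex s.2)) := hf.trans (δ_mk _ _ _)
    have h1 := leftAt_congr hf.symm _ (cutAt_incL _ _)
    have h2 := rightAt_congr hf.symm _ (cutAt_incR _ _)
    rw [leftAt_incL] at h1
    rw [rightAt_incR] at h2
    have h3 : s.1 ≤ t.1 := SSet.N.le_iff.2 (by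
      rw [Subcomplex.ofSimplex_le_iff]
      exact ⟨_, h1.symm⟩)
    rcases h3.eq_or_lt with h3 | h3
    · refine Prod.lex_iff.2 (Or.inr ⟨congrArg (fun x : K.N => x.dim) h3,
        fun h4 => hne (Prod.ext h3 h4), ?_⟩)
      refine lt_of_le_of_ne (Subcomplex.N.le_iff.2 (SSet.N.le_iff.2 ?_))
        (h.type₁_ne_type₂ _ _).symm
      rw [Subcomplex.ofSimplex_le_iff]
      exact ⟨_, h2.symm⟩
    · exact Prod.Lex.left _ _ (SSet.N.dim_lt_of_lt h3)

/-- An index p + 1 + i is never 0, and it is last only when i is last. Hence only the last index has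
to be excluded in B. -/
lemma isInner_pairingCore (h : A.PairingCore) (hi : ∀ s, h.index s ≠ Fin.last _) :
    (pairingCore K h).IsInner where
  ne_zero s h' := by
    have := congrArg Fin.val h'
    simp [pairingCore, indexR] at this
  ne_last s h' := by
    have := congrArg Fin.val h'
    simp [pairingCore, indexR] at this
    refine hi s.2 (Fin.ext ?_)
    simp
    lia

lemma innerAnodyneExtensions_union_ι (h : A.PairingCore) [h.IsRegular]
    (hi : ∀ s, h.index s ≠ Fin.last _) : innerAnodyneExtensions (union K A).ι := by
  have := isInner_pairingCore (K := K) h hi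
  exact (pairingCore K h).pairing.innerAnodyneExtensions

end join

/-- A map out of a union of two subobjects is glued pointwise: injectivity makes the value
independent of the preimage, and the hypothesis settles the overlap. -/
lemma Subcomplex.exists_desc_range_sup {P Q X Z : SSet.{u}} (f : P ⟶ X) (g : Q ⟶ X)
    (a : P ⟶ Z) (b : Q ⟶ Z) [Mono f] [Mono g]
    (h : ∀ (n : SimplexCategoryᵒᵖ) (x : P.obj n) (y : Q.obj n), f.app n x = g.app n y →
      a.app n x = b.app n y) :
    ∃ φ : ((range f ⊔ range g : X.Subcomplex) : SSet.{u}) ⟶ Z,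
      (∀ n x, φ.app n ⟨f.app n x, Or.inl ⟨x, rfl⟩⟩ = a.app n x) ∧
      (∀ n y, φ.app n ⟨g.app n y, Or.inr ⟨y, rfl⟩⟩ = b.app n y) := by
  have hf : ∀ {n} {x x' : P.obj n}, f.app n x = f.app n x' → x = x' := fun {n} _ _ h =>
    (mono_iff_injective _).1 ((NatTrans.mono_iff_mono_app f).1 inferInstance n) h
  have hg : ∀ {n} {x x' : Q.obj n}, g.app n x = g.app n x' → x = x' := fun {n} _ _ h =>
    (mono_iff_injective _).1 ((NatTrans.mono_iff_mono_app g).1 inferInstance n) h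
  have key : ∀ (n : SimplexCategoryᵒᵖ) (z : ((range f ⊔ range g : X.Subcomplex) : SSet.{u}).obj n),
      ∃ w : Z.obj n, (∀ x, f.app n x = z.1 → w = a.app n x) ∧
        (∀ y, g.app n y = z.1 → w = b.app n y) := by
    rintro n ⟨z, ⟨x, hx⟩ | ⟨y, hy⟩⟩
    · exact ⟨a.app n x, fun x' hx' => by rw [hf (hx.trans hx'.symm)],
        fun y hy => h _ _ _ (hx.trans hy.symm)⟩
    · exact ⟨b.app n y, fun x hx => (h _ _ _ (hx.trans hy.symm)).symm,
        fun y' hy' => by rw [hg (hy.trans hy'.symm)]⟩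
  choose w hw₁ hw₂ using key
  refine ⟨{ app n := ↾(w n), naturality n m k := ?_ },
    fun n x => hw₁ n _ x rfl, fun n y => hw₂ n _ y rfl⟩
  · ext ⟨z, ⟨x, hx⟩ | ⟨y, hy⟩⟩
    · refine (hw₁ m _ (P.map k x) ?_).trans ?_
      · refine (NatTrans.naturality_apply f k x).trans ?_
        rw [hx]
        rfl
      · refine (NatTrans.naturality_apply a k x).trans ?_
        exact congrArg _ (hw₁ n _ x hx).symm
    · refine (hw₂ m _ (Q.map k y) ?_).trans ?_
      · refine (NatTrans.naturality_apply g k y).trans ?_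
        rw [hy]
        rfl
      · refine (NatTrans.naturality_apply b k y).trans ?_
        exact congrArg _ (hw₂ n _ y hy).symm

namespace join

open JoinSimplex

variable {K L K' L' : SSet.{u}}

lemma joinMap_injective (f : K ⟶ K') (g : L ⟶ L') [Mono f] [Mono g] {n : ℕ}
    {x y : (join K L) _⦋n⦌} (h : (joinMap f g).app _ x = (joinMap f g).app _ y) : x = y := by
  have hf : ∀ {n} {x x' : K.obj n}, f.app n x = f.app n x' → x = x' := fun {n} _ _ h =>
    (mono_iff_injective _).1 ((NatTrans.mono_iff_mono_app f).1 inferInstance n) h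
  have hg : ∀ {n} {x x' : L.obj n}, g.app n x = g.app n x' → x = x' := fun {n} _ _ h =>
    (mono_iff_injective _).1 ((NatTrans.mono_iff_mono_app g).1 inferInstance n) h
  have hc : ∀ i, cutAt (toJoinSimplex x) i = cutAt (toJoinSimplex y) i := fun i =>
    congrArg (fun z : (join K' L') _⦋n⦌ => cutAt (toJoinSimplex z) i) h
  exact ext_at hc (fun d k hz _ => hf (leftAt_congr h k hz))
    (fun d k hz _ => hg (rightAt_congr h k hz))

instance (f : K ⟶ K') (g : L ⟶ L') [Mono f] [Mono g] : Mono (joinMap f g) := by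
  rw [NatTrans.mono_iff_mono_app]
  rintro ⟨⟨n⟩⟩
  rw [mono_iff_injective]
  exact fun x y h => joinMap_injective f g h

instance : Mono (joinInr K L) := by
  rw [NatTrans.mono_iff_mono_app]
  rintro ⟨⟨n⟩⟩
  rw [mono_iff_injective]
  intro x y h
  have : L.map (𝟙 ⦋n⦌).op x = L.map (𝟙 ⦋n⦌).op y := rightAt_congr h (𝟙 _) (fun i => rfl)
  simpa using this

/-- If an inner fibration lifts against `A ⟶ B`, it lifts against `K ⋆ A ⟶ K ⋆ B`, provided that
the simplices of `B` not in `A` are suitably paired. -/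
lemma hasLiftingProperty_joinMap {B X Y : SSet.{u}} {A : B.Subcomplex} (h : A.PairingCore)
    [h.IsRegular] (hi : ∀ s, h.index s ≠ Fin.last _) {p : X ⟶ Y} (hp : innerFibrations p)
    [HasLiftingProperty A.ι p] : HasLiftingProperty (joinMap (𝟙 K) A.ι) p where
  sq_hasLift {a b} sq := by
    -- The lift is first chosen on the terminal part B, where it exists by hypothesis. Glued to a it
    -- gives a map on K ⋆ A ∪ B, and the rest of K ⋆ B is inner anodyne over that.
    have sq' : CommSq (joinInr K A ≫ a) A.ι p (joinInr K B ≫ b) := ⟨by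
      rw [Category.assoc, sq.w, ← Category.assoc, joinInr_joinMap, Category.assoc]⟩
    obtain ⟨φ, h1, h2⟩ := Subcomplex.exists_desc_range_sup (joinMap (𝟙 K) A.ι) (joinInr K B)
      a sq'.lift (by
        -- A simplex of K ⋆ A whose image lies in the terminal part comes from A, where both maps
        -- agree.
        rintro ⟨⟨n⟩⟩ x y hxy
        have hc : ∀ i, cutAt (toJoinSimplex x) i = 1 := fun i =>
          congrArg (fun z : (join K B) _⦋n⦌ => cutAt (toJoinSimplex z) i) hxy
        obtain ⟨y', rfl⟩ : ∃ y', x = (joinInr K A).app _ y' := ⟨_, eq_joinInr x hc⟩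
        obtain rfl : A.ι.app _ y' = y :=
          (mono_iff_injective _).1 ((NatTrans.mono_iff_mono_app (joinInr K B)).1 inferInstance _)
            ((congrArg (fun f : (A : SSet.{u}) ⟶ join K B => f.app _ y')
              (joinInr_joinMap (𝟙 K) A.ι)).symm.trans hxy)
        exact (congrArg (fun f : (A : SSet.{u}) ⟶ X => f.app _ y') sq'.fac_left).symm)
    have := innerAnodyneExtensions_union_ι (K := K) h hi p hp
    have sq'' : CommSq φ (union K A).ι p b := ⟨by
      ext n ⟨z, ⟨x, hx⟩ | ⟨y, hy⟩⟩
      · subst hx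
        exact (congrArg (fun w => p.app n w) (h1 n x)).trans
          (congrArg (fun f : _ ⟶ Y => f.app n x) sq.w)
      · subst hy
        exact (congrArg (fun w => p.app n w) (h2 n y)).trans
          (congrArg (fun f : _ ⟶ Y => f.app n y) sq'.fac_right)⟩
    have hL : sq''.HasLift := this.sq_hasLift sq''
    refine ⟨⟨⟨sq''.lift, ?_, sq''.fac_right⟩⟩⟩
    ext n x
    exact (congrArg (fun f : (union K A : SSet.{u}) ⟶ X => f.app n
      ⟨(joinMap (𝟙 K) A.ι).app n x, Or.inl ⟨x, rfl⟩⟩) sq''.fac_left).trans (h1 n x)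

end join

end SSet

/-! ### Pairings for horns and for {0} in E[1] -/

namespace SSet

/-- The pairing of the two nondegenerate simplices of `Δ[n + 1]` which do not belong to a horn. -/
def hornPairingCore {n : ℕ} (i : Fin (n + 2)) : (horn.{u} (n + 1) i).PairingCore where
  ι := PUnit.{u + 1}
  dim _ := n
  simplex _ := stdSimplex.objEquiv.symm (𝟙 _)
  index _ := i
  nonDegenerate₁ _ := by
    rw [stdSimplex.objEquiv_symm_mem_nonDegenerate_iff_mono]
    infer_instance
  nonDegenerate₂ _ := by
    refine (stdSimplex.objEquiv_symm_mem_nonDegenerate_iff_mono (SimplexCategory.δ i)).2 ?_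
    infer_instance
  notMem₁ _ h := h (by
    rw [Set.eq_univ_iff_forall]
    exact fun j => Or.inl ⟨j, rfl⟩)
  notMem₂ _ h := h (by
    rw [Set.eq_univ_iff_forall]
    intro j
    by_cases hj : j = i
    · exact Or.inr hj
    · obtain ⟨k, hk⟩ := Fin.exists_succAbove_eq hj
      exact Or.inl ⟨k, hk⟩)
  injective_type₁' _ := rfl
  injective_type₂' _ := rfl
  type₁_ne_type₂' _ _ h := by
    have := S.dim_eq_of_mk_eq h
    lia
  surjective' x := by
    obtain ⟨m, x, hx, hx', rfl⟩ := x.mk_surjective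
    obtain ⟨f, rfl⟩ := stdSimplex.objEquiv.symm.surjective x
    rw [stdSimplex.objEquiv_symm_mem_nonDegenerate_iff_mono] at hx
    have hr : ∀ j : Fin (n + 2), (∃ k : Fin (m + 1), f k = j) ∨ j = i := by
      have h1 : Set.range (fun k : Fin (m + 1) => (f k : Fin (n + 2))) ∪ {i} = Set.univ :=
        not_not.1 hx'
      intro j
      have : j ∈ Set.range (fun k : Fin (m + 1) => (f k : Fin (n + 2))) ∪ {i} := h1 ▸ Set.mem_univ _
      exact this
    have hf : Function.Injective f := SimplexCategory.mono_iff_injective.1 hx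
    refine ⟨⟨⟩, ?_⟩
    by_cases hi : ∃ k : Fin (m + 1), f k = i
    · left
      have hs : Function.Surjective f := fun j => (hr j).elim id (fun h => h ▸ hi)
      obtain rfl : m = n + 1 := by
        have := Fintype.card_congr (Equiv.ofBijective _ ⟨hf, hs⟩)
        simpa using this
      obtain rfl := SimplexCategory.eq_id_of_mono f
      rfl
    · right
      have h1 : Finset.univ.image (fun k : Fin (m + 1) => (f k : Fin (n + 2))) = {i}ᶜ := by
        ext j
        simp only [Finset.mem_image, Finset.mem_univ, true_and, Finset.mem_compl,
          Finset.mem_singleton]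
        exact ⟨fun ⟨k, hk⟩ h => hi ⟨k, hk.trans h⟩, fun h => (hr j).resolve_right h⟩
      obtain rfl : m = n := by
        have := congrArg Finset.card h1
        rw [Finset.card_image_of_injective _ hf, Finset.card_compl] at this
        simpa using this
      obtain ⟨j, rfl⟩ := SimplexCategory.eq_δ_of_mono f
      obtain rfl : j = i := (hr j).resolve_left (fun ⟨k, hk⟩ => Fin.succAbove_ne j k hk)
      rfl

instance {n : ℕ} (i : Fin (n + 2)) : (hornPairingCore.{u} i).IsRegular where
  isUniquelyCodimOneFace s :=
    isUniquelyCodimOneFace_δ ((hornPairingCore.{u} i).nonDegenerate₁ s) _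
  wf := ⟨fun s => ⟨_, fun t ht => absurd (Subsingleton.elim (α := PUnit) t s) ht.1⟩⟩

namespace coherentIso

/-- Alternating labels, starting with `false`. -/
def alternating (n : ℕ) : coherentIso.{u} _⦋n⦌ := ofLabel fun i => decide (Odd (i : ℕ))

lemma label_alternating (n : ℕ) (i : Fin (n + 1)) :
    label (alternating.{u} n) i = decide (Odd (i : ℕ)) := rfl

lemma mem_nonDegenerate_iff {n : ℕ} (x : coherentIso.{u} _⦋n⦌) :
    x ∈ coherentIso.nonDegenerate n ↔
      ∀ (i : ℕ) (hi : i < n), label x ⟨i, by lia⟩ ≠ label x ⟨i + 1, by lia⟩ := by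
  simp only [mem_nonDegenerate_iff_vertex_ne, ne_eq, vertex_eq_iff]

/-- Labels of a nondegenerate simplex alternate, so there are two such simplices in each dimension.
The pairing matches the one of dimension n + 1 starting with false with its 0-th face, which starts
with true. -/
lemma eq_of_mem_nonDegenerate {n : ℕ} {x y : coherentIso.{u} _⦋n⦌}
    (hx : x ∈ coherentIso.nonDegenerate n) (hy : y ∈ coherentIso.nonDegenerate n)
    (h : label x 0 = label y 0) : x = y := by
  rw [mem_nonDegenerate_iff] at hx hy
  refine label_ext fun i => ?_
  obtain ⟨i, hi⟩ := i
  induction i with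
  | zero => exact h
  | succ i ih =>
    have h1 := hx i (by lia)
    have h2 := hy i (by lia)
    have h3 := ih (by lia)
    revert h1 h2 h3
    generalize label x ⟨i, _⟩ = a, label y ⟨i, _⟩ = b, label x ⟨i + 1, _⟩ = c,
      label y ⟨i + 1, _⟩ = d
    revert a b c d
    decide

lemma alternating_mem_nonDegenerate (n : ℕ) :
    alternating.{u} n ∈ coherentIso.nonDegenerate n := by
  rw [mem_nonDegenerate_iff]
  intro i hi
  simp only [label_alternating, ne_eq, decide_eq_decide, Nat.odd_add_one]
  tauto

lemma label_δ_alternating (n : ℕ) (i : Fin (n + 1)) :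
    label (coherentIso.δ 0 (alternating.{u} (n + 1))) i = decide (Odd ((i : ℕ) + 1)) := by
  rw [label_δ, label_alternating, Fin.succAbove_zero, Fin.val_succ]

lemma δ_alternating_mem_nonDegenerate (n : ℕ) :
    coherentIso.δ 0 (alternating.{u} (n + 1)) ∈ coherentIso.nonDegenerate n := by
  rw [mem_nonDegenerate_iff]
  intro i hi
  simp only [label_δ_alternating, ne_eq, decide_eq_decide, Nat.odd_add_one]
  tauto

/-- The pairing of the simplices of `E[1]` which do not belong to `{0}`. -/
def zeroPairingCore : (zero.{u}).PairingCore where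
  ι := ℕ
  dim n := n
  simplex n := alternating (n + 1)
  index _ := 0
  nonDegenerate₁ _ := alternating_mem_nonDegenerate _
  nonDegenerate₂ _ := δ_alternating_mem_nonDegenerate _
  notMem₁ n h := by
    rw [mem_zero_iff] at h
    have := h 1
    rw [label_alternating] at this
    simp at this
  notMem₂ n h := by
    rw [mem_zero_iff] at h
    have := h 0
    rw [label_δ_alternating] at this
    simp at this
  injective_type₁' h := Nat.succ_injective (S.dim_eq_of_mk_eq h)
  injective_type₂' h := S.dim_eq_of_mk_eq h
  type₁_ne_type₂' m n h := by
    obtain rfl : m + 1 = n := S.dim_eq_of_mk_eq h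
    have := congrArg (fun x => label x 0) ((S.ext_iff _ _).1 h)
    simp only [label_alternating, label_δ_alternating] at this
    simp at this
  surjective' x := by
    obtain ⟨m, x, hx, hx', rfl⟩ := x.mk_surjective
    by_cases h : label x 0 = false
    · obtain _ | m := m
      · exact absurd ((mem_zero_iff x).2 fun i => by
          obtain rfl : i = 0 := by lia
          exact h) hx'
      · refine ⟨m, Or.inl ?_⟩
        obtain rfl : x = alternating (m + 1) :=
          eq_of_mem_nonDegenerate hx (alternating_mem_nonDegenerate _) (by
            rw [h, label_alternating]
            simp)
        rfl
    · refine ⟨m, Or.inr ?_⟩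
      obtain rfl : x = coherentIso.δ 0 (alternating (m + 1)) :=
        eq_of_mem_nonDegenerate hx (δ_alternating_mem_nonDegenerate _) (by
          rw [Bool.eq_true_of_not_eq_false h, label_δ_alternating]
          simp)
      rfl

instance : zeroPairingCore.{u}.IsRegular where
  isUniquelyCodimOneFace s :=
    isUniquelyCodimOneFace_δ (zeroPairingCore.nonDegenerate₁ s) _
  wf := by
    refine Subrelation.wf (r := fun (m n : ℕ) => m < n) ?_ wellFounded_lt
    rintro (m : ℕ) (n : ℕ) ⟨hne, hlt⟩
    have : m < n + 1 := SSet.N.dim_lt_of_lt hlt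
    have hne' : m ≠ n := hne
    lia

/-- `E[1]` has one vertex in `zero`. -/
lemma coherentIsoZero_eq : ∃ e : (Δ[0] : SSet.{u}) ⟶ (zero.{u} : SSet.{u}), IsIso e ∧
    e ≫ (zero.{u}).ι = coherentIsoZero := by
  refine ⟨Subcomplex.lift coherentIsoZero ?_, ?_, rfl⟩
  · rintro ⟨⟨n⟩⟩ _ ⟨x, rfl⟩
    rw [mem_zero_iff]
    exact fun _ => rfl
  · rw [NatTrans.isIso_iff_isIso_app]
    rintro ⟨⟨n⟩⟩
    rw [isIso_iff_bijective]
    refine ⟨fun x y _ => ?_, fun ⟨x, hx⟩ =>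
      ⟨stdSimplex.objEquiv.symm (SimplexCategory.const _ _ 0), Subtype.ext ?_⟩⟩
    · ext i : 1
      exact Subsingleton.elim (α := Fin 1) _ _
    · exact label_ext fun i => ((mem_zero_iff x).1 hx i).symm

end coherentIso

lemma hasLiftingProperty_zero_iff {X Y : SSet.{u}} (p : X ⟶ Y) :
    HasLiftingProperty coherentIsoZero.{u} p ↔ HasLiftingProperty coherentIso.zero.{u}.ι p := by
  obtain ⟨e, he, h⟩ := coherentIso.coherentIsoZero_eq.{u}
  let φ : Arrow.mk coherentIsoZero.{u} ≅ Arrow.mk coherentIso.zero.{u}.ι :=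
    Arrow.isoMk (asIso e) (Iso.refl _) (by simpa using h)
  exact HasLiftingProperty.iff_of_arrow_iso_left φ p

namespace join

variable {K X Y : SSet.{u}} {p : X ⟶ Y}

lemma hasLiftingProperty_joinMap_horn (hp : innerFibrations p) {n : ℕ} {i : Fin (n + 1)}
    (h0 : 0 < i) (hn : i < Fin.last n) :
    HasLiftingProperty (joinMap (𝟙 K) (horn.{u} n i).ι) p := by
  obtain _ | n := n
  · lia
  · have := hp _ (horn_ι_mem_innerHornInclusions h0 hn)
    exact hasLiftingProperty_joinMap (hornPairingCore i) (fun _ => hn.ne) hp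

/-- The pairing of E[1] has index 0, which is never the last index of a simplex of positive
dimension; this is all that the join requires. -/
lemma hasLiftingProperty_joinMap_zero (hp : IsInnerIsofibration p) :
    HasLiftingProperty (joinMap (𝟙 K) coherentIso.zero.{u}.ι) p := by
  have := (hasLiftingProperty_zero_iff p).1 hp.2
  exact hasLiftingProperty_joinMap coherentIso.zeroPairingCore
    (fun _ => (Fin.last_pos).ne) hp.1

end join

end SSet

/-! ### Slices and their adjunction with joins -/

namespace SSet

variable {K C D : SSet.{u}}

lemma joinMap_comp {L L' L'' : SSet.{u}} (f : L ⟶ L') (g : L' ⟶ L'') :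
    joinMap (𝟙 K) (f ≫ g) = joinMap (𝟙 K) f ≫ joinMap (𝟙 K) g := rfl

lemma joinInl_joinMap_id {L L' : SSet.{u}} (f : L ⟶ L') (U : join K L' ⟶ C) :
    joinInl K L ≫ joinMap (𝟙 K) f ≫ U = joinInl K L' ≫ U := by
  rw [← Category.assoc, join.joinInl_joinMap, Category.id_comp]

/-- The slice `C_{X/}` under a diagram `X : K ⟶ C`. -/
def slice (X : K ⟶ C) : SSet.{u} where
  obj n := { U : join K (SSet.stdSimplex.{u}.obj n.unop) ⟶ C // joinInl K _ ≫ U = X }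
  map f := ↾fun U => ⟨joinMap (𝟙 K) (SSet.stdSimplex.map f.unop) ≫ U.1, by
    rw [joinInl_joinMap_id, U.2]⟩
  map_id n := ConcreteCategory.hom_ext _ _ fun U => Subtype.ext
    (congrArg (fun g => joinMap (𝟙 K) g ≫ U.1)
      (CategoryTheory.Functor.map_id SSet.stdSimplex n.unop))
  map_comp f g := ConcreteCategory.hom_ext _ _ fun U => Subtype.ext
    (congrArg (fun g => joinMap (𝟙 K) g ≫ U.1)
      (CategoryTheory.Functor.map_comp SSet.stdSimplex g.unop f.unop))

namespace slice

variable {X : K ⟶ C}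

/-- The map `K ⋆ Δ[n] ⟶ C` corresponding to a simplex of a slice. -/
def hom {n : SimplexCategory} (U : (slice X).obj (op n)) :
    join K (SSet.stdSimplex.{u}.obj n) ⟶ C :=
  U.1

lemma joinInl_hom {n : SimplexCategory} (U : (slice X).obj (op n)) : joinInl K _ ≫ hom U = X := U.2

lemma hom_map {n m : SimplexCategory} (f : m ⟶ n) (U : (slice X).obj (op n)) :
    hom ((slice X).map f.op U) = joinMap (𝟙 K) (SSet.stdSimplex.map f) ≫ hom U := rfl

lemma map_ext {L : SSet.{u}} {φ ψ : L ⟶ slice X}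
    (h : ∀ (n : ℕ) (r : L _⦋n⦌), hom (φ.app (op ⦋n⦌) r) = hom (ψ.app (op ⦋n⦌) r)) : φ = ψ := by
  refine NatTrans.ext (funext fun n => ConcreteCategory.hom_ext _ _ fun r => ?_)
  exact Subtype.ext (h n.unop.len r)

end slice

open slice

/-- Functoriality of slices. -/
def sliceMap (P : C ⟶ D) {X : K ⟶ C} {Y : K ⟶ D} (h : X ≫ P = Y) : slice X ⟶ slice Y where
  app n := ↾fun U => ⟨hom U ≫ P, by rw [← Category.assoc, joinInl_hom, h]⟩
  naturality _ _ _ := ConcreteCategory.hom_ext _ _ fun _ => Subtype.ext rfl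

variable {X : K ⟶ C} {L L' : SSet.{u}}

/-- The map to a slice which corresponds to a map from a join. -/
def toSlice (U : join K L ⟶ C) (hU : joinInl K L ≫ U = X) : L ⟶ slice X where
  app n := ↾fun r => ⟨joinMap (𝟙 K) (yonedaEquiv.symm r) ≫ U, by
    rw [joinInl_joinMap_id, hU]⟩
  naturality m n f := by
    ext r
    refine Subtype.ext ?_
    change joinMap (𝟙 K) (yonedaEquiv.symm (L.map f r)) ≫ U =
      joinMap (𝟙 K) (SSet.stdSimplex.map f.unop) ≫ joinMap (𝟙 K) (yonedaEquiv.symm r) ≫ U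
    rw [← Category.assoc, ← joinMap_comp]
    exact congrArg (fun g => joinMap (𝟙 K) g ≫ U) (yonedaEquiv_symm_naturality_left f.unop r).symm

lemma hom_toSlice (U : join K L ⟶ C) (hU : joinInl K L ≫ U = X) {n : SimplexCategory}
    (r : L.obj (op n)) :
    hom ((toSlice U hU).app _ r) = joinMap (𝟙 K) (yonedaEquiv.symm r) ≫ U := rfl

lemma comp_toSlice (g : L ⟶ L') (U : join K L' ⟶ C) (hU : joinInl K L' ≫ U = X) :
    g ≫ toSlice U hU = toSlice (joinMap (𝟙 K) g ≫ U) (by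
      rw [joinInl_joinMap_id, hU]) := by
  refine map_ext fun n r => ?_
  rw [hom_toSlice, ← Category.assoc, ← joinMap_comp, yonedaEquiv_symm_comp]
  rfl

lemma toSlice_sliceMap (U : join K L ⟶ C) (hU : joinInl K L ≫ U = X) (P : C ⟶ D) {Y : K ⟶ D}
    (h : X ≫ P = Y) :
    toSlice U hU ≫ sliceMap P h = toSlice (U ≫ P) (by rw [← Category.assoc, hU, h]) := rfl

namespace join

open JoinSimplex

/-- The simplex of `K ⋆ L` obtained from a simplex of `K ⋆ Δ[m]` and a simplex of `L`. -/
lemma eq_joinInl_or_eq_joinMap {n : ℕ} (z : (join K L) _⦋n⦌) :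
    (∃ σ, z = (joinInl K L).app _ σ) ∨ ∃ (m : ℕ) (r : L _⦋m⦌) (w : (join K Δ[m]) _⦋n⦌),
      z = (joinMap (𝟙 K) (yonedaEquiv.symm r)).app _ w := by
  refine cases (P := fun n z => (∃ σ, z = (joinInl K L).app _ σ) ∨
    ∃ (m : ℕ) (r : L _⦋m⦌) (w : (join K Δ[m]) _⦋n⦌),
      z = (joinMap (𝟙 K) (yonedaEquiv.symm r)).app _ w) ?_ ?_ ?_ z
  · exact fun n σ => Or.inl ⟨σ, rfl⟩
  · refine fun n τ => Or.inr ⟨n, τ, (joinInr K _).app _ (yonedaEquiv (𝟙 _)), ?_⟩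
    have := congrArg (fun f : Δ[n] ⟶ join K L => f.app _ (yonedaEquiv (𝟙 _)))
      (joinInr_joinMap (𝟙 K) (yonedaEquiv.symm τ))
    refine Eq.trans ?_ this.symm
    exact congrArg ((joinInr K L).app _) (yonedaEquiv_symm_app_id τ).symm
  · refine fun p q σ τ => Or.inr ⟨q, τ, mk σ (yonedaEquiv (𝟙 _)), ?_⟩
    rw [joinMap_mk, yonedaEquiv_symm_app_id]
    rfl

lemma joinInl_injective {n : ℕ} {σ σ' : K _⦋n⦌}
    (h : (joinInl K L).app _ σ = (joinInl K L).app _ σ') : σ = σ' := by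
  have : K.map (𝟙 ⦋n⦌).op σ = K.map (𝟙 ⦋n⦌).op σ' := leftAt_congr h (𝟙 _) (fun i => rfl)
  simpa using this

lemma joinInr_injective {n : ℕ} {τ τ' : L _⦋n⦌}
    (h : (joinInr K L).app _ τ = (joinInr K L).app _ τ') : τ = τ' := by
  have : L.map (𝟙 ⦋n⦌).op τ = L.map (𝟙 ⦋n⦌).op τ' := rightAt_congr h (𝟙 _) (fun i => rfl)
  simpa using this

lemma hom_app_map (φ : L ⟶ slice X) {m n d : ℕ} (f : ⦋n⦌ ⟶ ⦋m⦌) (r : L _⦋m⦌)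
    (w : (join K Δ[n]) _⦋d⦌) :
    (hom (φ.app (op ⦋n⦌) (L.map f.op r))).app (op ⦋d⦌) w =
      (hom (φ.app (op ⦋m⦌) r)).app (op ⦋d⦌) ((joinMap (𝟙 K) (SSet.stdSimplex.map f)).app _ w) := by
  rw [NatTrans.naturality_apply φ f.op r, hom_map]
  rfl

/-- A simplex of K ⋆ L factors through K ⋆ Δ[m] in many ways, but all factorizations come from the
one in which Δ[m] is its terminal part. Naturality of φ then makes the value independent of the
choice. -/
lemma exists_value (φ : L ⟶ slice X) {n : ℕ} (z : (join K L) _⦋n⦌) :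
    ∃ u : C _⦋n⦌, (∀ σ, (joinInl K L).app _ σ = z → u = X.app _ σ) ∧
      (∀ (m : ℕ) (r : L _⦋m⦌) (w : (join K Δ[m]) _⦋n⦌),
        (joinMap (𝟙 K) (yonedaEquiv.symm r)).app _ w = z →
          u = (hom (φ.app (op ⦋m⦌) r)).app (op ⦋n⦌) w) := by
  refine cases (P := fun n z => ∃ u : C _⦋n⦌, (∀ σ, (joinInl K L).app _ σ = z → u = X.app _ σ) ∧
      (∀ (m : ℕ) (r : L _⦋m⦌) (w : (join K Δ[m]) _⦋n⦌),
        (joinMap (𝟙 K) (yonedaEquiv.symm r)).app _ w = z →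
          u = (hom (φ.app (op ⦋m⦌) r)).app (op ⦋n⦌) w)) ?_ ?_ ?_ z
  · intro n σ
    refine ⟨X.app _ σ, fun σ' h => by rw [joinInl_injective h], fun m r w hw => ?_⟩
    have hc : ∀ i, cutAt (toJoinSimplex w) i = 0 := fun i =>
      congrArg (fun z : (join K L) _⦋n⦌ => cutAt (toJoinSimplex z) i) hw
    obtain ⟨σ', rfl⟩ : ∃ σ', w = (joinInl K Δ[m]).app _ σ' := ⟨_, eq_joinInl w hc⟩
    obtain rfl : σ' = σ := joinInl_injective
      ((congrArg (fun f : K ⟶ join K L => f.app _ σ')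
        (joinInl_joinMap (𝟙 K) (yonedaEquiv.symm r))).symm.trans hw)
    exact (congrArg (fun f : K ⟶ C => f.app _ σ') (joinInl_hom (φ.app (op ⦋m⦌) r))).symm
  · intro n τ
    refine ⟨(hom (φ.app (op ⦋n⦌) τ)).app _ ((joinInr K Δ[n]).app _ (yonedaEquiv (𝟙 Δ[n]))),
      fun σ' h => ?_, fun m r w hw => ?_⟩
    · exact absurd (congrArg (fun z : (join K L) _⦋n⦌ => cutAt (toJoinSimplex z) 0) h)
        (by change (0 : Fin 2) ≠ 1; simp)
    · have hc : ∀ i, cutAt (toJoinSimplex w) i = 1 := fun i =>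
        congrArg (fun z : (join K L) _⦋n⦌ => cutAt (toJoinSimplex z) i) hw
      obtain ⟨θ, rfl⟩ : ∃ θ, w = (joinInr K Δ[m]).app _ θ := ⟨_, eq_joinInr w hc⟩
      obtain ⟨f, rfl⟩ := stdSimplex.objEquiv.symm.surjective θ
      obtain rfl : L.map f.op r = τ := joinInr_injective
        ((congrArg (fun g : Δ[m] ⟶ join K L => g.app _ (stdSimplex.objEquiv.symm f))
          (joinInr_joinMap (𝟙 K) (yonedaEquiv.symm r))).symm.trans hw)
      rw [hom_app_map]
      refine congrArg ((hom (φ.app (op ⦋m⦌) r)).app _) ?_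
      refine (congrArg (fun g : Δ[n] ⟶ join K Δ[m] => g.app _ (yonedaEquiv (𝟙 Δ[n])))
        (joinInr_joinMap (𝟙 K) (SSet.stdSimplex.map f))).trans ?_
      exact congrArg ((joinInr K Δ[m]).app _) (yonedaEquiv_map f)
  · intro p q σ τ
    refine ⟨(hom (φ.app (op ⦋q⦌) τ)).app _ (mk σ (yonedaEquiv (𝟙 Δ[q]))),
      fun σ' h => ?_, fun m r w hw => ?_⟩
    · have h1 := cutAt_incR σ τ 0
      rw [← h] at h1
      exact absurd h1 (by change (0 : Fin 2) ≠ 1; simp)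
    · have h0 : ∀ i, cutAt (toJoinSimplex w) (incL p q i) = 0 := fun i =>
        (congrArg (fun z : (join K L) _⦋p + 1 + q⦌ =>
          cutAt (toJoinSimplex z) (incL p q i)) hw).trans
          (cutAt_incL σ τ i)
      have h1 : ∀ i, cutAt (toJoinSimplex w) (incR p q i) = 1 := fun i =>
        (congrArg (fun z : (join K L) _⦋p + 1 + q⦌ =>
          cutAt (toJoinSimplex z) (incR p q i)) hw).trans
          (cutAt_incR σ τ i)
      obtain ⟨σ', θ, rfl⟩ : ∃ σ' θ, w = mk σ' θ := ⟨_, _, eq_mk w h0 h1⟩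
      obtain ⟨f, rfl⟩ := stdSimplex.objEquiv.symm.surjective θ
      obtain ⟨rfl, rfl⟩ : σ' = σ ∧ L.map f.op r = τ :=
        mk_injective ((joinMap_mk (𝟙 K) (yonedaEquiv.symm r) σ' _).symm.trans hw)
      rw [hom_app_map]
      refine congrArg ((hom (φ.app (op ⦋m⦌) r)).app _) ?_
      refine (joinMap_mk (𝟙 K) (SSet.stdSimplex.map f) σ' _).trans ?_
      exact congrArg (mk σ') (yonedaEquiv_map f)

end join

/-- With `toSlice_injective` this gives the bijection between maps L ⟶ slice X and maps K ⋆ L ⟶ C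
that restrict to X. Lifting problems are transposed along it. -/
lemma exists_eq_toSlice (φ : L ⟶ slice X) :
    ∃ (U : join K L ⟶ C) (hU : joinInl K L ≫ U = X), toSlice U hU = φ := by
  choose! u hu₁ hu₂ using fun (n : SimplexCategoryᵒᵖ) (z : (join K L).obj n) =>
    join.exists_value φ (n := n.unop.len) z
  let U : join K L ⟶ C :=
    { app n := ↾(u n)
      naturality n m f := by
        ext z
        rcases join.eq_joinInl_or_eq_joinMap (n := n.unop.len) z with ⟨σ, hσ⟩ | ⟨d, r, w, hw⟩
        · refine (hu₁ m _ (K.map f σ) ?_).trans ?_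
          · rw [hσ]
            exact NatTrans.naturality_apply (joinInl K L) f σ
          · refine (NatTrans.naturality_apply X f σ).trans ?_
            exact congrArg (C.map f) (hu₁ n z σ hσ.symm).symm
        · refine (hu₂ m _ d r ((join K Δ[d]).map f w) ?_).trans ?_
          · rw [hw]
            exact NatTrans.naturality_apply (joinMap (𝟙 K) (yonedaEquiv.symm r)) f w
          · refine (NatTrans.naturality_apply (hom (φ.app (op ⦋d⦌) r)) f w).trans ?_
            exact congrArg (C.map f) (hu₂ n z d r w hw.symm).symm }
  refine ⟨U, ?_, ?_⟩
  · ext n σ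
    exact hu₁ n _ σ rfl
  · refine map_ext fun m r => ?_
    ext n w
    exact hu₂ n _ m r w rfl

lemma toSlice_injective {U V : join K L ⟶ C} {hU : joinInl K L ≫ U = X} {hV : joinInl K L ≫ V = X}
    (h : toSlice U hU = toSlice V hV) : U = V := by
  ext ⟨⟨n⟩⟩ z
  rcases join.eq_joinInl_or_eq_joinMap z with ⟨σ, rfl⟩ | ⟨d, r, w, rfl⟩
  · exact congrArg (fun f : K ⟶ C => f.app _ σ) (hU.trans hV.symm)
  · exact congrArg (fun f : L ⟶ slice X => (hom (f.app (op ⦋d⦌) r)).app (op ⦋n⦌) w) h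

lemma hasLiftingProperty_sliceMap {A B : SSet.{u}} (i : A ⟶ B) (P : C ⟶ D)
    [HasLiftingProperty (joinMap (𝟙 K) i) P] {X : K ⟶ C} {Y : K ⟶ D} (h : X ≫ P = Y) :
    HasLiftingProperty i (sliceMap P h) where
  sq_hasLift {a b} sq := by
    obtain ⟨U, hU, rfl⟩ := exists_eq_toSlice a
    obtain ⟨V, hV, rfl⟩ := exists_eq_toSlice b
    have w := sq.w
    rw [toSlice_sliceMap, comp_toSlice] at w
    have sq' : CommSq U (joinMap (𝟙 K) i) P V := ⟨toSlice_injective w⟩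
    have hW : joinInl K B ≫ sq'.lift = X :=
      (joinInl_joinMap_id i _).symm.trans ((congrArg (joinInl K A ≫ ·) sq'.fac_left).trans hU)
    refine ⟨⟨⟨toSlice sq'.lift hW, ?_, ?_⟩⟩⟩
    · rw [comp_toSlice]
      congr 1
      exact sq'.fac_left
    · rw [toSlice_sliceMap]
      congr 1
      exact sq'.fac_right

lemma innerFibrations_sliceMap {P : C ⟶ D} (hP : innerFibrations P) {X : K ⟶ C} {Y : K ⟶ D}
    (h : X ≫ P = Y) : innerFibrations (sliceMap P h) := by
  rintro _ _ _ ⟨i, h0, hn⟩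
  have := join.hasLiftingProperty_joinMap_horn (K := K) hP h0 hn
  exact hasLiftingProperty_sliceMap _ P h

lemma IsInnerIsofibration.sliceMap {P : C ⟶ D} (hP : IsInnerIsofibration P) {X : K ⟶ C} {Y : K ⟶ D}
    (h : X ≫ P = Y) : IsInnerIsofibration (sliceMap P h) where
  left := innerFibrations_sliceMap hP.1 h
  right := by
    rw [hasLiftingProperty_zero_iff]
    have := join.hasLiftingProperty_joinMap_zero (K := K) hP
    exact hasLiftingProperty_sliceMap _ P h

instance quasicategory_slice [Quasicategory C] (X : K ⟶ C) : Quasicategory (slice X) where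
  hornFilling' n i σ₀ h0 hn := by
    obtain ⟨U, hU, rfl⟩ := exists_eq_toSlice σ₀
    have := join.hasLiftingProperty_joinMap_horn (K := K) (mem_innerFibrations (terminal.from C))
      h0 hn
    have sq : CommSq U (joinMap (𝟙 K) (horn.{u} (n + 2) i).ι) (terminal.from C)
      (terminal.from _) := ⟨Subsingleton.elim _ _⟩
    have hW : joinInl K _ ≫ sq.lift = X :=
      (joinInl_joinMap_id _ _).symm.trans ((congrArg (joinInl K _ ≫ ·) sq.fac_left).trans hU)
    refine ⟨toSlice sq.lift hW, ?_⟩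
    rw [comp_toSlice]
    congr 1
    exact sq.fac_left.symm

end SSet

/-! ### Lifting of homotopies along inner isofibrations -/

namespace SSet

variable {A B X Y : SSet.{u}} {p : X ⟶ Y}

/-- The inclusion of `B × {0}` in `B × E[1]`. -/
abbrev cylZero (B : SSet.{u}) : B ⟶ B ⊗ coherentIso.{u} := lift (𝟙 B) (const coherentIso.x₀)

/-- The inclusion of `B × {1}` in `B × E[1]`. -/
abbrev cylOne (B : SSet.{u}) : B ⟶ B ⊗ coherentIso.{u} := lift (𝟙 B) (const coherentIso.x₁)

lemma IsInnerIsofibration.hasLiftingProperty_union (hp : IsInnerIsofibration p) (n : ℕ) :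
    HasLiftingProperty (Subcomplex.unionProd.{u} ∂Δ[n] coherentIso.zero.{u}).ι p := by
  obtain _ | n := n
  · have := (hasLiftingProperty_zero_iff p).1 hp.2
    let s : Δ[0] _⦋0⦌ := yonedaEquiv (𝟙 _)
    -- As ∂Δ[0] is empty, the case n = 0 is {0} ⊂ E[1] with a spurious factor Δ[0], which j inserts
    -- and the second projection removes.
    let j : coherentIso.{u} ⟶ Δ[0] ⊗ coherentIso.{u} := lift (const s) (𝟙 _)
    have hj : snd _ _ ≫ j = 𝟙 _ := by
      refine CartesianMonoidalCategory.hom_ext _ _ ?_ ?_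
      · exact stdSimplex.isTerminalObj₀.hom_ext _ _
      · simp [j]
    refine ⟨fun {a b} sq => ?_⟩
    let k : (coherentIso.zero.{u} : SSet.{u}) ⟶
        (Subcomplex.unionProd.{u} ∂Δ[0] coherentIso.zero.{u} : SSet.{u}) :=
      Subcomplex.lift (coherentIso.zero.ι ≫ j) (by
        rintro n _ ⟨x, rfl⟩
        exact Or.inl ⟨trivial, x.2⟩)
    have sq' : CommSq (k ≫ a) coherentIso.zero.{u}.ι p (j ≫ b) := ⟨by
      rw [Category.assoc, sq.w]
      rfl⟩
    refine ⟨⟨⟨snd _ _ ≫ sq'.lift, ?_, ?_⟩⟩⟩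
    · ext ⟨⟨n⟩⟩ ⟨⟨s, e⟩, h⟩
      have he : e ∈ coherentIso.zero.{u}.obj _ := by
        rcases (Subcomplex.mem_unionProd_iff _ _ _).1 h with h | h
        · exact h
        · have : (∂Δ[0] : (Δ[0] : SSet.{u}).Subcomplex) = ⊥ := boundary_zero
          rw [this] at h
          exact h.elim
      have hk : k.app (op ⦋n⦌) ⟨e, he⟩ = ⟨⟨s, e⟩, h⟩ := Subtype.ext (congrArg
        (fun g : Δ[0] ⊗ coherentIso.{u} ⟶ Δ[0] ⊗ coherentIso.{u} => g.app (op ⦋n⦌) ⟨s, e⟩) hj)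
      exact (congrArg (fun g : (coherentIso.zero.{u} : SSet.{u}) ⟶ X => g.app (op ⦋n⦌) ⟨e, he⟩)
        sq'.fac_left).trans (congrArg (a.app _) hk)
    · rw [Category.assoc, sq'.fac_right, ← Category.assoc, hj, Category.id_comp]
  · exact stdSimplexProdCoherentIso.innerAnodyneExtensions_union_ι (Nat.succ_pos n) p hp.1

/-- By adjunction the claim is that the pullback-hom of {0} ⊂ E[1] with p lifts against i. Lifting
against all monomorphisms is tested on boundary inclusions, and transposing back leads to
`hasLiftingProperty_union`. -/
lemma IsInnerIsofibration.hasLiftingProperty_pushoutObjObj (hp : IsInnerIsofibration p) {i : A ⟶ B}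
    [Mono i] (sq₁₂ : (curriedTensor SSet.{u}).PushoutObjObj i coherentIso.zero.{u}.ι) :
    HasLiftingProperty sq₁₂.ι p := by
  rw [HasLiftingProperty.iff_of_arrow_iso_left
    (show Arrow.mk sq₁₂.ι ≅ Arrow.mk sq₁₂.flipTensor.ι from Arrow.isoMk (Iso.refl _) (β_ _ _))]
  let sq₁₃ := Functor.PullbackObjObj.ofHasPullback MonoidalClosed.internalHom
    coherentIso.zero.{u}.ι p
  rw [MonoidalClosed.internalHomAdjunction₂.hasLiftingProperty_iff _ sq₁₃]
  suffices (MorphismProperty.monomorphisms _).rlp sq₁₃.π from this _ inferInstance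
  rw [rlp_monomorphisms]
  rintro _ _ _ ⟨n⟩
  let sq := Subcomplex.unionProd.pushoutObjObj.{u} ∂Δ[n] coherentIso.zero.{u}
  rw [← MonoidalClosed.internalHomAdjunction₂.hasLiftingProperty_iff sq.flipTensor,
    ← HasLiftingProperty.iff_of_arrow_iso_left
      (show Arrow.mk sq.ι ≅ Arrow.mk sq.flipTensor.ι from Arrow.isoMk (Iso.refl _) (β_ _ _))]
  exact hp.hasLiftingProperty_union n

/-- The homotopy lifting extension property of inner isofibrations. -/
lemma IsInnerIsofibration.exists_lift (hp : IsInnerIsofibration p) (i : A ⟶ B) [Mono i]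
    (f : B ⟶ X) (h : A ⊗ coherentIso.{u} ⟶ X) (k : B ⊗ coherentIso.{u} ⟶ Y)
    (h₁ : cylZero A ≫ h = i ≫ f) (h₂ : i ▷ _ ≫ k = h ≫ p) (h₃ : cylZero B ≫ k = f ≫ p) :
    ∃ H : B ⊗ coherentIso.{u} ⟶ X, cylZero B ≫ H = f ∧ i ▷ _ ≫ H = h ∧ H ≫ p = k := by
  let sq₁₂ := Functor.PushoutObjObj.ofHasPushout (curriedTensor SSet.{u}) i coherentIso.zero.{u}.ι
  have := hp.hasLiftingProperty_pushoutObjObj sq₁₂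
  -- The complex `zero` is a point, so the inclusion of Z × {0} is a projection followed by `cylZero
  -- Z`. This translates the pushout-product into conditions on `cylZero`.
  have key : ∀ Z : SSet.{u}, Z ◁ coherentIso.zero.{u}.ι = fst _ _ ≫ cylZero Z := by
    intro Z
    refine CartesianMonoidalCategory.hom_ext _ _ (by simp) ?_
    refine NatTrans.ext (funext fun n => ConcreteCategory.hom_ext _ _ fun ⟨z, e, he⟩ => ?_)
    exact coherentIso.label_ext (m := n.unop.len) fun i =>
      (coherentIso.mem_zero_iff (m := n.unop.len) e).1 he i
  let a : sq₁₂.pt ⟶ X := sq₁₂.isPushout.desc (fst _ _ ≫ f) h (by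
    dsimp
    rw [key, Category.assoc, h₁, whiskerRight_fst_assoc])
  have sq : CommSq a sq₁₂.ι p k := ⟨by
    apply sq₁₂.hom_ext
    · rw [sq₁₂.inl_ι_assoc, sq₁₂.isPushout.inl_desc_assoc]
      dsimp
      rw [key]
      simp only [Category.assoc, h₃]
    · rw [sq₁₂.inr_ι_assoc, sq₁₂.isPushout.inr_desc_assoc]
      exact h₂.symm⟩
  refine ⟨sq.lift, ?_, ?_, sq.fac_right⟩
  · have h4 : B ◁ coherentIso.zero.ι ≫ sq.lift = fst _ _ ≫ f :=
      (sq₁₂.inl_ι_assoc sq.lift).symm.trans ((congrArg (sq₁₂.inl ≫ ·) sq.fac_left).trans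
        (sq₁₂.isPushout.inl_desc _ _ _))
    rw [key, Category.assoc] at h4
    let s : B ⟶ B ⊗ (coherentIso.zero.{u} : SSet.{u}) :=
      lift (𝟙 B) (const ⟨coherentIso.x₀, (coherentIso.mem_zero_iff _).2 fun _ => rfl⟩)
    have hs : s ≫ fst _ _ = 𝟙 _ := lift_fst _ _
    have h5 := congrArg (s ≫ ·) h4
    simpa only [← Category.assoc, hs, Category.id_comp] using h5
  · exact (sq₁₂.inr_ι_assoc sq.lift).symm.trans ((congrArg (sq₁₂.inr ≫ ·) sq.fac_left).trans
      (sq₁₂.isPushout.inr_desc _ _ _))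

end SSet

namespace SSet

variable {A B X Y : SSet.{u}} {p : X ⟶ Y}

/-- The involution of `E[1]` which exchanges the two vertices. -/
def coherentIso.swap : coherentIso.{u} ⟶ coherentIso.{u} where
  app n := ↾fun x => ofLabel (m := n.unop.len) fun i => !label (m := n.unop.len) x i
  naturality _ _ _ := rfl

lemma coherentIso.swap_swap : swap.{u} ≫ swap = 𝟙 _ := by
  refine NatTrans.ext (funext fun n => ConcreteCategory.hom_ext _ _ fun x => ?_)
  exact label_ext (m := n.unop.len) fun i => Bool.not_not _

lemma cylZero_swap (B : SSet.{u}) : cylZero B ≫ B ◁ coherentIso.swap = cylOne B := rfl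

lemma cylOne_swap (B : SSet.{u}) : cylOne B ≫ B ◁ coherentIso.swap = cylZero B := rfl

lemma cylZero_whiskerRight (i : A ⟶ B) : cylZero A ≫ i ▷ _ = i ≫ cylZero B := rfl

lemma cylOne_whiskerRight (i : A ⟶ B) : cylOne A ≫ i ▷ _ = i ≫ cylOne B := rfl

lemma cylZero_fst (B : SSet.{u}) : cylZero B ≫ fst _ _ = 𝟙 B := rfl

lemma cylOne_fst (B : SSet.{u}) : cylOne B ≫ fst _ _ = 𝟙 B := rfl

lemma whiskerLeft_swap_swap (B : SSet.{u}) :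
    B ◁ coherentIso.swap ≫ B ◁ coherentIso.swap = 𝟙 (B ⊗ coherentIso.{u}) := by
  rw [← MonoidalCategory.whiskerLeft_comp, coherentIso.swap_swap, MonoidalCategory.whiskerLeft_id]

/-- The homotopy lifting extension property of inner isofibrations, starting from `1`. -/
lemma IsInnerIsofibration.exists_lift_one (hp : IsInnerIsofibration p) (i : A ⟶ B) [Mono i]
    (f : B ⟶ X) (h : A ⊗ coherentIso.{u} ⟶ X) (k : B ⊗ coherentIso.{u} ⟶ Y)
    (h₁ : cylOne A ≫ h = i ≫ f) (h₂ : i ▷ _ ≫ k = h ≫ p) (h₃ : cylOne B ≫ k = f ≫ p) :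
    ∃ H : B ⊗ coherentIso.{u} ⟶ X, cylOne B ≫ H = f ∧ i ▷ _ ≫ H = h ∧ H ≫ p = k := by
  obtain ⟨H, h4, h5, h6⟩ := hp.exists_lift i f (A ◁ coherentIso.swap ≫ h)
    (B ◁ coherentIso.swap ≫ k)
    (by rw [← Category.assoc, cylZero_swap, h₁])
    (by rw [← whisker_exchange_assoc, h₂, Category.assoc])
    (by rw [← Category.assoc, cylZero_swap, h₃])
  refine ⟨B ◁ coherentIso.swap ≫ H, by rw [← Category.assoc, cylOne_swap, h4], ?_, ?_⟩
  · rw [← whisker_exchange_assoc, h5, ← Category.assoc, whiskerLeft_swap_swap, Category.id_comp]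
  · rw [Category.assoc, h6, ← Category.assoc, whiskerLeft_swap_swap, Category.id_comp]

lemma isInnerIsofibration_of_quasicategory [Quasicategory X] (p : X ⟶ Δ[0]) :
    IsInnerIsofibration p where
  left := (quasicategory_iff_of_isTerminal p stdSimplex.isTerminalObj₀).1 inferInstance |>.mem
  right := ⟨fun {a b} _ => ⟨⟨⟨stdSimplex.isTerminalObj₀.from _ ≫ a,
    by rw [← Category.assoc, stdSimplex.isTerminalObj₀.hom_ext (coherentIsoZero ≫ _) (𝟙 _),
      Category.id_comp],
    stdSimplex.isTerminalObj₀.hom_ext _ _⟩⟩⟩⟩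

/-- The homotopy extension property of quasicategories. -/
lemma Quasicategory.exists_extension [Quasicategory X] (i : A ⟶ B) [Mono i]
    (f : B ⟶ X) (h : A ⊗ coherentIso.{u} ⟶ X) (h₁ : cylZero A ≫ h = i ≫ f) :
    ∃ H : B ⊗ coherentIso.{u} ⟶ X, cylZero B ≫ H = f ∧ i ▷ _ ≫ H = h := by
  obtain ⟨H, h4, h5, -⟩ := (isInnerIsofibration_of_quasicategory
    (stdSimplex.isTerminalObj₀.from X)).exists_lift i f h (stdSimplex.isTerminalObj₀.from _) h₁
    (stdSimplex.isTerminalObj₀.hom_ext _ _) (stdSimplex.isTerminalObj₀.hom_ext _ _)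
  exact ⟨H, h4, h5⟩

lemma Quasicategory.exists_extension_one [Quasicategory X] (i : A ⟶ B) [Mono i]
    (f : B ⟶ X) (h : A ⊗ coherentIso.{u} ⟶ X) (h₁ : cylOne A ≫ h = i ≫ f) :
    ∃ H : B ⊗ coherentIso.{u} ⟶ X, cylOne B ≫ H = f ∧ i ▷ _ ≫ H = h := by
  obtain ⟨H, h4, h5, -⟩ := (isInnerIsofibration_of_quasicategory
    (stdSimplex.isTerminalObj₀.from X)).exists_lift_one i f h (stdSimplex.isTerminalObj₀.from _) h₁
    (stdSimplex.isTerminalObj₀.hom_ext _ _) (stdSimplex.isTerminalObj₀.hom_ext _ _)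
  exact ⟨H, h4, h5⟩

end SSet

/-! ### Initial vertices -/

namespace SSet

variable {Q R : SSet.{u}}

/-- A vertex `x` is initial if every map `∂Δ[m] ⟶ Q` for `m > 0` which sends `0` to `x` extends
to `Δ[m]`. -/
def IsInitialVertex (x : (Δ[0] : SSet.{u}) ⟶ Q) : Prop :=
  ∀ (m : ℕ) (u : (∂Δ[m + 1] : SSet.{u}) ⟶ Q), boundaryZero m ≫ u = x →
    ∃ v : Δ[m + 1] ⟶ Q, (∂Δ[m + 1]).ι ≫ v = u

lemma isUniversalCone_iff {K C : SSet.{u}} {X : K ⟶ C} (S : underCone K ⟶ C)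
    (hS : coneBase K ≫ S = X) : IsUniversalCone S ↔ IsInitialVertex (toSlice S hS) := by
  constructor
  · intro h m u hu
    obtain ⟨U, hU, rfl⟩ := exists_eq_toSlice u
    rw [comp_toSlice] at hu
    obtain ⟨V, hV⟩ := h m U (toSlice_injective hu)
    refine ⟨toSlice V (by rw [← hU, ← hV, joinInl_joinMap_id]), ?_⟩
    rw [comp_toSlice]
    congr 1
  · intro h m U hU
    have hU' : joinInl K _ ≫ U = X := by rw [← hS, ← hU, joinInl_joinMap_id]
    obtain ⟨v, hv⟩ := h m (toSlice U hU') (by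
      rw [comp_toSlice]
      congr 1)
    obtain ⟨V, hV, rfl⟩ := exists_eq_toSlice v
    rw [comp_toSlice] at hv
    exact ⟨V, toSlice_injective hv⟩

lemma mem_horn_iff_exists {n d : ℕ} (i : Fin (n + 1)) (z : Δ[n] _⦋d⦌) :
    z ∈ (horn.{u} n i).obj _ ↔ ∃ j, j ≠ i ∧ ∀ k, z k ≠ j := by
  rw [mem_horn_iff, ne_eq, Set.eq_univ_iff_forall]
  push Not
  refine exists_congr fun j => ?_
  simp only [Set.union_singleton, Set.mem_insert_iff, Set.mem_range, not_or, not_exists]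
  rfl

lemma mem_boundary_iff_exists {n d : ℕ} (z : Δ[n] _⦋d⦌) :
    z ∈ (boundary.{u} n).obj _ ↔ ∃ j, ∀ k, z k ≠ j := by
  rw [mem_boundary_iff_notMem_range]
  simp

lemma exists_δ_eq {n d : ℕ} (i : Fin (n + 2)) (z : (Δ[n + 1] : SSet.{u}) _⦋d⦌)
    (h : ∀ k, z k ≠ i) :
    ∃ y : Δ[n] _⦋d⦌, (stdSimplex.{u}.δ i).app _ y = z := by
  have : z ∈ (Subcomplex.range (stdSimplex.{u}.δ i)).obj _ := by
    rw [stdSimplex.range_δ]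
    exact (stdSimplex.mem_face_iff _ _).2 fun k => by simpa using h k
  exact this

/-- Replacing a face of a simplex by another one with the same boundary. -/
lemma exists_boundary_of_face {n : ℕ} (i : Fin (n + 2)) (T : Δ[n + 1] ⟶ R) (V : Δ[n] ⟶ R)
    (h : (∂Δ[n]).ι ≫ V = (∂Δ[n]).ι ≫ stdSimplex.δ i ≫ T) :
    ∃ t : (∂Δ[n + 1] : SSet.{u}) ⟶ R,
      (∀ (d : ℕ) (z : Δ[n + 1] _⦋d⦌) (_ : z ∈ (horn.{u} (n + 1) i).obj _) (hz'),
        t.app (op ⦋d⦌) ⟨z, hz'⟩ = T.app _ z) ∧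
      (∀ (d : ℕ) (y : Δ[n] _⦋d⦌) (hy), t.app (op ⦋d⦌) ⟨(stdSimplex.δ i).app _ y, hy⟩ =
        V.app _ y) := by
  obtain ⟨φ, h1, h2⟩ := Subcomplex.exists_desc_range_sup (horn.{u} (n + 1) i).ι
    (stdSimplex.{u}.δ i) ((horn.{u} (n + 1) i).ι ≫ T) V (by
      rintro ⟨⟨d⟩⟩ ⟨x, hx⟩ y hxy
      obtain rfl : x = _ := hxy
      obtain ⟨j, hj, hj'⟩ := (mem_horn_iff_exists _ _).1 hx
      obtain ⟨j, rfl⟩ := Fin.exists_succAbove_eq hj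
      have hy : y ∈ (boundary.{u} n).obj _ := (mem_boundary_iff_exists _).2
        ⟨j, fun k hk => hj' k (by rw [← hk]; rfl)⟩
      exact (congrArg (fun f : (∂Δ[n] : SSet.{u}) ⟶ R => f.app (op ⦋d⦌) ⟨y, hy⟩) h).symm)
  -- The boundary is the horn together with the face opposite i, so a map on it is obtained by
  -- gluing.
  have hle : ∂Δ[n + 1] ≤ Subcomplex.range (horn.{u} (n + 1) i).ι ⊔
      Subcomplex.range (stdSimplex.{u}.δ i) := by
    rintro ⟨⟨d⟩⟩ z hz
    by_cases hz' : ∀ k, z k ≠ i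
    · obtain ⟨y, rfl⟩ := exists_δ_eq i z hz'
      exact Or.inr ⟨y, rfl⟩
    · obtain ⟨j, hj⟩ := (mem_boundary_iff_exists _).1 hz
      push Not at hz'
      obtain ⟨k, hk⟩ := hz'
      exact Or.inl ⟨⟨z, (mem_horn_iff_exists _ _).2 ⟨j, fun hij => hj k (hk.trans hij.symm), hj⟩⟩,
        rfl⟩
  exact ⟨Subcomplex.homOfLE hle ≫ φ, fun d z hz _ => h1 _ ⟨z, hz⟩, fun d y _ => h2 _ y⟩

/-- For j ≠ 0 the degeneracy carries the face opposite j + 1 into the face opposite j. So `σ 0`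
sends the faces of Δ[m + 2] opposite 2, 3, … into the boundary of Δ[m + 1]. -/
lemma σ_zero_app_ne {n d : ℕ} {z : (Δ[n + 1] : SSet.{u}) _⦋d⦌} {j : Fin (n + 1)} (hj : j ≠ 0)
    {k : Fin (d + 1)} (h : z k ≠ j.succ) : ((stdSimplex.{u}.σ 0).app _ z) k ≠ j := by
  change (0 : Fin (n + 1)).predAbove (z k) ≠ j
  obtain h0 | ⟨a, ha⟩ := Fin.eq_zero_or_eq_succ (z k)
  · rw [h0]
    exact hj.symm
  · rw [ha, Fin.predAbove_zero_succ]
    rintro rfl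
    exact h ha

lemma map_vertex_ext {f g : (Δ[0] : SSet.{u}) ⟶ Q}
    (h : f.app (op ⦋0⦌) (yonedaEquiv (𝟙 _)) = g.app (op ⦋0⦌) (yonedaEquiv (𝟙 _))) : f = g :=
  yonedaEquiv.injective h

/-- Right lifting property of inner fibrations with respect to boundaries which start at a vertex
which is initial and whose image is initial. -/
lemma IsInitialVertex.exists_lift {p : Q ⟶ R} (hp : innerFibrations p) {x : Δ[0] ⟶ Q}
    (hx : IsInitialVertex x) (hpx : IsInitialVertex (x ≫ p)) {m : ℕ}
    (u : (∂Δ[m + 1] : SSet.{u}) ⟶ Q) (hu : boundaryZero m ≫ u = x) (w : Δ[m + 1] ⟶ R)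
    (hw : (∂Δ[m + 1]).ι ≫ w = u ≫ p) :
    ∃ v : Δ[m + 1] ⟶ Q, (∂Δ[m + 1]).ι ≫ v = u ∧ v ≫ p = w := by
  -- V fills u but need not lie over w. The difference between V ≫ p and w is corrected by a simplex
  -- of dimension one higher.
  obtain ⟨V, hV⟩ := hx m u hu
  have hσ₀ : stdSimplex.{u}.δ (0 : Fin (m + 3)) ≫ stdSimplex.σ 0 = 𝟙 Δ[m + 1] :=
    CosimplicialObject.δ_comp_σ_self stdSimplex (i := (0 : Fin (m + 2)))
  have hσ₁ : stdSimplex.{u}.δ (1 : Fin (m + 3)) ≫ stdSimplex.σ 0 = 𝟙 Δ[m + 1] :=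
    CosimplicialObject.δ_comp_σ_succ stdSimplex (i := (0 : Fin (m + 2)))
  -- The boundary of the degenerate simplex `σ 0 ≫ w`, with its 0-th face w replaced by V ≫ p, which
  -- has the same boundary. It still starts at the initial vertex x ≫ p, hence has a filling τ.
  obtain ⟨t, ht₁, ht₂⟩ := exists_boundary_of_face (0 : Fin (m + 3)) (stdSimplex.σ 0 ≫ w) (V ≫ p)
    (by rw [← Category.assoc, hV, reassoc_of% hσ₀, hw])
  obtain ⟨τ, hτ⟩ := hpx (m + 1) t (map_vertex_ext (by
    have h01 : ∀ k : Fin 1, (stdSimplex.obj₀Equiv.symm 0 : (Δ[m + 2] : SSet.{u}) _⦋0⦌) k ≠ 1 :=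
      fun k => by
        change (0 : Fin (m + 3)) ≠ 1
        simp
    refine (ht₁ 0 (stdSimplex.obj₀Equiv.symm 0)
      ((mem_horn_iff_exists _ _).2 ⟨1, by simp, h01⟩)
      ((mem_boundary_iff_exists _).2 ⟨1, h01⟩)).trans ?_
    rw [← hu, Category.assoc, ← hw]
    rfl))
  replace ht₁ : ∀ (d : ℕ) (z : Δ[m + 2] _⦋d⦌) (_ : z ∈ (horn.{u} (m + 2) 0).obj _),
      τ.app _ z = (stdSimplex.σ 0 ≫ w).app _ z := fun d z hz => by
    have hz' : z ∈ (boundary.{u} (m + 2)).obj _ := by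
      obtain ⟨j, -, hj⟩ := (mem_horn_iff_exists _ _).1 hz
      exact (mem_boundary_iff_exists _).2 ⟨j, hj⟩
    rw [← ht₁ d z hz hz', ← hτ]
    rfl
  replace ht₂ : stdSimplex.{u}.δ (0 : Fin (m + 3)) ≫ τ = V ≫ p := by
    ext ⟨⟨d⟩⟩ y
    refine Eq.trans ?_ (ht₂ d y ((mem_boundary_iff_exists _).2 ⟨0, fun k => ?_⟩))
    · rw [← hτ]
      rfl
    · exact Fin.succAbove_ne (0 : Fin (m + 3)) (y k)
  -- On the inner horn at 1, τ lifts to `σ 0 ≫ V`. The 0-th face is V over V ≫ p, and the faces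
  -- opposite j ≥ 2 are sent by `σ 0` into the boundary, where V ≫ p and w agree.
  have sq : CommSq ((horn.{u} (m + 2) 1).ι ≫ stdSimplex.σ 0 ≫ V) (horn.{u} (m + 2) 1).ι p τ := ⟨by
    ext ⟨⟨d⟩⟩ ⟨z, hz⟩
    by_cases hz' : ∀ k, z k ≠ 0
    · obtain ⟨y, rfl⟩ := exists_δ_eq 0 z hz'
      have h1 := congrArg (fun f : Δ[m + 1] ⟶ Δ[m + 1] => p.app _ (V.app _ (f.app _ y))) hσ₀
      exact h1.trans (congrArg (fun f : Δ[m + 1] ⟶ R => f.app _ y) ht₂).symm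
    · push Not at hz'
      obtain ⟨k₀, hk₀⟩ := hz'
      obtain ⟨j, hj, hj'⟩ := (mem_horn_iff_exists _ _).1 hz
      have hj₀ : j ≠ 0 := fun h => hj' k₀ (hk₀.trans h.symm)
      refine Eq.trans ?_ (ht₁ d z ((mem_horn_iff_exists _ _).2 ⟨j, hj₀, hj'⟩)).symm
      obtain ⟨j, rfl⟩ := Fin.exists_succ_eq.2 hj₀
      have hy : (stdSimplex.{u}.σ 0).app _ z ∈ (boundary.{u} (m + 1)).obj _ :=
        (mem_boundary_iff_exists _).2 ⟨j, fun k => σ_zero_app_ne (by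
          rintro rfl
          exact hj rfl) (hj' k)⟩
      have h1 : (∂Δ[m + 1]).ι ≫ V ≫ p = (∂Δ[m + 1]).ι ≫ w := by rw [← Category.assoc, hV, hw]
      exact congrArg (fun f : (∂Δ[m + 1] : SSet.{u}) ⟶ R => f.app (op ⦋d⦌) ⟨_, hy⟩) h1⟩
  have := hp _ (horn_ι_mem_innerHornInclusions (n := m + 2) (i := 1) (by simp) (by
    simp [Fin.lt_def]))
  -- The missing face lies over `δ 1 ≫ σ 0 ≫ w`, which is w, and its boundary is that of `δ 1 ≫ σ 0
  -- ≫ V`, which is u.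
  refine ⟨stdSimplex.δ 1 ≫ sq.lift, ?_, ?_⟩
  · ext ⟨⟨d⟩⟩ ⟨z, hz⟩
    obtain ⟨j, hj⟩ := (mem_boundary_iff_exists _).1 hz
    have hz' : (stdSimplex.{u}.δ 1).app _ z ∈ (horn.{u} (m + 2) 1).obj _ :=
      (mem_horn_iff_exists _ _).2 ⟨(1 : Fin (m + 3)).succAbove j, Fin.succAbove_ne _ _, fun k hk =>
        hj k (Fin.succAbove_right_injective hk)⟩
    refine (congrArg (fun f : (horn.{u} (m + 2) 1 : SSet.{u}) ⟶ Q => f.app (op ⦋d⦌) ⟨_, hz'⟩)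
      sq.fac_left).trans ?_
    rw [← hV]
    exact congrArg (fun f : Δ[m + 1] ⟶ Δ[m + 1] => V.app _ (f.app _ z)) hσ₁
  · rw [Category.assoc, sq.fac_right]
    ext ⟨⟨d⟩⟩ y
    refine (ht₁ d _ ((mem_horn_iff_exists _ _).2 ⟨1, by simp, fun k =>
      Fin.succAbove_ne (1 : Fin (m + 3)) (y k)⟩)).trans ?_
    exact congrArg (fun f : Δ[m + 1] ⟶ Δ[m + 1] => w.app _ (f.app _ y)) hσ₁

end SSet

namespace SSet

variable {Q R : SSet.{u}}

/-- The vertex inclusion `Δ[0] ⟶ E[1]` at `1`. -/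
def coherentIsoOne : (Δ[0] : SSet.{u}) ⟶ coherentIso.{u} := const coherentIso.x₁

instance mono_of_stdSimplex_zero (f : (Δ[0] : SSet.{u}) ⟶ Q) : Mono f :=
  stdSimplex.isTerminalObj₀.mono_from f

/-- Initial vertices are invariant under isomorphisms. -/
lemma IsInitialVertex.of_coherentIso [Quasicategory Q] {e : coherentIso.{u} ⟶ Q}
    (h : IsInitialVertex (coherentIsoZero ≫ e)) : IsInitialVertex (coherentIsoOne ≫ e) := by
  intro m u hu
  -- The boundary u is dragged backwards along e, so that it starts at the vertex known to be
  -- initial. It is filled there, and the filling is dragged forwards to the end 1.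
  obtain ⟨H, h1, h2⟩ := Quasicategory.exists_extension_one (boundaryZero m) u (snd _ _ ≫ e)
    (by rw [hu]; rfl)
  obtain ⟨v, hv⟩ := h m (cylZero _ ≫ H) (by
    rw [← Category.assoc, ← cylZero_whiskerRight, Category.assoc, h2]
    rfl)
  obtain ⟨H', h3, h4⟩ := Quasicategory.exists_extension (∂Δ[m + 1]).ι v H hv.symm
  refine ⟨cylOne _ ≫ H', ?_⟩
  rw [← Category.assoc, ← cylOne_whiskerRight, Category.assoc, h4, h1]

variable (Q) in
/-- The full subcomplex spanned by the initial vertices. -/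
def initialVertices : Q.Subcomplex where
  obj n := {z | ∀ i, IsInitialVertex (yonedaEquiv.symm (vertex (m := n.unop.len) z i))}
  map {n m} f := by
    intro z hz i
    have := hz (f.unop i)
    rw [← vertex_map f.unop] at this
    exact this

lemma mem_initialVertices_iff {n : ℕ} (z : Q _⦋n⦌) : z ∈ (initialVertices Q).obj _ ↔
    ∀ i, IsInitialVertex (yonedaEquiv.symm (vertex z i)) := Iff.rfl

lemma boundary_zero_hom_ext (f g : (∂Δ[0] : SSet.{u}) ⟶ Q) : f = g := by
  refine NatTrans.ext (funext fun n => ConcreteCategory.hom_ext _ _ fun ⟨z, hz⟩ => ?_)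
  rw [boundary_zero] at hz
  exact hz.elim

lemma vertex_zero (x : Q _⦋0⦌) (i : Fin 1) : vertex x i = x := by
  rw [vertex, show SimplexCategory.const ⦋0⦌ ⦋0⦌ i = 𝟙 _ by
    ext j : 3
    exact Subsingleton.elim (α := Fin 1) _ _]
  simp

lemma mem_initialVertices_zero_iff (z : Q _⦋0⦌) :
    z ∈ (initialVertices Q).obj _ ↔ IsInitialVertex (yonedaEquiv.symm z) := by
  rw [mem_initialVertices_iff]
  exact ⟨fun h => vertex_zero z 0 ▸ h 0, fun h i => (vertex_zero z i).symm ▸ h⟩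

/-- Every boundary of positive dimension in this subcomplex starts at an initial vertex, hence can
be filled; x itself serves in dimension 0. -/
lemma rlp_initialVertices {x : Δ[0] ⟶ Q} (hx : IsInitialVertex x) :
    (MorphismProperty.monomorphisms SSet.{u}).rlp
      (stdSimplex.isTerminalObj₀.from (initialVertices Q : SSet.{u})) := by
  rw [rlp_monomorphisms]
  rintro _ _ _ ⟨n⟩
  refine ⟨fun {a b} _ => ?_⟩
  suffices h : ∃ c : Δ[n] ⟶ (initialVertices Q : SSet.{u}), (∂Δ[n]).ι ≫ c = a by
    obtain ⟨c, hc⟩ := h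
    exact ⟨⟨⟨c, hc, stdSimplex.isTerminalObj₀.hom_ext _ _⟩⟩⟩
  obtain _ | m := n
  · refine ⟨yonedaEquiv.symm ⟨yonedaEquiv x, (mem_initialVertices_zero_iff _).2 ?_⟩, ?_⟩
    · rwa [Equiv.symm_apply_apply]
    · exact boundary_zero_hom_ext _ _
  -- The vertices of Δ[m + 1] all lie on its boundary, so a filling in Q has only initial vertices
  -- and stays in the full subcomplex.
  · have hv : ∀ (z : Δ[m + 1] _⦋0⦌), z ∈ (∂Δ[m + 1]).obj _ := by
      rw [boundary_obj_eq_univ 0 (m + 1)]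
      exact fun _ => trivial
    have h0 : IsInitialVertex (boundaryZero m ≫ a ≫ (initialVertices Q).ι) := by
      have := (mem_initialVertices_zero_iff _).1
        (a.app (op ⦋0⦌) ((boundaryZero m).app _ (yonedaEquiv (𝟙 _)))).2
      exact yonedaEquiv.symm_apply_apply (boundaryZero m ≫ a ≫ (initialVertices Q).ι) ▸ this
    obtain ⟨v, hv'⟩ := h0 m (a ≫ (initialVertices Q).ι) rfl
    refine ⟨Subcomplex.lift v ?_, ?_⟩
    · rintro ⟨⟨d⟩⟩ _ ⟨z, rfl⟩ i
      have h1 : v.app _ (vertex z i) = (a.app (op ⦋0⦌) ⟨vertex z i, hv _⟩).1 :=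
        congrArg (fun f : (∂Δ[m + 1] : SSet.{u}) ⟶ Q => f.app (op ⦋0⦌) ⟨vertex z i, hv _⟩) hv'
      have h2 := (mem_initialVertices_zero_iff _).1 (a.app (op ⦋0⦌) ⟨vertex z i, hv _⟩).2
      rw [← h1] at h2
      change IsInitialVertex (yonedaEquiv.symm (vertex (v.app (op ⦋d⦌) z) i))
      rwa [vertex_app]
    · rw [← cancel_mono (initialVertices Q).ι]
      exact hv'

/-- Two initial vertices are isomorphic. -/
lemma IsInitialVertex.exists_coherentIso {x y : Δ[0] ⟶ Q} (hx : IsInitialVertex x)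
    (hy : IsInitialVertex y) :
    ∃ e : coherentIso.{u} ⟶ Q, coherentIsoZero ≫ e = x ∧ coherentIsoOne ≫ e = y := by
  have hmem : ∀ z : Δ[0] ⟶ Q, IsInitialVertex z → ∃ z' : Δ[0] ⟶ (initialVertices Q : SSet.{u}),
      z' ≫ (initialVertices Q).ι = z := fun z hz =>
    ⟨yonedaEquiv.symm ⟨yonedaEquiv z, (mem_initialVertices_zero_iff _).2
      (by rwa [Equiv.symm_apply_apply])⟩, yonedaEquiv.injective (by
        rw [yonedaEquiv_comp]
        exact congrArg ((initialVertices Q).ι.app _) (Equiv.apply_symm_apply yonedaEquiv _))⟩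
  obtain ⟨x', rfl⟩ := hmem x hx
  obtain ⟨y', rfl⟩ := hmem y hy
  -- The two vertices of E[1] are disjoint, so x' and y' define a map on {0, 1}. It extends to E[1]
  -- by contractibility.
  obtain ⟨φ, h1, h2⟩ := Subcomplex.exists_desc_range_sup coherentIsoZero.{u} coherentIsoOne.{u}
    x' y' (fun n z w h => by
      have := congrArg (fun t => coherentIso.label (m := n.unop.len) t 0) h
      exact absurd (show false = true from this) (by simp))
  have := rlp_initialVertices hx
    (Subcomplex.range coherentIsoZero.{u} ⊔ Subcomplex.range coherentIsoOne.{u}).ι inferInstance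
  have sq : CommSq φ (Subcomplex.range coherentIsoZero.{u} ⊔ Subcomplex.range coherentIsoOne.{u}).ι
    (stdSimplex.isTerminalObj₀.from (initialVertices Q : SSet.{u}))
      (stdSimplex.isTerminalObj₀.from _) := ⟨stdSimplex.isTerminalObj₀.hom_ext _ _⟩
  refine ⟨sq.lift ≫ (initialVertices Q).ι, ?_, ?_⟩
  · rw [← Category.assoc]
    congr 1
    refine NatTrans.ext (funext fun n => ConcreteCategory.hom_ext _ _ fun z => ?_)
    exact (congrArg (fun f : ((Subcomplex.range coherentIsoZero.{u} ⊔
      Subcomplex.range coherentIsoOne.{u} : coherentIso.Subcomplex) : SSet.{u}) ⟶ _ =>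
        f.app n ⟨coherentIsoZero.app n z, Or.inl ⟨z, rfl⟩⟩) sq.fac_left).trans (h1 n z)
  · rw [← Category.assoc]
    congr 1
    refine NatTrans.ext (funext fun n => ConcreteCategory.hom_ext _ _ fun z => ?_)
    exact (congrArg (fun f : ((Subcomplex.range coherentIsoZero.{u} ⊔
      Subcomplex.range coherentIsoOne.{u} : coherentIso.Subcomplex) : SSet.{u}) ⟶ _ =>
        f.app n ⟨coherentIsoOne.app n z, Or.inr ⟨z, rfl⟩⟩) sq.fac_left).trans (h2 n z)

end SSet

/-! ### Universal cones: lifting, comparison and pullbacks -/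

namespace SSet

section

variable {K C D : SSet.{u}} {X : K ⟶ C}

lemma IsUniversalCone.exists_lift {P : C ⟶ D} (hP : innerFibrations P) {S : underCone K ⟶ C}
    (hS : IsUniversalCone S) (hSP : IsUniversalCone (S ≫ P)) {m : ℕ}
    (U : join K (∂Δ[m + 1] : SSet.{u}) ⟶ C) (hU : joinMap (𝟙 K) (boundaryZero m) ≫ U = S)
    (W : join K Δ[m + 1] ⟶ D) (hW : joinMap (𝟙 K) (∂Δ[m + 1]).ι ≫ W = U ≫ P) :
    ∃ V : join K Δ[m + 1] ⟶ C, joinMap (𝟙 K) (∂Δ[m + 1]).ι ≫ V = U ∧ V ≫ P = W := by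
  have hU' : joinInl K _ ≫ U = coneBase K ≫ S := by rw [← hU, joinInl_joinMap_id]
  have hW' : joinInl K _ ≫ W = (coneBase K ≫ S) ≫ P := by
    rw [← hU', Category.assoc, ← hW, joinInl_joinMap_id]
  obtain ⟨v, hv₁, hv₂⟩ := ((isUniversalCone_iff S rfl).1 hS).exists_lift
    (innerFibrations_sliceMap hP (rfl : (coneBase K ≫ S) ≫ P = _))
    (by
      rw [toSlice_sliceMap]
      exact (isUniversalCone_iff _ _).1 hSP) (toSlice U hU')
    (by
      rw [comp_toSlice]
      congr 1)
    (toSlice W hW')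
    (by
      rw [comp_toSlice, toSlice_sliceMap]
      congr 1)
  obtain ⟨V, hV, rfl⟩ := exists_eq_toSlice v
  rw [comp_toSlice] at hv₁
  rw [toSlice_sliceMap] at hv₂
  exact ⟨V, toSlice_injective hv₁, toSlice_injective hv₂⟩

/-- A functor which preserves one colimit of a diagram preserves all of them. -/
lemma IsUniversalCone.comp_of_comp [Quasicategory D] {S S' : underCone K ⟶ C}
    (h : coneBase K ≫ S = coneBase K ≫ S') (hS : IsUniversalCone S) (hS' : IsUniversalCone S')
    (F : C ⟶ D) (hF : IsUniversalCone (S ≫ F)) : IsUniversalCone (S' ≫ F) := by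
  obtain ⟨e, h₁, h₂⟩ := ((isUniversalCone_iff S h).1 hS).exists_coherentIso
    ((isUniversalCone_iff S' rfl).1 hS')
  have h₃ : (coneBase K ≫ S') ≫ F = coneBase K ≫ S' ≫ F := Category.assoc _ _ _
  -- The map e joins the two cones in the slice of C; initiality is transported along its image in
  -- the slice of D.
  have h₄ : IsInitialVertex (coherentIsoZero ≫ e ≫ sliceMap F h₃) := by
    have h₆ := (Category.assoc _ _ _).symm.trans
      ((congrArg (· ≫ sliceMap F h₃) h₁).trans (toSlice_sliceMap ..))
    rw [h₆]
    exact (isUniversalCone_iff _ _).1 hF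
  have h₅ := h₄.of_coherentIso
  have h₆ := (Category.assoc _ _ _).symm.trans
    ((congrArg (· ≫ sliceMap F h₃) h₂).trans (toSlice_sliceMap ..))
  rw [h₆] at h₅
  exact (isUniversalCone_iff _ _).2 h₅

/-- Lifting of colimits along inner isofibrations. -/
lemma exists_isUniversalCone_lift [Quasicategory C] {P : C ⟶ D}
    (hP : IsInnerIsofibration P) (T : underCone K ⟶ D) (hT : coneBase K ≫ T = X ≫ P)
    (hT' : IsUniversalCone T) (S' : underCone K ⟶ C) (hS' : coneBase K ≫ S' = X)
    (hS'u : IsUniversalCone S') (hS'P : IsUniversalCone (S' ≫ P)) :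
    ∃ S : underCone K ⟶ C, coneBase K ≫ S = X ∧ IsUniversalCone S ∧ S ≫ P = T := by
  have h₀ : coneBase K ≫ S' ≫ P = X ≫ P := by rw [← Category.assoc, hS']
  -- Both S' ≫ P and T are initial in the slice of D, so some e from E[1] joins them. Its lift
  -- starting at S' ends at a cone over T, which is again initial.
  obtain ⟨e, h₁, h₂⟩ := ((isUniversalCone_iff (S' ≫ P) h₀).1 hS'P).exists_coherentIso
    ((isUniversalCone_iff T hT).1 hT')
  have := (hP.sliceMap (rfl : X ≫ P = _)).2
  have sq : CommSq (toSlice S' hS') coherentIsoZero (sliceMap P (rfl : X ≫ P = _)) e :=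
    ⟨by rw [h₁, toSlice_sliceMap]⟩
  obtain ⟨S, hS, h₃⟩ := exists_eq_toSlice (coherentIsoOne ≫ sq.lift)
  refine ⟨S, hS, ?_, ?_⟩
  · rw [isUniversalCone_iff S hS, h₃]
    refine IsInitialVertex.of_coherentIso ?_
    rw [sq.fac_left]
    exact (isUniversalCone_iff S' hS').1 hS'u
  · have h₄ := congrArg (· ≫ sliceMap P (rfl : X ≫ P = _)) h₃
    rw [Category.assoc, sq.fac_right, h₂, toSlice_sliceMap] at h₄
    exact toSlice_injective h₄

end

section

variable {C D E : FCQCat.{u}} (F : C ⟶ D) (P : E ⟶ D) (hP : FCQCat.fibrations P)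
  {R : SSet.{u}} {Q : R ⟶ C.toSSet} {G : R ⟶ E.toSSet}
  (sq : IsPullback Q G (FCQCat.mapOf F) (FCQCat.mapOf P))

include hP sq

lemma quasicategory_of_isPullback : Quasicategory R := by
  have := C.quasicategory
  have : InnerFibration Q := ⟨innerFibrations.of_isPullback sq.flip hP.1⟩
  exact quasicategory_of_innerFibration Q

variable {K : SSet.{u}}

/-- A filling is chosen in C and pushed to D, and a filling in E over it is found by
`IsUniversalCone.exists_lift`. That applies because F is exact, so the common image of the cone in D
is universal. -/
lemma isUniversalCone_of_isPullback (hK : K.Finite) (S : underCone K ⟶ R)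
    (hQ : IsUniversalCone (S ≫ Q)) (hG : IsUniversalCone (S ≫ G)) : IsUniversalCone S := by
  intro m U hU
  obtain ⟨V, hV⟩ := hQ m (U ≫ Q) (by rw [← Category.assoc, hU])
  obtain ⟨W, hW₁, hW₂⟩ := IsUniversalCone.exists_lift hP.1 hG (by
    rw [Category.assoc, ← sq.w, ← Category.assoc]
    exact F.exact K hK _ hQ) (U ≫ G) (by rw [← Category.assoc, hU]) (V ≫ FCQCat.mapOf F) (by
      rw [← Category.assoc, hV, Category.assoc, Category.assoc, sq.w])
  refine ⟨sq.lift V W hW₂.symm, sq.hom_ext ?_ ?_⟩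
  · rw [Category.assoc, sq.lift_fst, hV]
  · rw [Category.assoc, sq.lift_snd, hW₁]

/-- Colimits S in C and T in E have images in D that need not coincide, but both are colimits of one
diagram. So T can be replaced by a colimit T' lying exactly over the image of S. -/
lemma exists_isUniversalCone_of_isPullback (hK : K.Finite) (X : K ⟶ R) :
    ∃ S : underCone K ⟶ R, coneBase K ≫ S = X ∧ IsUniversalCone S ∧ IsUniversalCone (S ≫ Q) ∧
      IsUniversalCone (S ≫ G) := by
  have := E.quasicategory
  obtain ⟨S, hS, hSu⟩ := C.finitelyCocomplete K hK (X ≫ Q)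
  obtain ⟨T, hT, hTu⟩ := E.finitelyCocomplete K hK (X ≫ G)
  obtain ⟨T', hT', hT'u, h⟩ := exists_isUniversalCone_lift hP (S ≫ FCQCat.mapOf F) (by
    rw [← Category.assoc, hS, Category.assoc, Category.assoc, sq.w]) (F.exact K hK _ hSu) T hT hTu
    (P.exact K hK _ hTu)
  have h₁ : sq.lift S T' h.symm ≫ Q = S := sq.lift_fst _ _ _
  have h₂ : sq.lift S T' h.symm ≫ G = T' := sq.lift_snd _ _ _
  refine ⟨sq.lift S T' h.symm, sq.hom_ext ?_ ?_,
    isUniversalCone_of_isPullback F P hP sq hK _ (h₁.symm ▸ hSu) (h₂.symm ▸ hT'u),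
    h₁.symm ▸ hSu, h₂.symm ▸ hT'u⟩
  · rw [Category.assoc, h₁, hS]
  · rw [Category.assoc, h₂, hT']

lemma isFinitelyCocomplete_of_isPullback : IsFinitelyCocomplete R := fun _ hK X => by
  obtain ⟨S, h₁, h₂, -⟩ := exists_isUniversalCone_of_isPullback F P hP sq hK X
  exact ⟨S, h₁, h₂⟩

/-- An arbitrary universal cone is compared with the componentwise universal cone on the same base,
which Q preserves by construction. -/
lemma isExact_fst_of_isPullback : IsExact Q := fun K hK S hS => by
  have := C.quasicategory
  obtain ⟨S', h₁, h₂, h₃, -⟩ := exists_isUniversalCone_of_isPullback F P hP sq hK (coneBase K ≫ S)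
  exact h₂.comp_of_comp h₁ hS Q h₃

lemma isExact_snd_of_isPullback : IsExact G := fun K hK S hS => by
  have := E.quasicategory
  obtain ⟨S', h₁, h₂, -, h₃⟩ := exists_isUniversalCone_of_isPullback F P hP sq hK (coneBase K ≫ S)
  exact h₂.comp_of_comp h₁ hS G h₃

lemma _root_.FCQCat.isPullback (hR : Quasicategory R) (hc : IsFinitelyCocomplete R) (hQ : IsExact Q)
    (hG : IsExact G) :
    IsPullback (FCQCat.ofMap Q hQ : FCQCat.mk R hR hc ⟶ C)
      (FCQCat.ofMap G hG : FCQCat.mk R hR hc ⟶ E) F P := by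
  have w : (FCQCat.ofMap Q hQ : FCQCat.mk R hR hc ⟶ C) ≫ F = FCQCat.ofMap G hG ≫ P :=
    FCQCat.Hom.ext sq.w
  have hs (s : PullbackCone F P) : FCQCat.mapOf s.fst ≫ FCQCat.mapOf F =
      FCQCat.mapOf s.snd ≫ FCQCat.mapOf P := congrArg FCQCat.mapOf s.condition
  refine ⟨⟨w⟩, ⟨PullbackCone.IsLimit.mk w (fun s => FCQCat.ofMap
    (sq.lift (FCQCat.mapOf s.fst) (FCQCat.mapOf s.snd) (hs s)) ?_)
    (fun s => FCQCat.Hom.ext (sq.lift_fst _ _ _)) (fun s => FCQCat.Hom.ext (sq.lift_snd _ _ _))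
    (fun s m h₁ h₂ => FCQCat.Hom.ext (sq.hom_ext ?_ ?_))⟩⟩
  · intro K hK S hS
    refine isUniversalCone_of_isPullback F P hP sq hK _ ?_ ?_
    · rw [Category.assoc, sq.lift_fst]
      exact s.fst.exact K hK S hS
    · rw [Category.assoc, sq.lift_snd]
      exact s.snd.exact K hK S hS
  · exact (congrArg FCQCat.mapOf h₁).trans (sq.lift_fst _ _ _).symm
  · exact (congrArg FCQCat.mapOf h₂).trans (sq.lift_snd _ _ _).symm

end

end SSet

/-! ### The homotopy relation and categorical equivalences -/

namespace SSet

section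

variable {K L M : SSet.{u}}

lemma IsoHomotopic.refl (f : K ⟶ L) : IsoHomotopic f f := Relation.EqvGen.refl _

lemma IsoHomotopic.symm {f g : K ⟶ L} (h : IsoHomotopic f g) : IsoHomotopic g f :=
  Relation.EqvGen.symm _ _ h

lemma IsoHomotopic.trans {f g k : K ⟶ L} (h : IsoHomotopic f g) (h' : IsoHomotopic g k) :
    IsoHomotopic f k :=
  Relation.EqvGen.trans _ _ _ h h'

lemma IsoHomotopy.isoHomotopic {f g : K ⟶ L} (h : IsoHomotopy f g) : IsoHomotopic f g :=
  Relation.EqvGen.rel _ _ h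

lemma IsoHomotopic.comp_right {f g : K ⟶ L} (h : IsoHomotopic f g) (k : L ⟶ M) :
    IsoHomotopic (f ≫ k) (g ≫ k) := by
  induction h with
  | rel f g h =>
    obtain ⟨H, rfl, rfl⟩ := h
    exact IsoHomotopy.isoHomotopic ⟨H ≫ k, (Category.assoc _ _ _).symm, (Category.assoc _ _ _).symm⟩
  | refl f => exact .refl _
  | symm f g _ h => exact h.symm
  | trans f g k _ _ h h' => exact h.trans h'

lemma IsoHomotopic.comp_left {f g : L ⟶ M} (h : IsoHomotopic f g) (k : K ⟶ L) :
    IsoHomotopic (k ≫ f) (k ≫ g) := by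
  induction h with
  | rel f g h =>
    obtain ⟨H, rfl, rfl⟩ := h
    refine IsoHomotopy.isoHomotopic ⟨k ▷ _ ≫ H, ?_, ?_⟩
    · rw [← Category.assoc, cylZero_whiskerRight, Category.assoc]
    · rw [← Category.assoc, cylOne_whiskerRight, Category.assoc]
  | refl f => exact .refl _
  | symm f g _ h => exact h.symm
  | trans f g k _ _ h h' => exact h.trans h'

lemma IsoHomotopy.refl (f : K ⟶ L) : IsoHomotopy f f :=
  ⟨fst _ _ ≫ f, by rw [← Category.assoc, cylZero_fst, Category.id_comp],
    by rw [← Category.assoc, cylOne_fst, Category.id_comp]⟩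

lemma IsoHomotopy.symm {f g : K ⟶ L} (h : IsoHomotopy f g) : IsoHomotopy g f := by
  obtain ⟨H, h₁, h₂⟩ := h
  refine ⟨K ◁ coherentIso.swap ≫ H, ?_, ?_⟩
  · rw [← Category.assoc, cylZero_swap, h₂]
  · rw [← Category.assoc, cylOne_swap, h₁]

/-- The diagonal of the square `E[1] × E[1]`. -/
def cylDiag (K : SSet.{u}) : K ⊗ coherentIso.{u} ⟶ (K ⊗ coherentIso.{u}) ⊗ coherentIso.{u} :=
  lift (𝟙 _) (snd _ _)

lemma cylZero_cylDiag (K : SSet.{u}) :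
    cylZero K ≫ cylDiag K = cylZero K ≫ cylZero (K ⊗ coherentIso) := rfl

lemma cylOne_cylDiag (K : SSet.{u}) :
    cylOne K ≫ cylDiag K = cylOne K ≫ cylOne K ▷ coherentIso := rfl

instance (K : SSet.{u}) : Mono (cylZero K) := mono_of_mono_fac (cylZero_fst K)

instance (K : SSet.{u}) : Mono (cylOne K) := mono_of_mono_fac (cylOne_fst K)

/-- The homotopy extension property gives a square on K × E[1] × E[1] with H on one side and H' on
the adjacent side; its diagonal runs from f to k. Zig-zags into a quasicategory thus reduce to
single homotopies. -/
lemma IsoHomotopy.trans [Quasicategory L] {f g k : K ⟶ L} (h : IsoHomotopy f g)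
    (h' : IsoHomotopy g k) : IsoHomotopy f k := by
  obtain ⟨H, h₁, h₂⟩ := h
  obtain ⟨H', h₁', h₂'⟩ := h'
  obtain ⟨L, hL₁, hL₂⟩ := Quasicategory.exists_extension (cylOne K) H H' (h₁'.trans h₂.symm)
  refine ⟨cylDiag K ≫ L, ?_, ?_⟩
  · rw [← Category.assoc, cylZero_cylDiag, Category.assoc, hL₁, h₁]
  · rw [← Category.assoc, cylOne_cylDiag, Category.assoc, hL₂, h₂']

lemma IsoHomotopic.isoHomotopy [Quasicategory L] {f g : K ⟶ L} (h : IsoHomotopic f g) :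
    IsoHomotopy f g := by
  induction h with
  | rel f g h => exact h
  | refl f => exact .refl _
  | symm f g _ h => exact h.symm
  | trans f g k _ _ h h' => exact h.trans h'

/-- The relation of being `E[1]`-homotopic, as a relation on morphisms. -/
def isoHomotopicRel : HomRel SSet.{u} := fun _ _ f g => IsoHomotopic f g

instance : Congruence isoHomotopicRel.{u} where
  equivalence := ⟨IsoHomotopic.refl, IsoHomotopic.symm, IsoHomotopic.trans⟩
  comp_left k _ _ h := IsoHomotopic.comp_left h k
  comp_right k h := IsoHomotopic.comp_right h k

/-- Closure under composition and 2-out-of-6 are thereby inherited from isomorphisms. -/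
lemma isCategoricalEquivalence_iff (f : K ⟶ L) :
    IsCategoricalEquivalence f ↔ IsIso ((Quotient.functor isoHomotopicRel).map f) := by
  constructor
  · rintro ⟨g, h₁, h₂⟩
    refine ⟨(Quotient.functor isoHomotopicRel).map g, ?_, ?_⟩
    · rw [← Functor.map_comp, ← (Quotient.functor isoHomotopicRel).map_id]
      exact CategoryTheory.Quotient.sound isoHomotopicRel h₂
    · rw [← Functor.map_comp, ← (Quotient.functor isoHomotopicRel).map_id]
      exact CategoryTheory.Quotient.sound isoHomotopicRel h₁
  · rintro ⟨g, h₁, h₂⟩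
    obtain ⟨g, rfl⟩ := (Quotient.functor isoHomotopicRel).map_surjective g
    rw [← Functor.map_comp, ← (Quotient.functor isoHomotopicRel).map_id] at h₁ h₂
    exact ⟨g, (CategoryTheory.Quotient.functor_map_eq_iff isoHomotopicRel _ _).1 h₂,
      (CategoryTheory.Quotient.functor_map_eq_iff isoHomotopicRel _ _).1 h₁⟩

lemma IsCategoricalEquivalence.of_isIso (f : K ⟶ L) [IsIso f] : IsCategoricalEquivalence f := by
  rw [isCategoricalEquivalence_iff]
  infer_instance

lemma IsCategoricalEquivalence.comp {f : K ⟶ L} {g : L ⟶ M} (hf : IsCategoricalEquivalence f)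
    (hg : IsCategoricalEquivalence g) : IsCategoricalEquivalence (f ≫ g) := by
  rw [isCategoricalEquivalence_iff] at *
  rw [Functor.map_comp]
  infer_instance

end

/-- The middle map is a split epimorphism because of f ≫ g and a monomorphism because of g ≫ h. -/
lemma _root_.CategoryTheory.isIso_of_isIso_comp_of_isIso_comp {C : Type*} [Category C]
    {X Y Z T : C} (f : X ⟶ Y) (g : Y ⟶ Z) (h : Z ⟶ T) [IsIso (f ≫ g)] [IsIso (g ≫ h)] :
    IsIso f ∧ IsIso g ∧ IsIso h := by
  have : IsSplitEpi g := ⟨⟨inv (f ≫ g) ≫ f, by simp⟩⟩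
  have : Mono g := mono_of_mono g h
  have hg : IsIso g := isIso_of_mono_of_isSplitEpi g
  exact ⟨IsIso.of_isIso_comp_right f g, hg, IsIso.of_isIso_comp_left g h⟩

lemma isCategoricalEquivalence_two_out_of_six {X Y Z T : SSet.{u}} (f : X ⟶ Y) (g : Y ⟶ Z)
    (h : Z ⟶ T) (hfg : IsCategoricalEquivalence (f ≫ g)) (hgh : IsCategoricalEquivalence (g ≫ h)) :
    IsCategoricalEquivalence f ∧ IsCategoricalEquivalence g ∧ IsCategoricalEquivalence h := by
  simp only [isCategoricalEquivalence_iff, Functor.map_comp] at *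
  exact isIso_of_isIso_comp_of_isIso_comp _ _ _

lemma IsInnerIsofibration.of_isIso {X Y : SSet.{u}} (f : X ⟶ Y) [IsIso f] :
    IsInnerIsofibration f :=
  ⟨MorphismProperty.of_isIso _ _, inferInstance⟩

lemma IsInnerIsofibration.comp {X Y Z : SSet.{u}} {f : X ⟶ Y} {g : Y ⟶ Z}
    (hf : IsInnerIsofibration f) (hg : IsInnerIsofibration g) : IsInnerIsofibration (f ≫ g) := by
  have := hf.2
  have := hg.2
  exact ⟨MorphismProperty.comp_mem _ _ _ hf.1 hg.1, inferInstance⟩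

lemma IsInnerIsofibration.of_isPullback {X Y Z T : SSet.{u}} {f : X ⟶ Y} {g : X ⟶ Z} {p : Y ⟶ T}
    {q : Z ⟶ T} (sq : IsPullback f g p q) (hp : IsInnerIsofibration p) : IsInnerIsofibration g := by
  have := hp.2
  exact ⟨MorphismProperty.of_isPullback sq hp.1, sq.hasLiftingProperty _⟩

/-! ### The boundary of a cylinder -/

section

variable (K : SSet.{u}) {T Z : SSet.{u}}

/-- The two ends of a cylinder. -/
abbrev cylBoundary : (K ⊗ coherentIso.{u}).Subcomplex := Subcomplex.range (cylZero K) ⊔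
  Subcomplex.range (cylOne K)

/-- The inclusion of the end `0` of a cylinder in its boundary. -/
def cylBoundaryZero : K ⟶ (cylBoundary K : SSet.{u}) :=
  Subcomplex.lift (cylZero K) (le_sup_left)

/-- The inclusion of the end `1` of a cylinder in its boundary. -/
def cylBoundaryOne : K ⟶ (cylBoundary K : SSet.{u}) :=
  Subcomplex.lift (cylOne K) (le_sup_right)

lemma cylBoundaryZero_ι : cylBoundaryZero K ≫ (cylBoundary K).ι = cylZero K := rfl

lemma cylBoundaryOne_ι : cylBoundaryOne K ≫ (cylBoundary K).ι = cylOne K := rfl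

variable {K}

lemma cylBoundary_hom_ext {f g : (cylBoundary K : SSet.{u}) ⟶ Z}
    (h₀ : cylBoundaryZero K ≫ f = cylBoundaryZero K ≫ g)
    (h₁ : cylBoundaryOne K ≫ f = cylBoundaryOne K ≫ g) : f = g := by
  refine NatTrans.ext (funext fun n => ConcreteCategory.hom_ext _ _ fun ⟨z, hz⟩ => ?_)
  obtain ⟨x, rfl⟩ | ⟨x, rfl⟩ := hz
  · exact congrArg (fun f : K ⟶ Z => f.app n x) h₀
  · exact congrArg (fun f : K ⟶ Z => f.app n x) h₁

lemma exists_cylBoundary_desc (a b : K ⟶ Z) : ∃ f : (cylBoundary K : SSet.{u}) ⟶ Z,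
    cylBoundaryZero K ≫ f = a ∧ cylBoundaryOne K ≫ f = b := by
  obtain ⟨f, h₀, h₁⟩ := Subcomplex.exists_desc_range_sup (cylZero K) (cylOne K) a b (by
    rintro ⟨⟨n⟩⟩ x y h
    have h' := congrArg (fun z : coherentIso.{u} _⦋n⦌ => coherentIso.label z 0)
      (congrArg Prod.snd h)
    exact absurd h' Bool.false_ne_true)
  exact ⟨f, NatTrans.ext (funext fun n => ConcreteCategory.hom_ext _ _ fun x => h₀ n x),
    NatTrans.ext (funext fun n => ConcreteCategory.hom_ext _ _ fun x => h₁ n x)⟩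

lemma cylBoundary_tensor_hom_ext {f g : (cylBoundary K : SSet.{u}) ⊗ T ⟶ Z}
    (h₀ : cylBoundaryZero K ▷ T ≫ f = cylBoundaryZero K ▷ T ≫ g)
    (h₁ : cylBoundaryOne K ▷ T ≫ f = cylBoundaryOne K ▷ T ≫ g) : f = g := by
  refine NatTrans.ext (funext fun n => ConcreteCategory.hom_ext _ _ fun ⟨⟨z, hz⟩, t⟩ => ?_)
  obtain ⟨x, rfl⟩ | ⟨x, rfl⟩ := hz
  · exact congrArg (fun f : K ⊗ T ⟶ Z => f.app n (x, t)) h₀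
  · exact congrArg (fun f : K ⊗ T ⟶ Z => f.app n (x, t)) h₁

/-- The product with T is a left adjoint, so it preserves the decomposition into two disjoint ends;
currying reduces to the case without T. -/
lemma exists_cylBoundary_tensor_desc (a b : K ⊗ T ⟶ Z) :
    ∃ f : (cylBoundary K : SSet.{u}) ⊗ T ⟶ Z,
      cylBoundaryZero K ▷ T ≫ f = a ∧ cylBoundaryOne K ▷ T ≫ f = b := by
  obtain ⟨f, h₀, h₁⟩ := exists_cylBoundary_desc (MonoidalClosed.curry ((β_ _ _).hom ≫ a))
    (MonoidalClosed.curry ((β_ _ _).hom ≫ b))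
  refine ⟨(β_ _ _).hom ≫ MonoidalClosed.uncurry f, ?_, ?_⟩
  · rw [BraidedCategory.braiding_naturality_left_assoc, ← MonoidalClosed.uncurry_natural_left,
      h₀, MonoidalClosed.uncurry_curry, SymmetricCategory.symmetry_assoc]
  · rw [BraidedCategory.braiding_naturality_left_assoc, ← MonoidalClosed.uncurry_natural_left,
      h₁, MonoidalClosed.uncurry_curry, SymmetricCategory.symmetry_assoc]

/-- The homotopy lifting property of inner isofibrations for cylinders, relative to both ends. -/
lemma IsInnerIsofibration.exists_lift_cylBoundary {X Y : SSet.{u}} {p : X ⟶ Y}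
    (hp : IsInnerIsofibration p) (f a b : K ⊗ coherentIso.{u} ⟶ X)
    (k : (K ⊗ coherentIso.{u}) ⊗ coherentIso.{u} ⟶ Y)
    (h₀ : cylZero K ≫ a = cylZero K ≫ f) (h₁ : cylZero K ≫ b = cylOne K ≫ f)
    (ha : cylZero K ▷ _ ≫ k = a ≫ p) (hb : cylOne K ▷ _ ≫ k = b ≫ p)
    (hf : cylZero _ ≫ k = f ≫ p) :
    ∃ H : (K ⊗ coherentIso.{u}) ⊗ coherentIso.{u} ⟶ X, cylZero _ ≫ H = f ∧
      cylZero K ▷ _ ≫ H = a ∧ cylOne K ▷ _ ≫ H = b ∧ H ≫ p = k := by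
  obtain ⟨c, hc₀, hc₁⟩ := exists_cylBoundary_tensor_desc a b
  obtain ⟨H, hH₁, hH₂, hH₃⟩ := hp.exists_lift (cylBoundary K).ι f c k (by
    refine cylBoundary_hom_ext ?_ ?_
    · rw [← Category.assoc, ← cylZero_whiskerRight, Category.assoc, hc₀, h₀, ← Category.assoc,
        cylBoundaryZero_ι]
    · rw [← Category.assoc, ← cylZero_whiskerRight, Category.assoc, hc₁, h₁, ← Category.assoc,
        cylBoundaryOne_ι]) (by
    refine cylBoundary_tensor_hom_ext ?_ ?_
    · rw [← comp_whiskerRight_assoc, cylBoundaryZero_ι, ha, ← Category.assoc, hc₀]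
    · rw [← comp_whiskerRight_assoc, cylBoundaryOne_ι, hb, ← Category.assoc, hc₁]) hf
  refine ⟨H, hH₁, ?_, ?_, hH₃⟩
  · rw [← hc₀, ← hH₂, ← comp_whiskerRight_assoc, cylBoundaryZero_ι]
  · rw [← hc₁, ← hH₂, ← comp_whiskerRight_assoc, cylBoundaryOne_ι]

end

end SSet

/-! ### Acyclic inner isofibrations have fibrewise deformations -/

namespace SSet

/-- The maximum of the two coordinates of `E[1] × E[1]`. -/
def coherentIso.max : coherentIso.{u} ⊗ coherentIso.{u} ⟶ coherentIso.{u} where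
  app n := ↾fun x => ofLabel (m := n.unop.len) fun i =>
    label (m := n.unop.len) x.1 i || label (m := n.unop.len) x.2 i
  naturality _ _ _ := rfl

variable (X : SSet.{u})

/-- The maximum of the two cylinder coordinates. -/
def cylMax : (X ⊗ coherentIso.{u}) ⊗ coherentIso.{u} ⟶ X ⊗ coherentIso.{u} :=
  (α_ _ _ _).hom ≫ X ◁ coherentIso.max

lemma cylZero_cylMax : cylZero (X ⊗ coherentIso) ≫ cylMax X = 𝟙 _ := by
  refine NatTrans.ext (funext fun n => ConcreteCategory.hom_ext _ _ fun ⟨x, e⟩ => ?_)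
  exact Prod.ext rfl (coherentIso.label_ext (m := n.unop.len) fun i => Bool.or_false _)

lemma cylOne_cylMax : cylOne (X ⊗ coherentIso) ≫ cylMax X = fst _ _ ≫ cylOne X := by
  refine NatTrans.ext (funext fun n => ConcreteCategory.hom_ext _ _ fun ⟨x, e⟩ => ?_)
  exact Prod.ext rfl (coherentIso.label_ext (m := n.unop.len) fun i => Bool.or_true _)

lemma cylZero_whiskerRight_cylMax : cylZero X ▷ coherentIso ≫ cylMax X = 𝟙 _ := by
  refine NatTrans.ext (funext fun n => ConcreteCategory.hom_ext _ _ fun ⟨x, e⟩ => ?_)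
  exact Prod.ext rfl (coherentIso.label_ext (m := n.unop.len) fun i => Bool.false_or _)

lemma cylOne_whiskerRight_cylMax : cylOne X ▷ coherentIso ≫ cylMax X = fst _ _ ≫ cylOne X := by
  refine NatTrans.ext (funext fun n => ConcreteCategory.hom_ext _ _ fun ⟨x, e⟩ => ?_)
  exact Prod.ext rfl (coherentIso.label_ext (m := n.unop.len) fun i =>
    Bool.true_or (coherentIso.label (m := n.unop.len) e i))

variable {X} {Y : SSet.{u}}

/-- `p` has a section `s`, with a homotopy over `Y` from `p ≫ s` to the identity. -/
def IsShrinkable (p : X ⟶ Y) : Prop :=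
  ∃ s : Y ⟶ X, s ≫ p = 𝟙 Y ∧ ∃ H : X ⊗ coherentIso.{u} ⟶ X, cylZero X ≫ H = p ≫ s ∧
    cylOne X ≫ H = 𝟙 X ∧ H ≫ p = fst _ _ ≫ p

lemma IsShrinkable.isCategoricalEquivalence {p : X ⟶ Y} (hp : IsShrinkable p) :
    IsCategoricalEquivalence p := by
  obtain ⟨s, hs, H, h₀, h₁, -⟩ := hp
  exact ⟨s, hs ▸ IsoHomotopic.refl _, IsoHomotopy.isoHomotopic ⟨H, h₀, h₁⟩⟩

/-- The section and the homotopy live over Y, so they are induced on the pullback. This gives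
stability of acyclic fibrations. -/
lemma IsShrinkable.of_isPullback {p : X ⟶ Y} (hp : IsShrinkable p) {X' Y' : SSet.{u}}
    {g : X' ⟶ X} {q : X' ⟶ Y'} {f : Y' ⟶ Y} (sq : IsPullback g q p f) : IsShrinkable q := by
  obtain ⟨s, hs, H, h₀, h₁, h₂⟩ := hp
  have w₁ : (f ≫ s) ≫ p = 𝟙 _ ≫ f := by rw [Category.assoc, hs, Category.comp_id, Category.id_comp]
  have w₂ : (g ▷ coherentIso ≫ H) ≫ p = (fst _ _ ≫ q) ≫ f := by
    rw [Category.assoc, h₂, whiskerRight_fst_assoc, sq.w, Category.assoc]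
  refine ⟨sq.lift _ _ w₁, sq.lift_snd _ _ w₁, sq.lift _ _ w₂, sq.hom_ext ?_ ?_, sq.hom_ext ?_ ?_,
    sq.lift_snd _ _ w₂⟩
  · rw [Category.assoc, Category.assoc, sq.lift_fst, sq.lift_fst, ← Category.assoc,
      cylZero_whiskerRight, Category.assoc, h₀, ← Category.assoc, sq.w, Category.assoc]
  · rw [Category.assoc, Category.assoc, sq.lift_snd, sq.lift_snd, ← Category.assoc, cylZero_fst,
      Category.id_comp, Category.comp_id]
  · rw [Category.assoc, sq.lift_fst, ← Category.assoc, cylOne_whiskerRight, Category.assoc, h₁,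
      Category.comp_id, Category.id_comp]
  · rw [Category.assoc, sq.lift_snd, ← Category.assoc, cylOne_fst]

/-- Inner isofibrations which are categorical equivalences are shrinkable. -/
lemma IsInnerIsofibration.isShrinkable [Quasicategory X] [Quasicategory Y] {p : X ⟶ Y}
    (hp : IsInnerIsofibration p) (hp' : IsCategoricalEquivalence p) : IsShrinkable p := by
  obtain ⟨g, h₁, h₂⟩ := hp'
  obtain ⟨K, hK₀, hK₁⟩ := h₁.isoHomotopy
  -- With an empty relative part the lifting property is absolute: it moves the homotopy inverse g
  -- to a strict section s, the other end of a lift of K.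
  let A : Y.Subcomplex := ⊥
  have hA {Z : SSet.{u}} (a b : (A : SSet.{u}) ⟶ Z) : a = b :=
    NatTrans.ext (funext fun n => ConcreteCategory.hom_ext _ _ fun ⟨_, hx⟩ => hx.elim)
  have hA' {Z : SSet.{u}} (a b : (A : SSet.{u}) ⊗ coherentIso.{u} ⟶ Z) : a = b :=
    NatTrans.ext (funext fun n => ConcreteCategory.hom_ext _ _ fun ⟨⟨_, hx⟩, _⟩ => hx.elim)
  obtain ⟨S, hS₀, -, hS⟩ := hp.exists_lift A.ι g (A.ι ▷ _ ≫ fst _ _ ≫ g) K (hA _ _) (hA' _ _) hK₀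
  let s := cylOne Y ≫ S
  have hs : s ≫ p = 𝟙 Y := by rw [Category.assoc, hS, hK₁]
  have hgs : IsoHomotopic s g := (IsoHomotopy.isoHomotopic ⟨S, hS₀, rfl⟩).symm
  obtain ⟨G, hG₀, hG₁⟩ := ((hgs.comp_left p).trans h₂).isoHomotopy
  -- The homotopy G from p ≫ s to the identity need not lie over Y. Its projection is contracted by
  -- (t, t') ↦ max(t, t'), which is constant at t' = 1. Lifting with the ends carried along `G ≫ p ≫
  -- s` and the constant homotopy yields at t' = 1 a homotopy with the same ends, now over Y.
  obtain ⟨L, hL₀, hL₁, hL₂, hL₃⟩ := hp.exists_lift_cylBoundary G (G ≫ p ≫ s) (fst _ _)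
    (cylMax X ≫ G ≫ p) (by
      rw [← Category.assoc, hG₀, Category.assoc, ← Category.assoc s, hs, Category.id_comp])
    (by rw [cylZero_fst, hG₁])
    (by
      rw [← Category.assoc, cylZero_whiskerRight_cylMax, Category.id_comp, Category.assoc,
        Category.assoc, hs, Category.comp_id])
    (by
      rw [← Category.assoc, cylOne_whiskerRight_cylMax, Category.assoc, ← Category.assoc (cylOne X),
        hG₁, Category.id_comp])
    (by rw [← Category.assoc, cylZero_cylMax, Category.id_comp])
  refine ⟨s, hs, cylOne _ ≫ L, ?_, ?_, ?_⟩
  · rw [← Category.assoc, ← cylOne_whiskerRight, Category.assoc, hL₁, ← Category.assoc, hG₁,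
      Category.id_comp]
  · rw [← Category.assoc, ← cylOne_whiskerRight, Category.assoc, hL₂, cylOne_fst]
  · rw [Category.assoc, hL₃, ← Category.assoc, cylOne_cylMax, Category.assoc,
      ← Category.assoc (cylOne X), hG₁, Category.id_comp]

end SSet

namespace SSet

/-! ### Trivial fibrations -/

instance (K L : SSet.{u}) : Mono (joinInl K L) := by
  refine (NatTrans.mono_iff_mono_app _).2 fun n => (mono_iff_injective _).2 fun x y h => ?_
  have h' : (JoinSimplex.inl (yonedaEquiv.symm x) : JoinSimplex K L _) =
    JoinSimplex.inl (yonedaEquiv.symm y) := h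
  injection h' with _ h₁ _
  -- The initial part is everything, so r inverts its inclusion and the simplex can be read off.
  let r : stdSimplex.{u}.obj (unop n) ⟶ (cutFiber (const (stdSimplex.obj₀Equiv.symm 0) :
      stdSimplex.{u}.obj (unop n) ⟶ Δ[1]) 0 : SSet.{u}) := Subcomplex.lift (𝟙 _) (by
    rintro ⟨m⟩ z -
    exact (stdSimplex.mem_face_iff.{u} {0} _).2 fun _ => Finset.mem_singleton_self _)
  exact yonedaEquiv.symm.injective (congrArg (r ≫ ·) h₁)

section

variable {X Y : SSet.{u}} {p : X ⟶ Y} (hp : (MorphismProperty.monomorphisms SSet.{u}).rlp p)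

include hp

lemma hasLiftingProperty_of_rlp_monomorphisms {A B : SSet.{u}} (i : A ⟶ B) [Mono i] :
    HasLiftingProperty i p :=
  hp i inferInstance

lemma isInnerIsofibration_of_rlp_monomorphisms : IsInnerIsofibration p := by
  refine ⟨?_, hp _ (mono_of_stdSimplex_zero _)⟩
  rintro _ _ _ ⟨k, _, _⟩
  exact hasLiftingProperty_of_rlp_monomorphisms hp _

/-- Joins preserve monomorphisms, so extension problems for cones can be pushed down and their
solutions lifted, or lifted and their solutions pushed down. -/
lemma isUniversalCone_comp_iff_of_rlp_monomorphisms {K : SSet.{u}} (S : underCone K ⟶ X) :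
    IsUniversalCone (S ≫ p) ↔ IsUniversalCone S := by
  refine ⟨fun h m U hU => ?_, fun h m U hU => ?_⟩
  · obtain ⟨V, hV⟩ := h m (U ≫ p) (by rw [← Category.assoc, hU])
    have := hasLiftingProperty_of_rlp_monomorphisms hp
      (joinMap (𝟙 K) (∂Δ[m + 1] : SSet.Subcomplex.{u} _).ι)
    have sq : CommSq U (joinMap (𝟙 K) (∂Δ[m + 1] : SSet.Subcomplex.{u} _).ι) p V := ⟨hV.symm⟩
    exact ⟨sq.lift, sq.fac_left⟩
  · have := hasLiftingProperty_of_rlp_monomorphisms hp (joinMap (𝟙 K) (boundaryZero m))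
    have sq : CommSq S (joinMap (𝟙 K) (boundaryZero m)) p U := ⟨hU.symm⟩
    obtain ⟨V, hV⟩ := h m sq.lift sq.fac_left
    exact ⟨V ≫ p, by rw [← Category.assoc, hV, sq.fac_right]⟩

lemma isFinitelyCocomplete_of_rlp_monomorphisms (hY : IsFinitelyCocomplete Y) :
    IsFinitelyCocomplete X := fun K hK X' => by
  obtain ⟨S, hS, hSu⟩ := hY K hK (X' ≫ p)
  have := hasLiftingProperty_of_rlp_monomorphisms hp (coneBase K)
  have sq : CommSq X' (coneBase K) p S := ⟨hS.symm⟩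
  refine ⟨sq.lift, sq.fac_left, (isUniversalCone_comp_iff_of_rlp_monomorphisms hp _).1 ?_⟩
  rwa [sq.fac_right]

lemma isoHomotopy_of_rlp_monomorphisms {K : SSet.{u}} (f g : K ⟶ X) (h : f ≫ p = g ≫ p) :
    IsoHomotopy f g := by
  obtain ⟨a, h₀, h₁⟩ := exists_cylBoundary_desc f g
  have := hasLiftingProperty_of_rlp_monomorphisms hp (cylBoundary K).ι
  have sq : CommSq a (cylBoundary K).ι p (fst _ _ ≫ f ≫ p) := ⟨by
    refine cylBoundary_hom_ext ?_ ?_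
    · rw [← Category.assoc, h₀, ← Category.assoc, cylBoundaryZero_ι, ← Category.assoc, cylZero_fst,
        Category.id_comp]
    · rw [← Category.assoc, h₁, ← Category.assoc, cylBoundaryOne_ι, ← Category.assoc, cylOne_fst,
        Category.id_comp, h]⟩
  refine ⟨sq.lift, ?_, ?_⟩
  · exact (Category.assoc (cylBoundaryZero K) _ _).trans (by rw [sq.fac_left, h₀])
  · exact (Category.assoc (cylBoundaryOne K) _ _).trans (by rw [sq.fac_left, h₁])

end

/-! ### The quasicategory of equivalences -/

/-- The simplicial set of maps `E[1] ⟶ D`. -/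
abbrev pathSpace (D : SSet.{u}) : SSet.{u} := (ihom (Δ[0] ⊗ coherentIso.{u})).obj D

section

variable {D : SSet.{u}}

/-- Evaluation at a vertex of the cylinder. -/
def pathEval (v : (Δ[0] : SSet.{u}) ⟶ Δ[0] ⊗ coherentIso.{u}) (D : SSet.{u}) : pathSpace D ⟶ D :=
  lift (stdSimplex.isTerminalObj₀.from _ ≫ v) (𝟙 _) ≫ (ihom.ev _).app D

/-- The factor Δ[0] in the path space makes the ends of the interval the case K = Δ[0] of `cylZero
K` and `cylOne K`. -/
lemma comp_pathEval (v : (Δ[0] : SSet.{u}) ⟶ Δ[0] ⊗ coherentIso.{u}) {B : SSet.{u}}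
    (g : B ⟶ pathSpace D) : g ≫ pathEval v D =
      lift (stdSimplex.isTerminalObj₀.from B ≫ v) (𝟙 _) ≫ MonoidalClosed.uncurry g := by
  rw [MonoidalClosed.uncurry_eq, pathEval, ← Category.assoc, ← Category.assoc]
  congr 1

lemma curry_pathEval (v : (Δ[0] : SSet.{u}) ⟶ Δ[0] ⊗ coherentIso.{u}) {B : SSet.{u}}
    (g : (Δ[0] ⊗ coherentIso.{u}) ⊗ B ⟶ D) : MonoidalClosed.curry g ≫ pathEval v D =
      lift (stdSimplex.isTerminalObj₀.from B ≫ v) (𝟙 _) ≫ g := by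
  rw [comp_pathEval, MonoidalClosed.uncurry_curry]

/-- The exchange of factors `(Δ[0] × E[1]) × B ≅ B × E[1]`. -/
def cylSwap (B : SSet.{u}) : (Δ[0] ⊗ coherentIso.{u}) ⊗ B ⟶ B ⊗ coherentIso.{u} :=
  lift (snd _ _) (fst _ _ ≫ snd _ _)

/-- The inverse of `cylSwap`. -/
def cylSwapInv (B : SSet.{u}) : B ⊗ coherentIso.{u} ⟶ (Δ[0] ⊗ coherentIso.{u}) ⊗ B :=
  lift (lift (stdSimplex.isTerminalObj₀.from _) (snd _ _)) (fst _ _)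

lemma cylSwap_cylSwapInv (B : SSet.{u}) : cylSwap B ≫ cylSwapInv B = 𝟙 _ := by
  refine CartesianMonoidalCategory.hom_ext _ _
    (CartesianMonoidalCategory.hom_ext _ _ (stdSimplex.isTerminalObj₀.hom_ext _ _) rfl) rfl

lemma whiskerLeft_cylSwap {A B : SSet.{u}} (i : A ⟶ B) :
    _ ◁ i ≫ cylSwap B = cylSwap A ≫ i ▷ _ := rfl

lemma lift_cylZero_cylSwap (B : SSet.{u}) :
    lift (stdSimplex.isTerminalObj₀.from B ≫ cylZero Δ[0]) (𝟙 _) ≫ cylSwap B = cylZero B := rfl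

lemma lift_cylOne_cylSwap (B : SSet.{u}) :
    lift (stdSimplex.isTerminalObj₀.from B ≫ cylOne Δ[0]) (𝟙 _) ≫ cylSwap B = cylOne B := rfl

lemma cylZero_cylSwapInv (B : SSet.{u}) :
    cylZero B ≫ cylSwapInv B = lift (stdSimplex.isTerminalObj₀.from B ≫ cylZero Δ[0]) (𝟙 _) := by
  rw [← lift_cylZero_cylSwap, Category.assoc, cylSwap_cylSwapInv, Category.comp_id]

lemma cylOne_cylSwapInv (B : SSet.{u}) :
    cylOne B ≫ cylSwapInv B = lift (stdSimplex.isTerminalObj₀.from B ≫ cylOne Δ[0]) (𝟙 _) := by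
  rw [← lift_cylOne_cylSwap, Category.assoc, cylSwap_cylSwapInv, Category.comp_id]

/-- After transposition the lifting problem is the homotopy extension property of the quasicategory
D. -/
lemma rlp_monomorphisms_pathEval_cylZero [Quasicategory D] :
    (MorphismProperty.monomorphisms SSet.{u}).rlp (pathEval (cylZero Δ[0]) D) := by
  intro A B i hi
  have : Mono i := hi
  refine ⟨fun {a b} sq => ?_⟩
  have w := sq.w
  rw [comp_pathEval, ← cylZero_cylSwapInv, Category.assoc] at w
  obtain ⟨H, h₀, h₁⟩ := Quasicategory.exists_extension i b _ w
  refine ⟨⟨⟨MonoidalClosed.curry (cylSwap B ≫ H), ?_, ?_⟩⟩⟩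
  · rw [← MonoidalClosed.curry_natural_left, ← Category.assoc, whiskerLeft_cylSwap, Category.assoc,
      h₁, ← Category.assoc, cylSwap_cylSwapInv, Category.id_comp, MonoidalClosed.curry_uncurry]
  · rw [curry_pathEval, ← Category.assoc, lift_cylZero_cylSwap, h₀]

lemma rlp_monomorphisms_pathEval_cylOne [Quasicategory D] :
    (MorphismProperty.monomorphisms SSet.{u}).rlp (pathEval (cylOne Δ[0]) D) := by
  intro A B i hi
  have : Mono i := hi
  refine ⟨fun {a b} sq => ?_⟩
  have w := sq.w
  rw [comp_pathEval, ← cylOne_cylSwapInv, Category.assoc] at w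
  obtain ⟨H, h₀, h₁⟩ := Quasicategory.exists_extension_one i b _ w
  refine ⟨⟨⟨MonoidalClosed.curry (cylSwap B ≫ H), ?_, ?_⟩⟩⟩
  · rw [← MonoidalClosed.curry_natural_left, ← Category.assoc, whiskerLeft_cylSwap, Category.assoc,
      h₁, ← Category.assoc, cylSwap_cylSwapInv, Category.id_comp, MonoidalClosed.curry_uncurry]
  · rw [curry_pathEval, ← Category.assoc, lift_cylOne_cylSwap, h₀]

/-- The constant paths. -/
def pathConst (D : SSet.{u}) : D ⟶ pathSpace D := MonoidalClosed.curry (snd _ _)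

lemma pathConst_pathEval (v : (Δ[0] : SSet.{u}) ⟶ Δ[0] ⊗ coherentIso.{u}) :
    pathConst D ≫ pathEval v D = 𝟙 D := by
  rw [pathConst, curry_pathEval, lift_snd]

lemma snd_lift_comp (v : (Δ[0] : SSet.{u}) ⟶ Δ[0] ⊗ coherentIso.{u}) (B : SSet.{u}) :
    snd Δ[0] B ≫ lift (stdSimplex.isTerminalObj₀.from B ≫ v) (𝟙 _) = v ▷ B := by
  refine CartesianMonoidalCategory.hom_ext _ _ ?_ (by simp)
  rw [Category.assoc, lift_fst, whiskerRight_fst, ← Category.assoc]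
  congr 1
  exact stdSimplex.isTerminalObj₀.hom_ext _ _

lemma lift_comp_eq (v : (Δ[0] : SSet.{u}) ⟶ Δ[0] ⊗ coherentIso.{u}) (B : SSet.{u}) :
    lift (stdSimplex.isTerminalObj₀.from B ≫ v) (𝟙 _) =
      lift (stdSimplex.isTerminalObj₀.from B) (𝟙 B) ≫ v ▷ B := by
  rw [← snd_lift_comp, ← Category.assoc, lift_snd, Category.id_comp]

lemma innerFibrations_lift_pathEval [Quasicategory D] : innerFibrations
    (lift (pathEval (cylZero Δ[0]) D) (pathEval (cylOne Δ[0]) D)) := by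
  intro A B i hi
  -- Restricting paths to the two ends of the interval is an inner fibration of internal homs; its
  -- target is D × D by gluing along the disjoint ends.
  have := (inferInstance : InnerFibration
    ((MonoidalClosed.pre (cylBoundary Δ[0]).ι).app D)).mem i hi
  refine ⟨fun {a b} sq => ?_⟩
  have w₀ := congrArg (· ≫ fst _ _) sq.w
  have w₁ := congrArg (· ≫ snd _ _) sq.w
  simp only [Category.assoc, lift_fst, lift_snd] at w₀ w₁
  rw [comp_pathEval] at w₀ w₁
  obtain ⟨c, hc₀, hc₁⟩ := exists_cylBoundary_tensor_desc (K := Δ[0])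
    (snd _ _ ≫ b ≫ fst _ _) (snd _ _ ≫ b ≫ snd _ _)
  have sq' : CommSq a i ((MonoidalClosed.pre (cylBoundary Δ[0]).ι).app D)
      (MonoidalClosed.curry c) := ⟨by
    apply MonoidalClosed.uncurry_injective
    rw [MonoidalClosed.uncurry_pre_app, MonoidalClosed.uncurry_natural_left,
      MonoidalClosed.uncurry_curry]
    refine cylBoundary_tensor_hom_ext ?_ ?_
    · rw [← comp_whiskerRight_assoc, cylBoundaryZero_ι, ← snd_lift_comp, Category.assoc, w₀,
        ← whisker_exchange_assoc, hc₀, whiskerLeft_snd_assoc]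
    · rw [← comp_whiskerRight_assoc, cylBoundaryOne_ι, ← snd_lift_comp, Category.assoc, w₁,
        ← whisker_exchange_assoc, hc₁, whiskerLeft_snd_assoc]⟩
  have h := congrArg MonoidalClosed.uncurry sq'.fac_right
  rw [MonoidalClosed.uncurry_pre_app, MonoidalClosed.uncurry_curry] at h
  refine ⟨⟨⟨sq'.lift, sq'.fac_left, CartesianMonoidalCategory.hom_ext _ _ ?_ ?_⟩⟩⟩
  · rw [Category.assoc, lift_fst, comp_pathEval, lift_comp_eq, ← cylBoundaryZero_ι,
      comp_whiskerRight, Category.assoc, Category.assoc, h, hc₀, lift_snd_assoc, Category.id_comp]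
  · rw [Category.assoc, lift_snd, comp_pathEval, lift_comp_eq, ← cylBoundaryOne_ι,
      comp_whiskerRight, Category.assoc, Category.assoc, h, hc₁, lift_snd_assoc, Category.id_comp]

/-- The evaluation of paths at their ends is an inner isofibration. -/
lemma isInnerIsofibration_lift_pathEval [Quasicategory D] : IsInnerIsofibration
    (lift (pathEval (cylZero Δ[0]) D) (pathEval (cylOne Δ[0]) D)) := by
  refine ⟨innerFibrations_lift_pathEval, ⟨fun {a b} sq => ?_⟩⟩
  have w₀ := congrArg (· ≫ fst _ _) sq.w
  have w₁ := congrArg (· ≫ snd _ _) sq.w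
  simp only [Category.assoc, lift_fst, lift_snd] at w₀ w₁
  rw [comp_pathEval] at w₀ w₁
  let τ (I : SSet.{u}) : I ⟶ I ⊗ Δ[0] := lift (𝟙 I) (stdSimplex.isTerminalObj₀.from I)
  have hτ (v : (Δ[0] : SSet.{u}) ⟶ Δ[0] ⊗ coherentIso.{u}) :
      v ≫ τ _ = lift (stdSimplex.isTerminalObj₀.from Δ[0] ≫ v) (𝟙 _) := by
    refine CartesianMonoidalCategory.hom_ext _ _ ?_ (stdSimplex.isTerminalObj₀.hom_ext _ _)
    rw [Category.assoc, lift_fst, lift_fst, Category.comp_id,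
      stdSimplex.isTerminalObj₀.hom_ext (stdSimplex.isTerminalObj₀.from Δ[0]) (𝟙 _),
      Category.id_comp]
  have hτ' (I : SSet.{u}) : fst I Δ[0] ≫ τ I = 𝟙 _ :=
    CartesianMonoidalCategory.hom_ext _ _ (by simp [τ]) (stdSimplex.isTerminalObj₀.hom_ext _ _)
  -- Transposed, a path a of D is to be deformed along prescribed deformations of its two ends: the
  -- relative lifting property for the cylinder on Δ[0].
  obtain ⟨H, h₁, h₂, h₃, -⟩ := (isInnerIsofibration_of_quasicategory
    (stdSimplex.isTerminalObj₀.from D)).exists_lift_cylBoundary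
    (K := Δ[0]) (τ _ ≫ MonoidalClosed.uncurry a) (snd _ _ ≫ b ≫ fst _ _) (snd _ _ ≫ b ≫ snd _ _)
    (stdSimplex.isTerminalObj₀.from _)
    (by rw [← Category.assoc _ (τ _), hτ, w₀, ← Category.assoc]; rfl)
    (by rw [← Category.assoc _ (τ _), hτ, w₁, ← Category.assoc]; rfl)
    (stdSimplex.isTerminalObj₀.hom_ext _ _) (stdSimplex.isTerminalObj₀.hom_ext _ _)
    (stdSimplex.isTerminalObj₀.hom_ext _ _)
  refine ⟨⟨⟨MonoidalClosed.curry H, ?_, CartesianMonoidalCategory.hom_ext _ _ ?_ ?_⟩⟩⟩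
  · apply MonoidalClosed.uncurry_injective
    rw [MonoidalClosed.uncurry_natural_left, MonoidalClosed.uncurry_curry]
    have h₄ : (Δ[0] ⊗ coherentIso.{u}) ◁ coherentIsoZero = fst _ _ ≫ cylZero _ := rfl
    rw [h₄, Category.assoc, h₁, ← Category.assoc, hτ', Category.id_comp]
  · rw [Category.assoc, lift_fst, curry_pathEval, lift_comp_eq, Category.assoc, h₂,
      lift_snd_assoc, Category.id_comp]
  · rw [Category.assoc, lift_snd, curry_pathEval, lift_comp_eq, Category.assoc, h₃,
      lift_snd_assoc, Category.id_comp]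

end

end SSet

/-! ### Path objects and the fibration category structure -/

namespace FCQCat

open SSet

/-- The functor sending a finitely cocomplete quasicategory to its underlying simplicial set. -/
def forget : FCQCat.{u} ⥤ SSet.{u} where
  obj C := C.toSSet
  map F := mapOf F

instance (C : FCQCat.{u}) : Quasicategory C.toSSet := C.quasicategory

section

variable {C D E : FCQCat.{u}} (F : C ⟶ D) (P : E ⟶ D) (hP : fibrations P)

include hP

lemma exists_isPullback : ∃ (R : FCQCat.{u}) (Q : R ⟶ C) (G : R ⟶ E), IsPullback Q G F P ∧
    IsPullback (mapOf Q) (mapOf G) (mapOf F) (mapOf P) := by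
  have sq := IsPullback.of_hasPullback (mapOf F) (mapOf P)
  exact ⟨_, _, _, FCQCat.isPullback F P hP sq (quasicategory_of_isPullback F P hP sq)
    (isFinitelyCocomplete_of_isPullback F P hP sq) (isExact_fst_of_isPullback F P hP sq)
    (isExact_snd_of_isPullback F P hP sq), sq⟩

/-- The stability axioms concern arbitrary pullback squares of exact maps. Each is isomorphic to the
one formed in simplicial sets. -/
lemma isPullback_mapOf {R : FCQCat.{u}} {Q : R ⟶ C} {G : R ⟶ E} (sq : IsPullback Q G F P) :
    IsPullback (mapOf Q) (mapOf G) (mapOf F) (mapOf P) := by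
  obtain ⟨R', Q', G', sq', sq''⟩ := exists_isPullback F P hP
  obtain ⟨e, h₁, h₂⟩ : ∃ e : R' ≅ R, e.hom ≫ Q = Q' ∧ e.hom ≫ G = G' :=
    ⟨sq'.isoIsPullback _ _ sq, sq'.isoIsPullback_hom_fst _ _ sq, sq'.isoIsPullback_hom_snd _ _ sq⟩
  let e' : R'.toSSet ≅ R.toSSet :=
    ⟨mapOf e.hom, mapOf e.inv, congrArg mapOf e.hom_inv_id, congrArg mapOf e.inv_hom_id⟩
  exact sq''.of_iso e' (Iso.refl _) (Iso.refl _) (Iso.refl _)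
    ((Category.comp_id _).trans (congrArg mapOf h₁.symm))
    ((Category.comp_id _).trans (congrArg mapOf h₂.symm))
    ((Category.comp_id _).trans (Category.id_comp _).symm)
    ((Category.comp_id _).trans (Category.id_comp _).symm)

end

lemma isExact_of_rlp_monomorphisms {X Y : SSet.{u}} {p : X ⟶ Y}
    (hp : (MorphismProperty.monomorphisms SSet.{u}).rlp p) : IsExact p :=
  fun _ _ S hS => (isUniversalCone_comp_iff_of_rlp_monomorphisms hp S).2 hS

/-- Constant paths form a section of an evaluation map that reflects universal cones. -/
lemma isExact_pathConst {X : SSet.{u}} [Quasicategory X] : IsExact (pathConst X) := by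
  intro K _ S hS
  rw [← isUniversalCone_comp_iff_of_rlp_monomorphisms rlp_monomorphisms_pathEval_cylZero,
    Category.assoc, pathConst_pathEval, Category.comp_id]
  exact hS

/-- The path object of a finitely cocomplete quasicategory. -/
def path (D : FCQCat.{u}) : FCQCat.{u} where
  toSSet := pathSpace D.toSSet
  quasicategory := inferInstance
  finitelyCocomplete := isFinitelyCocomplete_of_rlp_monomorphisms
    rlp_monomorphisms_pathEval_cylZero D.finitelyCocomplete

/-- The starting point of a path. -/
def pathSource (D : FCQCat.{u}) : path D ⟶ D :=
  ofMap (pathEval (cylZero Δ[0]) D.toSSet)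
    (isExact_of_rlp_monomorphisms rlp_monomorphisms_pathEval_cylZero)

/-- The end point of a path. -/
def pathTarget (D : FCQCat.{u}) : path D ⟶ D :=
  ofMap (pathEval (cylOne Δ[0]) D.toSSet)
    (isExact_of_rlp_monomorphisms rlp_monomorphisms_pathEval_cylOne)

/-- The constant paths. -/
def constPath (D : FCQCat.{u}) : D ⟶ path D :=
  ofMap (pathConst D.toSSet) isExact_pathConst

lemma constPath_pathSource (D : FCQCat.{u}) : constPath D ≫ pathSource D = 𝟙 D :=
  Hom.ext (pathConst_pathEval _)

lemma constPath_pathTarget (D : FCQCat.{u}) : constPath D ≫ pathTarget D = 𝟙 D :=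
  Hom.ext (pathConst_pathEval _)

/-- A lift is found in C first. It prescribes the starting point and b the end point, and the path
itself is lifted through evaluation at both ends. -/
lemma hasLiftingProperty_comp_pathTarget {C D R A B : SSet.{u}} {F : C ⟶ D} {Q : R ⟶ C}
    {G : R ⟶ pathSpace D} (sq : IsPullback Q G F (pathEval (cylZero Δ[0]) D)) (i : A ⟶ B)
    [HasLiftingProperty i (stdSimplex.isTerminalObj₀.from C)]
    [HasLiftingProperty i (lift (pathEval (cylZero Δ[0]) D) (pathEval (cylOne Δ[0]) D))] :
    HasLiftingProperty i (G ≫ pathEval (cylOne Δ[0]) D) := by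
  refine ⟨fun {a b} w => ?_⟩
  have sq₁ : CommSq (a ≫ Q) i (stdSimplex.isTerminalObj₀.from C)
    (stdSimplex.isTerminalObj₀.from B) := ⟨stdSimplex.isTerminalObj₀.hom_ext _ _⟩
  have sq₂ : CommSq (a ≫ G) i (lift (pathEval (cylZero Δ[0]) D) (pathEval (cylOne Δ[0]) D))
      (lift (sq₁.lift ≫ F) b) := ⟨by
    refine CartesianMonoidalCategory.hom_ext _ _ ?_ ?_
    · rw [Category.assoc, lift_fst, Category.assoc, ← sq.w, Category.assoc i, lift_fst,
        ← Category.assoc i, sq₁.fac_left, Category.assoc]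
    · rw [Category.assoc, lift_snd, Category.assoc, w.w, Category.assoc i, lift_snd]⟩
  have h₁ := congrArg (· ≫ fst _ _) sq₂.fac_right
  have h₂ := congrArg (· ≫ snd _ _) sq₂.fac_right
  simp only [Category.assoc, lift_fst, lift_snd] at h₁ h₂
  refine ⟨⟨⟨sq.lift sq₁.lift sq₂.lift h₁.symm, sq.hom_ext ?_ ?_, ?_⟩⟩⟩
  · rw [Category.assoc, sq.lift_fst, sq₁.fac_left]
  · rw [Category.assoc, sq.lift_snd, sq₂.fac_left]
  · rw [← Category.assoc, sq.lift_snd, h₂]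

lemma fibrations_pathSource (D : FCQCat.{u}) : fibrations (pathSource D) :=
  isInnerIsofibration_of_rlp_monomorphisms rlp_monomorphisms_pathEval_cylZero

lemma exists_factorization {C D : FCQCat.{u}} (F : C ⟶ D) :
    ∃ (Z : FCQCat.{u}) (j : C ⟶ Z) (p : Z ⟶ D),
      weakEquivalences j ∧ fibrations p ∧ j ≫ p = F := by
  obtain ⟨R, Q, G, sq, sq'⟩ := exists_isPullback F (pathSource D) (fibrations_pathSource D)
  -- The map C ⟶ R sends an object to its image under F with the constant path. It is a section of
  -- Q, and Q lifts against all monomorphisms, so it is a categorical equivalence.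
  have w : 𝟙 C ≫ F = (F ≫ constPath D) ≫ pathSource D := by
    rw [Category.assoc, constPath_pathSource, Category.comp_id, Category.id_comp]
  have hQ : (MorphismProperty.monomorphisms SSet.{u}).rlp (mapOf Q) :=
    MorphismProperty.of_isPullback sq'.flip rlp_monomorphisms_pathEval_cylZero
  have h : mapOf (sq.lift _ _ w) ≫ mapOf Q = 𝟙 _ := congrArg mapOf (sq.lift_fst _ _ w)
  refine ⟨R, sq.lift _ _ w, G ≫ pathTarget D, ⟨mapOf Q, ?_, ?_⟩, ⟨fun A B i hi => ?_, ?_⟩, ?_⟩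
  · refine (isoHomotopy_of_rlp_monomorphisms hQ _ _ ?_).isoHomotopic
    rw [Category.assoc, h, Category.comp_id, Category.id_comp]
  · rw [h]
    exact .refl _
  · have h₁ := (isInnerIsofibration_of_quasicategory
      (stdSimplex.isTerminalObj₀.from C.toSSet)).1 i hi
    have h₂ := (isInnerIsofibration_lift_pathEval (D := D.toSSet)).1 i hi
    exact hasLiftingProperty_comp_pathTarget sq' i
  · have h₁ := (isInnerIsofibration_of_quasicategory (stdSimplex.isTerminalObj₀.from C.toSSet)).2
    have h₂ := (isInnerIsofibration_lift_pathEval (D := D.toSSet)).2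
    exact hasLiftingProperty_comp_pathTarget sq' coherentIsoZero
  · rw [← Category.assoc, sq.lift_snd, Category.assoc, constPath_pathTarget, Category.comp_id]

/-- The terminal finitely cocomplete quasicategory. -/
def point : FCQCat.{u} where
  toSSet := Δ[0]
  quasicategory := (quasicategory_iff_of_isTerminal (𝟙 _) stdSimplex.isTerminalObj₀).2
    ⟨MorphismProperty.id_mem _ _⟩
  finitelyCocomplete _ _ _ := ⟨stdSimplex.isTerminalObj₀.from _,
    stdSimplex.isTerminalObj₀.hom_ext _ _, fun _ _ _ => ⟨stdSimplex.isTerminalObj₀.from _,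
      stdSimplex.isTerminalObj₀.hom_ext _ _⟩⟩

/-- `point` is terminal. -/
def isTerminalPoint : IsTerminal point.{u} :=
  IsTerminal.ofUniqueHom
    (fun _ => ofMap (stdSimplex.isTerminalObj₀.from _) fun _ _ _ _ _ _ _ =>
      ⟨stdSimplex.isTerminalObj₀.from _, stdSimplex.isTerminalObj₀.hom_ext _ _⟩)
    fun _ _ => Hom.ext (stdSimplex.isTerminalObj₀.hom_ext _ _)

theorem isFibrationCategory :
    IsFibrationCategory FCQCat.{u} weakEquivalences fibrations where
  weq_multiplicative :=
    { id_mem C := IsCategoricalEquivalence.of_isIso (𝟙 C.toSSet)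
      comp_mem _ _ hf hg := IsCategoricalEquivalence.comp hf hg }
  fib_multiplicative :=
    { id_mem C := IsInnerIsofibration.of_isIso (𝟙 C.toSSet)
      comp_mem _ _ hf hg := IsInnerIsofibration.comp hf hg }
  two_out_of_six f g h hfg hgh := isCategoricalEquivalence_two_out_of_six _ _ _ hfg hgh
  iso_acyclic f hf :=
    have : IsIso (mapOf f) := inferInstanceAs (IsIso (forget.map f))
    ⟨IsCategoricalEquivalence.of_isIso _, IsInnerIsofibration.of_isIso _⟩
  hasTerminal := isTerminalPoint.hasTerminal
  fibrant {X T} hT f := by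
    -- The axiom allows any terminal object, so the known case of `point` is transported along the
    -- canonical isomorphism.
    let e : T ≅ point := hT.uniqueUpToIso isTerminalPoint
    have : IsIso (mapOf e.inv) := inferInstanceAs (IsIso (forget.map e.inv))
    have h : f = (f ≫ e.hom) ≫ e.inv := by simp
    rw [h]
    exact (isInnerIsofibration_of_quasicategory (mapOf (f ≫ e.hom))).comp
      (IsInnerIsofibration.of_isIso (mapOf e.inv))
  hasPullback f p hp := by
    obtain ⟨_, _, _, sq, -⟩ := exists_isPullback f p hp
    exact sq.hasPullback
  fib_baseChange := ⟨fun {_ _ _ _ f g f' g'} sq hg =>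
    IsInnerIsofibration.of_isPullback (isPullback_mapOf _ _ hg sq.flip).flip hg⟩
  acyclicFib_baseChange := ⟨fun {_ _ _ _ f g f' g'} sq hg => by
    have sq' := (isPullback_mapOf _ _ hg.2 sq.flip).flip
    have h := IsInnerIsofibration.isShrinkable hg.2 hg.1
    exact ⟨(h.of_isPullback sq').isCategoricalEquivalence,
      IsInnerIsofibration.of_isPullback sq' hg.2⟩⟩
  factorization := exists_factorization

end FCQCat

theorem mainTheorem3 :
    -- the fibration category structure
    IsFibrationCategory FCQCat.{u} FCQCat.weakEquivalences FCQCat.fibrations ∧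
    -- pullbacks along inner isofibrations, formed in simplicial sets, are finitely cocomplete
    -- quasicategories, are pullbacks for exact functors, and have colimits computed componentwise
    (∀ {C D E : FCQCat.{u}} (F : C ⟶ D) (P : E ⟶ D), FCQCat.fibrations P →
      ∀ (R : SSet.{u}) (Q : R ⟶ C.toSSet) (G : R ⟶ E.toSSet),
        IsPullback Q G (FCQCat.mapOf F) (FCQCat.mapOf P) →
        (∃ (hR : SSet.Quasicategory R) (hc : SSet.IsFinitelyCocomplete R)
            (hQ : SSet.IsExact Q) (hG : SSet.IsExact G),
          IsPullback (FCQCat.ofMap Q hQ : FCQCat.mk R hR hc ⟶ C)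
            (FCQCat.ofMap G hG : FCQCat.mk R hR hc ⟶ E) F P) ∧
        (∀ (K : SSet.{u}), K.Finite → ∀ S : SSet.underCone K ⟶ R,
          SSet.IsUniversalCone S ↔
            SSet.IsUniversalCone (S ≫ Q) ∧ SSet.IsUniversalCone (S ≫ G))) ∧
    -- lifting of colimits along inner isofibrations
    (∀ {C D : SSet.{u}}, SSet.Quasicategory C → SSet.Quasicategory D → ∀ P : C ⟶ D,
      SSet.IsInnerIsofibration P → ∀ {K : SSet.{u}} (X : K ⟶ C) (T : SSet.underCone K ⟶ D),
        SSet.coneBase K ≫ T = X ≫ P → SSet.IsUniversalCone T →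
        (∃ S' : SSet.underCone K ⟶ C, SSet.coneBase K ≫ S' = X ∧ SSet.IsUniversalCone S' ∧
          SSet.IsUniversalCone (S' ≫ P)) →
        ∃ S : SSet.underCone K ⟶ C, SSet.coneBase K ≫ S = X ∧ SSet.IsUniversalCone S ∧
          S ≫ P = T) := by
  refine ⟨FCQCat.isFibrationCategory, fun F P hP R Q G sq => ?_, ?_⟩
  · have hQ := SSet.isExact_fst_of_isPullback F P hP sq
    have hG := SSet.isExact_snd_of_isPullback F P hP sq
    have hR := SSet.quasicategory_of_isPullback F P hP sq
    have hc := SSet.isFinitelyCocomplete_of_isPullback F P hP sq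
    exact ⟨⟨hR, hc, hQ, hG, FCQCat.isPullback F P hP sq hR hc hQ hG⟩, fun K hK S =>
      ⟨fun hS => ⟨hQ K hK S hS, hG K hK S hS⟩,
        fun hS => SSet.isUniversalCone_of_isPullback F P hP sq hK S hS.1 hS.2⟩⟩
  · rintro C D hC hD P hP K X T hT hTu ⟨S', h₁, h₂, h₃⟩
    exact SSet.exists_isUniversalCone_lift hP T hT hTu S' h₁ h₂ h₃
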